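/- **LDP in CNNs.** Fix integers $L\ge 1$ (number of hidden layers), $P$ (number of inputs), $C_0$, spatial dimensions $N_0,\dots,N_{L+1}$, and finite mask index sets $\mathcal M_\ell$ with $M_\ell=|\mathcal M_\ell|$, $\ell=0,\dots,L$. Let $\lambda_0,\dots,\lambda_L>0$, let $\sigma:\mathbb R\to\mathbb R$ be an activation function, let $R^{(i,\ell)}=(R^{(i,\ell)}_m)_{m\in\mathcal M_\ell}:\mathbb R^{N_\ell}\to\mathbb R^{M_\ell}$ ($i=1,\dots,N_{\ell+1}$, $\ell=0,\dots,L$) be patch extractors, and fix inputs $\mathbf x_\mu=[x_{\mu,c,i}]\in\mathbb R^{C_0\times N_0}$, $\mu=1,\dots,P$. For each $n\ge1$ let $C_1(n),\dots,C_{L+1}(n)$ be channel counts, $C_0(n):=C_0$, and define, for $c=1,\dots,C_{\ell+1}(n)$ and $i=1,\dots,N_{\ell+1}$, $$h^{(1)}_{c,i}(\mathbf x_\mu)=\frac1{\sqrt{M_0C_0}}\sum_{c'=1}^{C_0}\sum_{m\in\mathcal M_0}W^{(0)}_{m,c',c}R^{(i,0)}_m(x_{\mu,c',:}),$$ $$h^{(\ell+1)}_{c,i}(\mathbf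 x_\mu)=\frac1{\sqrt{M_\ell C_\ell(n)}}\sum_{c'=1}^{C_\ell(n)}\sum_{m\in\mathcal M_\ell}W^{(\ell)}_{m,c',c}\,\sigma\big(R^{(i,\ell)}_m(h^{(\ell)}_{c',:}(\mathbf x_\mu))\big),\qquad \ell=1,\dots,L.$$ Assume: 1. (Gaussian prior) for each $n$ the weights $W^{(\ell)}_{m,c',c}$, $\ell=0,\dots,L$, $m\in\mathcal M_\ell$, $c'\le C_\ell(n)$, $c\le C_{\ell+1}(n)$, are independent random variables with $W^{(\ell)}_{m,c',c}\sim\mathcal N(0,\lambda_\ell^{-1})$; 2. (infinite channels limit) $C_\ell(n)/n\to\alpha_\ell\in(0,+\infty)$ as $n\to\infty$, for $\ell=1,\dots,L$; 3. (asymptotic Lipschitz condition) $\sigma$ is continuous and $|\sigma(x)-\sigma(y)|\le L_\sigma|x-y|+\rho_\sigma(x)+\rho_\sigma(y)$ for all $x,y\in\mathbb R$, for some constant $L_\sigma\ge0$ and some locally bounded $\rho_\sigma$ with $\rho_\sigma(x)=o(|x|)$ as $|x|\to\infty$; for $\ell=1,\dots,L$ and $i=1,\dots,N_{\ell+1}$,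 $R^{(i,\ell)}$ is continuous and $\|R^{(i,\ell)}(z)-R^{(i,\ell)}(z')\|\le L_R\|z-z'\|+\rho_R(z)+\rho_R(z')$ for all $z,z'\in\mathbb R^{N_\ell}$, for some constant $L_R\ge0$ and some function $\rho_R$ with $\rho_R(z)=o(\|z\|)$ as $\|z\|\to\infty$. Let $D_\ell=N_\ell P$, let $\mathcal S_D$ be the set of symmetric real $D\times D$ matrices and $\mathcal S^+_D\subset\mathcal S_D$ the cone of positive semidefinite ones. For $z\in\mathbb R^{N_\ell\times P}\cong\mathbb R^{D_\ell}$ let $G^{(\ell)}(z)\in\mathcal S^+_{D_{\ell+1}}$ be the matrix with entries $$[G^{(\ell)}(z)]_{i,\mu;j,\nu}=\frac1{\lambda_\ell M_\ell}\sum_{m\in\mathcal M_\ell}\sigma\big(R^{(i,\ell)}_m(z_{:,\mu})\big)\,\sigma\big(R^{(j,\ell)}_m(z_{:,\nu})\big),$$ and define the (conditional) covariance matrices $$\mathbf K^{(1)}_{i,\mu;j,\nu}=\frac1{\lambda_0C_0M_0}\sum_{c=1}^{C_0}\sum_{m\in\mathcal M_0}R^{(i,0)}_m(x_{\mu,c,:})R^{(j,0)}_m(x_{\nu,c,:}),\qquad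 \mathbf K^{(\ell+1,n)}=\frac1{C_\ell(n)}\sum_{c=1}^{C_\ell(n)}G^{(\ell)}\big([h^{(\ell)}_{c,i}(\mathbf x_\mu)]_{i,\mu}\big),\quad \ell=1,\dots,L.$$ For $Q_1\in\mathcal S^+_{D_\ell}$ and $Q_2\in\mathcal S^+_{D_{\ell+1}}$ set $$I_\ell(Q_2|Q_1)=\sup_{Q_0\in\mathcal S_{D_{\ell+1}}}\Big\{\operatorname{tr}(Q_0^\top Q_2)-\log\int_{\mathbb R^{D_\ell}}e^{\operatorname{tr}(Q_0^\top G^{(\ell)}(z))}\,\mathcal N(dz\mid\mathbf 0,Q_1)\Big\}.$$ Then the laws of the random tuples $(\mathbf K^{(2,n)},\dots,\mathbf K^{(L+1,n)})$ satisfy, as $n\to\infty$, a large deviation principle on $\mathcal S^+_{D_2}\times\dots\times\mathcal S^+_{D_{L+1}}$ with speed $n$ and rate function $$I_{2,\dots,L+1}(Q_2,\dots,Q_{L+1})=\alpha_1I_1(Q_2|\mathbf K^{(1)})+\sum_{\ell=2}^L\alpha_\ell I_\ell(Q_{\ell+1}|Q_\ell),$$ and this rate function is good. That is, $I:=I_{2,\dots,L+1}$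 takes values in $(-\infty,+\infty]$, is lower semicontinuous and has compact sublevel sets, and the laws $\mu_n$ satisfy $\liminf_n\frac1n\log\mu_n(O)\ge-\inf_OI$ for every open $O$ and $\limsup_n\frac1n\log\mu_n(F)\le-\inf_FI$ for every closed $F$. -/

import Mathlib

open MeasureTheory ProbabilityTheory Filter Topology
open scoped NNReal ENNReal

noncomputable section

/-- The cone of symmetric positive semidefinite real matrices indexed by `ι`, with the topology
inherited from the space of matrices and the Borel `σ`-algebra. -/
abbrev PSDCone (ι : Type) [Fintype ι] : Type := {Q : Matrix ι ι ℝ // Q.PosSemidef}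

instance PSDCone.instMeasurableSpace (ι : Type) [Fintype ι] : MeasurableSpace (PSDCone ι) :=
  borel _

instance PSDCone.instBorelSpace (ι : Type) [Fintype ι] : BorelSpace (PSDCone ι) := ⟨rfl⟩

instance PSDCone.instSecondCountable (ι : Type) [Fintype ι] :
    SecondCountableTopology (PSDCone ι) :=
  haveI : SecondCountableTopology (Matrix ι ι ℝ) :=
    inferInstanceAs (SecondCountableTopology (ι → ι → ℝ))
  inferInstanceAs (SecondCountableTopology ({Q | Q.PosSemidef} : Set (Matrix ι ι ℝ)))

/-! ### Large deviation principles with speed `n` -/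

/-- `I` takes values in `(-∞, +∞]`, is lower semicontinuous, and has compact sublevel sets. -/
def IsGoodRateFunction {X : Type*} [TopologicalSpace X] (I : X → EReal) : Prop :=
  (∀ x, I x ≠ ⊥) ∧ LowerSemicontinuous I ∧ ∀ a : ℝ, IsCompact {x | I x ≤ (a : EReal)}

/-- The measures `μ n` satisfy the large deviation bounds with speed `n` and rate function `I`. -/
def SatisfiesLDP {X : Type*} [TopologicalSpace X] [MeasurableSpace X] [BorelSpace X]
    (μ : ℕ → Measure X) (I : X → EReal) : Prop :=
  (∀ O : Set X, IsOpen O →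
    -(⨅ x ∈ O, I x) ≤ liminf (fun n : ℕ => ENNReal.log (μ n O) / (n : EReal)) atTop) ∧
  (∀ F : Set X, IsClosed F →
    limsup (fun n : ℕ => ENNReal.log (μ n F) / (n : EReal)) atTop ≤ -(⨅ x ∈ F, I x))

/-! ### Asymptotic Lipschitz conditions -/

/-- The activation function is continuous and asymptotically Lipschitz. -/
def AsympLipschitzActivation (σ : ℝ → ℝ) : Prop :=
  Continuous σ ∧ ∃ (Lσ : ℝ) (ρ : ℝ → ℝ), 0 ≤ Lσ ∧
    (∀ r : ℝ, ∃ B : ℝ, ∀ x : ℝ, |x| ≤ r → |ρ x| ≤ B) ∧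
    ρ =o[Bornology.cobounded ℝ] (fun x : ℝ => |x|) ∧
    ∀ x y : ℝ, |σ x - σ y| ≤ Lσ * |x - y| + ρ x + ρ y

/-- A map between finite-dimensional Euclidean spaces is continuous and asymptotically Lipschitz
(with respect to the Euclidean norms). -/
def AsympLipschitzMap {ι κ : Type} [Fintype ι] [Fintype κ] (f : (ι → ℝ) → (κ → ℝ)) : Prop :=
  Continuous f ∧ ∃ (LR : ℝ) (ρ : (ι → ℝ) → ℝ), 0 ≤ LR ∧
    ρ =o[Bornology.cobounded (ι → ℝ)] (fun z : ι → ℝ => ‖WithLp.toLp 2 z‖) ∧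
    ∀ z z' : ι → ℝ, ‖WithLp.toLp 2 (f z - f z')‖ ≤ LR * ‖WithLp.toLp 2 (z - z')‖ + ρ z + ρ z'

/-! ### Convolutional networks -/

/-- The fixed (non-random, independent of the scaling parameter) data of a convolutional network.
Layers are numbered by natural numbers; only the layers `0, …, L + 1` play a role. -/
structure ConvNet where
  /-- number of hidden layers -/
  L : ℕ
  /-- number of inputs -/
  P : ℕ
  /-- number of input channels -/
  C₀ : ℕ
  /-- spatial dimensions -/
  N : ℕ → ℕ
  /-- index sets of the masks -/
  Mask : ℕ → Type
  /-- the masks are finite -/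
  maskFintype : ∀ ℓ, Fintype (Mask ℓ)
  /-- activation function -/
  σ : ℝ → ℝ
  /-- patch extractors: `R ℓ i z m` is the component `m` of the receptive field, extracted from the
  spatial vector `z` of layer `ℓ`, of the neuron at position `i` of layer `ℓ + 1` -/
  R : (ℓ : ℕ) → Fin (N (ℓ + 1)) → (Fin (N ℓ) → ℝ) → (Mask ℓ → ℝ)
  /-- precisions of the weights -/
  prec : ℕ → ℝ≥0
  /-- the inputs: `x μ c i` -/
  x : Fin P → Fin C₀ → Fin (N 0) → ℝ

namespace ConvNet

attribute [instance] ConvNet.maskFintype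

variable (A : ConvNet)

/-- The index set of pairs (spatial position at layer `ℓ`, input); it has `N ℓ * P` elements. -/
abbrev Idx (ℓ : ℕ) : Type := Fin (A.N ℓ) × Fin A.P

/-- Number of channels of each layer, the layers `ℓ ≥ 1` having `C ℓ` channels. -/
def chan (C : ℕ → ℕ) : ℕ → ℕ
  | 0 => A.C₀
  | ℓ + 1 => C (ℓ + 1)

/-- Values of all the weights: `w ℓ m c' c` is the weight `W^{(ℓ)}_{m,c',c}`. -/
abbrev Weights (C : ℕ → ℕ) : Type :=
  (ℓ : ℕ) → A.Mask ℓ → Fin (A.chan C ℓ) → Fin (A.chan C (ℓ + 1)) → ℝ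

/-- Pre-activations: `A.preact C w ℓ c (i, μ)` is `h^{(ℓ+1)}_{c,i}(x_μ)`. -/
def preact (C : ℕ → ℕ) (w : A.Weights C) :
    (ℓ : ℕ) → Fin (A.chan C (ℓ + 1)) → A.Idx (ℓ + 1) → ℝ
  | 0, c, p =>
      1 / √((Fintype.card (A.Mask 0) : ℝ) * (A.chan C 0 : ℝ)) *
        ∑ c' : Fin (A.chan C 0), ∑ m : A.Mask 0, w 0 m c' c * A.R 0 p.1 (A.x p.2 c') m
  | ℓ + 1, c, p =>
      1 / √((Fintype.card (A.Mask (ℓ + 1)) : ℝ) * (A.chan C (ℓ + 1) : ℝ)) *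
        ∑ c' : Fin (A.chan C (ℓ + 1)), ∑ m : A.Mask (ℓ + 1),
          w (ℓ + 1) m c' c * A.σ (A.R (ℓ + 1) p.1 (fun i => preact C w ℓ c' (i, p.2)) m)

/-- The matrix-valued function `G^{(ℓ)}`. -/
def G (ℓ : ℕ) (z : A.Idx ℓ → ℝ) : Matrix (A.Idx (ℓ + 1)) (A.Idx (ℓ + 1)) ℝ :=
  Matrix.of fun p q =>
    1 / ((A.prec ℓ : ℝ) * (Fintype.card (A.Mask ℓ) : ℝ)) *
      ∑ m : A.Mask ℓ, A.σ (A.R ℓ p.1 (fun i => z (i, p.2)) m) *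
        A.σ (A.R ℓ q.1 (fun i => z (i, q.2)) m)

/-- The deterministic covariance matrix `K^{(1)}` of the first layer. -/
def K1Mat : Matrix (A.Idx 1) (A.Idx 1) ℝ :=
  Matrix.of fun p q =>
    1 / ((A.prec 0 : ℝ) * (A.C₀ : ℝ) * (Fintype.card (A.Mask 0) : ℝ)) *
      ∑ c : Fin A.C₀, ∑ m : A.Mask 0, A.R 0 p.1 (A.x p.2 c) m * A.R 0 q.1 (A.x q.2 c) m

/-- `A.KMat C w ℓ` is the conditional covariance matrix `K^{(ℓ+2)}`, the average of
`G^{(ℓ+1)}(H^{(ℓ+1)}_{c,:,:})` over the channels `c` of layer `ℓ + 1`. -/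
def KMat (C : ℕ → ℕ) (w : A.Weights C) (ℓ : ℕ) : Matrix (A.Idx (ℓ + 2)) (A.Idx (ℓ + 2)) ℝ :=
  (1 / (A.chan C (ℓ + 1) : ℝ)) • ∑ c : Fin (A.chan C (ℓ + 1)), A.G (ℓ + 1) (A.preact C w ℓ c)

theorem posSemidef_gram {ι κ : Type} [Fintype ι] [Fintype κ] (a : ℝ) (ha : 0 ≤ a)
    (u : κ → ι → ℝ) :
    (Matrix.of fun p q => a * ∑ k, u k p * u k q : Matrix ι ι ℝ).PosSemidef := by
  have h : (Matrix.of fun p q => a * ∑ k, u k p * u k q : Matrix ι ι ℝ) =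
      a • ∑ k, Matrix.vecMulVec (u k) (star (u k)) := by
    ext p q
    simp [Matrix.sum_apply, Matrix.vecMulVec_apply]
  rw [h]
  exact (Matrix.posSemidef_sum _ fun k _ => Matrix.posSemidef_vecMulVec_self_star (u k)).smul ha

theorem G_posSemidef (ℓ : ℕ) (z : A.Idx ℓ → ℝ) : (A.G ℓ z).PosSemidef :=
  posSemidef_gram _ (by positivity)
    (fun (m : A.Mask ℓ) (p : A.Idx (ℓ + 1)) => A.σ (A.R ℓ p.1 (fun i => z (i, p.2)) m))

theorem K1Mat_posSemidef : A.K1Mat.PosSemidef := by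
  have h := posSemidef_gram (1 / ((A.prec 0 : ℝ) * (A.C₀ : ℝ) * (Fintype.card (A.Mask 0) : ℝ)))
    (by positivity)
    (fun (k : Fin A.C₀ × A.Mask 0) (p : A.Idx 1) => A.R 0 p.1 (A.x p.2 k.1) k.2)
  simpa only [K1Mat, Fintype.sum_prod_type] using h

theorem KMat_posSemidef (C : ℕ → ℕ) (w : A.Weights C) (ℓ : ℕ) : (A.KMat C w ℓ).PosSemidef :=
  (Matrix.posSemidef_sum _ fun _ _ => A.G_posSemidef _ _).smul (by positivity)

/-- `K^{(1)}` as a point of the cone. -/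
def K1 : PSDCone (A.Idx 1) := ⟨A.K1Mat, A.K1Mat_posSemidef⟩

/-- The space of tuples `(Q_2, …, Q_{L+1})`, the component `k` being `Q_{k+2}`. -/
abbrev CovTuple : Type := (k : Fin A.L) → PSDCone (A.Idx (k + 2))

/-- The tuple `(K^{(2)}, …, K^{(L+1)})` of conditional covariance matrices. -/
def covTuple (C : ℕ → ℕ) (w : A.Weights C) : A.CovTuple :=
  fun k => ⟨A.KMat C w k, A.KMat_posSemidef C w k⟩

/-- The conditional rate `I_ℓ(Q₂ | Q₁)`: the Legendre transform, over symmetric matrices, of the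
log-moment generating function (with values in `(-∞, +∞]`) of `G^{(ℓ)}` under `N(0, Q₁)`. -/
def condRate (ℓ : ℕ) (Q₂ : PSDCone (A.Idx (ℓ + 1))) (Q₁ : PSDCone (A.Idx ℓ)) : EReal :=
  ⨆ (Q₀ : Matrix (A.Idx (ℓ + 1)) (A.Idx (ℓ + 1)) ℝ) (_ : Q₀.IsSymm),
    (((Q₀.transpose * Q₂.1).trace : ℝ) : EReal) -
      ENNReal.log (∫⁻ z : EuclideanSpace ℝ (A.Idx ℓ),
        ENNReal.ofReal (Real.exp ((Q₀.transpose * A.G ℓ z.ofLp).trace))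
          ∂(multivariateGaussian 0 Q₁.1))

/-- For a tuple `(Q_2, …, Q_{L+1})` and `k ≤ L`, the matrix `Q_{k+1}`, where `Q_1 := K^{(1)}`. -/
def entry (Q : A.CovTuple) : (k : ℕ) → k ≤ A.L → PSDCone (A.Idx (k + 1))
  | 0, _ => A.K1
  | k + 1, h => Q ⟨k, h⟩

/-- The joint rate function
`α_1 I_1(Q_2 | K^{(1)}) + ∑_{ℓ=2}^{L} α_ℓ I_ℓ(Q_{ℓ+1} | Q_ℓ)`;
the summand with index `k` is the one with `ℓ = k + 1`. -/
def rate (α : ℕ → ℝ) (Q : A.CovTuple) : EReal :=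
  ∑ k : Fin A.L,
    (α (k + 1) : EReal) * A.condRate (k + 1) (Q k) (A.entry Q k k.2.le)

/-- The index set of the weights of the layers `0, …, L`. -/
abbrev WeightIdx (C : ℕ → ℕ) : Type :=
  (ℓ : Fin (A.L + 1)) × (A.Mask ℓ × Fin (A.chan C ℓ) × Fin (A.chan C (ℓ + 1)))

end ConvNet

end

/-! Conditionally on the preceding layers, the channels of a layer are independent centred Gaussian
vectors whose covariance matrix is the current `cov`
(`IsGaussianWeights.measure_inter_preactVec_mem`). So `cov` is a Markov chain started at the
deterministic K^(1), and one step replaces q by the empirical mean of G over independent samples of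
N(0, q), with a number of samples proportional to n. The theorem follows from a Cramér theorem for
one step, locally uniform in q, composed along the L steps.

Two obstacles arise. G grows quadratically, so the exponential moments of tr(θᵀG) under N(0, q) can
be infinite for large θ; and their finiteness can change with q, so they are not continuous in q.

For the upper bound, a dual matrix θ that witnesses the rate at (Q₂, Q₁) is multiplied by some s <
1. The room gained in integrability gives continuity of the moment in q near Q₁ (`tendsto_gaussMGF`,
`exists_scaled_gaussMGF_le`), and Chernoff's bound on a half-space then holds for all q near Q₁
(`exists_layerLaw_le_of_lt_condRate`). This continuity rests on writing N(0, q) as the image of one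
standard Gaussian under √q, and on the asymptotic Lipschitz condition: moving q slightly changes
tr(θᵀG) by at most a small multiple of ‖ξ‖² plus a constant (`NearQuadratic`), which Fernique's
theorem absorbs.

For the lower bound, tilting is done with exp(⟪θ, y⟫ - k‖y‖²), whose moments are all bounded, and
the log-moment function is penalised by δ‖θ‖². The minimiser exists and its tilted mean is -2δθ,
which is small; a change of measure with Chebyshev's inequality concludes (`cramer_lower_bound`). No
steepness or finiteness of the moments is required.

Small multiples of the identity as dual matrices control traces. Applied layer after layer, they
give both exponential tightness (`exists_measure_trace_gt_le`) and compact sublevel sets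
(`isGoodRateFunction_rate`). -/

noncomputable section

/-! ### Product measures -/

section ProductMeasure

variable {ι Z : Type*} [Fintype ι] [MeasurableSpace Z]

theorem lintegral_pi_prod (γ : Measure Z) [IsProbabilityMeasure γ] (f : ι → Z → ℝ≥0∞)
    (hf : ∀ i, Measurable (f i)) :
    ∫⁻ z, ∏ i, f i (z i) ∂(Measure.pi fun _ : ι => γ) = ∏ i, ∫⁻ x, f i x ∂γ := by
  have hind : iIndepFun (fun i (z : ι → Z) => f i (z i)) (Measure.pi fun _ : ι => γ) :=
    iIndepFun_pi (X := f) fun i => (hf i).aemeasurable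
  rw [lintegral_prod_eq_prod_lintegral_of_indepFun _ _ hind
    fun i => (hf i).comp (measurable_pi_apply i)]
  refine Finset.prod_congr rfl fun i _ => ?_
  exact (measurePreserving_eval (fun _ : ι => γ) i).lintegral_comp (hf i)

/-- A product measure is determined by rectangles, and on a rectangle the indicator times the
product density splits coordinatewise. This turns the tilt of one sample into a tilt of the whole
family. -/
theorem pi_withDensity (γ : Measure Z) [IsProbabilityMeasure γ] (w : Z → ℝ≥0∞)
    (hw : Measurable w) [IsProbabilityMeasure (γ.withDensity w)] :
    Measure.pi (fun _ : ι => γ.withDensity w) =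
      (Measure.pi fun _ : ι => γ).withDensity fun z => ∏ i, w (z i) := by
  refine Measure.pi_eq fun s hs => ?_
  rw [withDensity_apply _ (MeasurableSet.univ_pi hs),
    ← lintegral_indicator (MeasurableSet.univ_pi hs)]
  have h : ∀ z : ι → Z, (Set.univ.pi s).indicator (fun z => ∏ i, w (z i)) z =
      ∏ i, (s i).indicator w (z i) := by
    intro z
    by_cases hz : z ∈ Set.univ.pi s
    · rw [Set.indicator_of_mem hz]
      exact Finset.prod_congr rfl fun i _ => (Set.indicator_of_mem (hz i trivial) _).symm
    · rw [Set.indicator_of_notMem hz]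
      simp only [Set.mem_pi, Set.mem_univ, true_implies, not_forall] at hz
      obtain ⟨i, hi⟩ := hz
      exact (Finset.prod_eq_zero (Finset.mem_univ i) (Set.indicator_of_notMem hi _)).symm
  simp_rw [h]
  rw [lintegral_pi_prod _ _ fun i => hw.indicator (hs i)]
  refine Finset.prod_congr rfl fun i _ => ?_
  rw [lintegral_indicator (hs i), withDensity_apply _ (hs i)]

/-- Chernoff's bound for sums of independent copies. -/
theorem pi_sum_ge_le_exp (γ : Measure Z) [IsProbabilityMeasure γ] {f : Z → ℝ} (hf : Measurable f)
    {a c : ℝ} (h : ∫⁻ x, ENNReal.ofReal (Real.exp (f x)) ∂γ ≤ ENNReal.ofReal (Real.exp c)) :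
    (Measure.pi fun _ : ι => γ) {z | Fintype.card ι * a ≤ ∑ i, f (z i)} ≤
      ENNReal.ofReal (Real.exp (-(Fintype.card ι * (a - c)))) := by
  have hsum : ∀ z : ι → Z, ENNReal.ofReal (Real.exp (∑ i, f (z i))) =
      ∏ i, ENNReal.ofReal (Real.exp (f (z i))) := fun z => by
    rw [Real.exp_sum, ENNReal.ofReal_prod_of_nonneg fun i _ => (Real.exp_pos _).le]
  have hmeas : Measurable fun z : ι → Z => ENNReal.ofReal (Real.exp (∑ i, f (z i))) := by
    have : ∀ i, Measurable fun z : ι → Z => f (z i) := fun i => hf.comp (measurable_pi_apply i)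
    fun_prop
  have hM := mul_meas_ge_le_lintegral (μ := Measure.pi fun _ : ι => γ) hmeas
    (ENNReal.ofReal (Real.exp (Fintype.card ι * a)))
  simp_rw [hsum] at hM
  rw [lintegral_pi_prod γ (fun _ x => ENNReal.ofReal (Real.exp (f x)))
    fun _ => by fun_prop] at hM
  simp_rw [← hsum] at hM
  have hset : {z : ι → Z | ENNReal.ofReal (Real.exp (Fintype.card ι * a)) ≤
      ENNReal.ofReal (Real.exp (∑ i, f (z i)))} = {z | Fintype.card ι * a ≤ ∑ i, f (z i)} := by
    ext z
    simp [ENNReal.ofReal_le_ofReal_iff (Real.exp_pos _).le]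
  rw [hset, Finset.prod_const, Finset.card_univ] at hM
  have hM' := hM.trans (pow_le_pow_left' h (Fintype.card ι))
  rw [← ENNReal.ofReal_pow (Real.exp_pos _).le, ← Real.exp_nat_mul] at hM'
  have hpos : ENNReal.ofReal (Real.exp (Fintype.card ι * a)) ≠ 0 := by
    simp [Real.exp_pos]
  rw [mul_comm, ← ENNReal.le_div_iff_mul_le (Or.inl hpos) (Or.inl ENNReal.ofReal_ne_top),
    ← ENNReal.ofReal_div_of_pos (Real.exp_pos _), ← Real.exp_sub] at hM'
  refine hM'.trans (le_of_eq ?_)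
  congr 2
  ring

end ProductMeasure

/-! ### Chebyshev's inequality for empirical means of Euclidean vectors -/

section Chebyshev

variable {ι Ξ κ : Type*} [Fintype ι] [MeasurableSpace Ξ] [Fintype κ]

/-- The squared norm is a sum over coordinates, and each coordinate of the mean has variance at most
n⁻¹ times a second moment. The uncentred second moment is good enough: only the decay in n matters.
-/
theorem pi_norm_mean_sub_ge_le (ν : Measure Ξ) [IsProbabilityMeasure ν]
    {y : Ξ → EuclideanSpace ℝ κ} (hy : MemLp y 2 ν) [Nonempty ι]
    {s : ℝ} (hs : 0 < s) :
    (Measure.pi fun _ : ι => ν).real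
        {ξ | s ≤ ‖(Fintype.card ι : ℝ)⁻¹ • ∑ i, y (ξ i) - ∫ x, y x ∂ν‖} ≤
      (∫ x, ‖y x‖ ^ 2 ∂ν) / (Fintype.card ι * s ^ 2) := by
  set P := Measure.pi fun _ : ι => ν
  set n : ℝ := (Fintype.card ι : ℝ) with hndef
  have hn : 0 < n := by simpa [hndef] using Fintype.card_pos (α := ι)
  have hcoord : ∀ k, MemLp (fun x => y x k) 2 ν := fun k =>
    ((EuclideanSpace.proj k : EuclideanSpace ℝ κ →L[ℝ] ℝ).comp_memLp' hy)
  have hint : Integrable y ν := hy.integrable one_le_two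
  have hintk : ∀ k, (∫ x, y x ∂ν) k = ∫ x, y x k ∂ν := fun k =>
    ((EuclideanSpace.proj k : EuclideanSpace ℝ κ →L[ℝ] ℝ).integral_comp_comm hint).symm
  have hev : ∀ i k, MemLp (fun ξ : ι → Ξ => y (ξ i) k) 2 P := fun i k =>
    (hcoord k).comp_measurePreserving (measurePreserving_eval (fun _ : ι => ν) i)
  have hmean : ∀ k, MemLp (fun ξ : ι → Ξ => n⁻¹ * ∑ i, y (ξ i) k) 2 P := fun k =>
    (memLp_finsetSum _ fun i _ => hev i k).const_mul _
  have hE : ∀ k, ∫ ξ, n⁻¹ * ∑ i, y (ξ i) k ∂P = ∫ x, y x k ∂ν := by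
    intro k
    rw [integral_const_mul, integral_finsetSum _ fun i _ => (hev i k).integrable one_le_two]
    have : ∀ i, ∫ ξ, y (ξ i) k ∂P = ∫ x, y x k ∂ν := fun i =>
      integral_comp_eval (μ := fun _ : ι => ν) (i := i) (hcoord k).aestronglyMeasurable
    simp_rw [this]
    simp only [Finset.sum_const, Finset.card_univ, nsmul_eq_mul]
    change n⁻¹ * (n * _) = _
    field_simp
  have hV : ∀ k, Var[fun ξ : ι → Ξ => n⁻¹ * ∑ i, y (ξ i) k; P] ≤ n⁻¹ * ∫ x, (y x k) ^ 2 ∂ν := by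
    intro k
    rw [variance_const_mul]
    have h1 : (fun ξ : ι → Ξ => ∑ i, y (ξ i) k) = ∑ i, fun ξ : ι → Ξ => y (ξ i) k := by
      ext ξ; simp
    rw [h1, variance_sum_pi (X := fun _ x => y x k) fun _ => hcoord k]
    simp only [Finset.sum_const, Finset.card_univ, nsmul_eq_mul]
    change (n⁻¹) ^ 2 * (n * _) ≤ _
    have h2 : Var[fun x => y x k; ν] ≤ ∫ x, (y x k) ^ 2 ∂ν :=
      variance_le_expectation_sq (hcoord k).aestronglyMeasurable
    calc (n⁻¹) ^ 2 * (n * Var[fun x => y x k; ν]) = n⁻¹ * Var[fun x => y x k; ν] := by field_simp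
      _ ≤ _ := by gcongr
  have hnorm : ∀ ξ : ι → Ξ, ‖n⁻¹ • ∑ i, y (ξ i) - ∫ x, y x ∂ν‖ ^ 2 =
      ∑ k, (n⁻¹ * ∑ i, y (ξ i) k - ∫ x, y x k ∂ν) ^ 2 := by
    intro ξ
    rw [EuclideanSpace.real_norm_sq_eq]
    refine Finset.sum_congr rfl fun k _ => ?_
    rw [← hintk k]
    simp
  have hsqint : ∀ k, Integrable
      (fun ξ : ι → Ξ => (n⁻¹ * ∑ i, y (ξ i) k - ∫ x, y x k ∂ν) ^ 2) P := fun k =>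
    ((hmean k).sub (memLp_const _)).integrable_sq
  have hI : Integrable (fun ξ : ι → Ξ => ‖n⁻¹ • ∑ i, y (ξ i) - ∫ x, y x ∂ν‖ ^ 2) P := by
    simp_rw [hnorm]
    exact integrable_finsetSum _ fun k _ => hsqint k
  have hM := mul_meas_ge_le_integral_of_nonneg (μ := P)
    (ae_of_all _ fun ξ => sq_nonneg ‖n⁻¹ • ∑ i, y (ξ i) - ∫ x, y x ∂ν‖) hI (s ^ 2)
  have hset : {ξ : ι → Ξ | s ^ 2 ≤ ‖n⁻¹ • ∑ i, y (ξ i) - ∫ x, y x ∂ν‖ ^ 2} =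
      {ξ | s ≤ ‖n⁻¹ • ∑ i, y (ξ i) - ∫ x, y x ∂ν‖} := by
    ext ξ
    exact pow_le_pow_iff_left₀ hs.le (norm_nonneg _) two_ne_zero
  rw [hset] at hM
  have hbound : ∫ ξ, ‖n⁻¹ • ∑ i, y (ξ i) - ∫ x, y x ∂ν‖ ^ 2 ∂P ≤ n⁻¹ * ∫ x, ‖y x‖ ^ 2 ∂ν := by
    simp_rw [hnorm]
    rw [integral_finsetSum _ fun k _ => hsqint k]
    calc ∑ k, ∫ ξ, (n⁻¹ * ∑ i, y (ξ i) k - ∫ x, y x k ∂ν) ^ 2 ∂P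
        = ∑ k, Var[fun ξ : ι → Ξ => n⁻¹ * ∑ i, y (ξ i) k; P] := by
          refine Finset.sum_congr rfl fun k _ => ?_
          rw [variance_eq_integral (hmean k).aestronglyMeasurable.aemeasurable, hE k]
      _ ≤ ∑ k, n⁻¹ * ∫ x, (y x k) ^ 2 ∂ν := Finset.sum_le_sum fun k _ => hV k
      _ = n⁻¹ * ∫ x, ‖y x‖ ^ 2 ∂ν := by
          simp_rw [EuclideanSpace.real_norm_sq_eq]
          rw [integral_finsetSum _ fun k _ => (hcoord k).integrable_sq, Finset.mul_sum]
  rw [le_div_iff₀ (by positivity)]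
  have := hM.trans hbound
  calc P.real {ξ | s ≤ ‖n⁻¹ • ∑ i, y (ξ i) - ∫ x, y x ∂ν‖} * (n * s ^ 2)
      = n * (s ^ 2 * P.real {ξ | s ≤ ‖n⁻¹ • ∑ i, y (ξ i) - ∫ x, y x ∂ν‖}) := by ring
    _ ≤ n * (n⁻¹ * ∫ x, ‖y x‖ ^ 2 ∂ν) := by gcongr
    _ = _ := by field_simp

end Chebyshev

/-! ### Gaussian-damped exponential tilting -/

section Tilt

open scoped RealInnerProductSpace

variable {κ : Type*} [Fintype κ]

/-- The exponential weight `exp ⟪θ, y⟫`, damped by a Gaussian factor. -/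
def dampedExp (θ : EuclideanSpace ℝ κ) (k : ℝ) (y : EuclideanSpace ℝ κ) : ℝ :=
  Real.exp (⟪θ, y⟫ - k * ‖y‖ ^ 2)

/-- A common bound for the damped weight and its first two moments. -/
def dampedBound (a k : ℝ) : ℝ := Real.exp ((a + 2) ^ 2 / (4 * k))

theorem dampedExp_pos (θ : EuclideanSpace ℝ κ) (k : ℝ) (y : EuclideanSpace ℝ κ) :
    0 < dampedExp θ k y := Real.exp_pos _

theorem continuous_dampedExp (θ : EuclideanSpace ℝ κ) (k : ℝ) : Continuous (dampedExp θ k) := by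
  unfold dampedExp
  fun_prop

/-- Complete the square in ‖y‖. The cases j = 0, 1, 2 dominate the weight and its first two moments,
so one constant serves all three. -/
theorem exp_norm_mul_dampedExp_le {θ : EuclideanSpace ℝ κ} {a k j : ℝ} (hθ : ‖θ‖ ≤ a)
    (hk : 0 < k) (hj : j ≤ 2) (y : EuclideanSpace ℝ κ) :
    Real.exp (j * ‖y‖) * dampedExp θ k y ≤ dampedBound a k := by
  unfold dampedExp dampedBound
  rw [← Real.exp_add, Real.exp_le_exp, le_div_iff₀ (by positivity)]
  have h1 : ⟪θ, y⟫ ≤ a * ‖y‖ := (real_inner_le_norm θ y).trans (by gcongr)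
  have h2 : j * ‖y‖ ≤ 2 * ‖y‖ := by gcongr
  nlinarith [sq_nonneg (2 * k * ‖y‖ - (a + 2)), norm_nonneg y]

theorem dampedExp_le {θ : EuclideanSpace ℝ κ} {a k : ℝ} (hθ : ‖θ‖ ≤ a) (hk : 0 < k)
    (y : EuclideanSpace ℝ κ) : dampedExp θ k y ≤ dampedBound a k := by
  simpa using exp_norm_mul_dampedExp_le hθ hk (j := 0) (by norm_num) y

theorem dampedExp_mul_norm_le {θ : EuclideanSpace ℝ κ} {a k : ℝ} (hθ : ‖θ‖ ≤ a) (hk : 0 < k)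
    (y : EuclideanSpace ℝ κ) : dampedExp θ k y * ‖y‖ ≤ dampedBound a k := by
  refine le_trans ?_ (exp_norm_mul_dampedExp_le hθ hk (j := 1) (by norm_num) y)
  rw [mul_comm, one_mul]
  have := Real.add_one_le_exp ‖y‖
  exact mul_le_mul_of_nonneg_right (by linarith) (dampedExp_pos _ _ _).le

theorem dampedExp_mul_norm_sq_le {θ : EuclideanSpace ℝ κ} {a k : ℝ} (hθ : ‖θ‖ ≤ a) (hk : 0 < k)
    (y : EuclideanSpace ℝ κ) : dampedExp θ k y * ‖y‖ ^ 2 ≤ dampedBound a k := by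
  refine le_trans ?_ (exp_norm_mul_dampedExp_le hθ hk (j := 2) le_rfl y)
  rw [mul_comm, two_mul, Real.exp_add, ← sq]
  have := Real.add_one_le_exp ‖y‖
  refine mul_le_mul_of_nonneg_right ?_ (dampedExp_pos _ _ _).le
  gcongr
  linarith

variable {ι Ξ : Type*} [Fintype ι] [MeasurableSpace Ξ]

theorem integrable_of_bound {F : Type*} [NormedAddCommGroup F] (γ : Measure Ξ)
    [IsFiniteMeasure γ] {f : Ξ → F} (hf : AEStronglyMeasurable f γ) (B : ℝ) (h : ∀ x, ‖f x‖ ≤ B) :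
    Integrable f γ :=
  Integrable.of_bound hf B (ae_of_all _ h)

theorem integrable_dampedExp (γ : Measure Ξ) [IsFiniteMeasure γ] {y : Ξ → EuclideanSpace ℝ κ}
    (hy : Measurable y) (θ : EuclideanSpace ℝ κ) {k : ℝ} (hk : 0 < k) :
    Integrable (fun ξ => dampedExp θ k (y ξ)) γ :=
  integrable_of_bound γ ((continuous_dampedExp θ k).measurable.comp hy).aestronglyMeasurable
    (dampedBound ‖θ‖ k) fun x => by
      rw [Real.norm_of_nonneg (dampedExp_pos _ _ _).le]; exact dampedExp_le le_rfl hk _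

theorem integral_dampedExp_pos (γ : Measure Ξ) [IsProbabilityMeasure γ]
    {y : Ξ → EuclideanSpace ℝ κ} (hy : Measurable y) (θ : EuclideanSpace ℝ κ) {k : ℝ}
    (hk : 0 < k) : 0 < ∫ ξ, dampedExp θ k (y ξ) ∂γ :=
  integral_exp_pos (integrable_dampedExp γ hy θ hk)

theorem integral_withDensity_ofReal {F : Type*} [NormedAddCommGroup F] [NormedSpace ℝ F]
    (γ : Measure Ξ) {w : Ξ → ℝ} (hw : Measurable w) (h0 : ∀ ξ, 0 ≤ w ξ) (f : Ξ → F) :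
    ∫ ξ, f ξ ∂(γ.withDensity fun ξ => ENNReal.ofReal (w ξ)) = ∫ ξ, w ξ • f ξ ∂γ := by
  rw [integral_withDensity_eq_integral_toReal_smul hw.ennreal_ofReal
    (ae_of_all _ fun _ => ENNReal.ofReal_lt_top)]
  simp_rw [ENNReal.toReal_ofReal (h0 _)]

/-- Change of measure: under the normalised damped tilt the mean is m, so Chebyshev makes the ball
around m likely. On that ball the density of the tilted product is at most exp(n(⟪θ, m⟫ + ‖θ‖s)) / Z
^ n, which converts the estimate back to γ. -/
theorem pi_norm_mean_sub_lt_ge (γ : Measure Ξ) [IsProbabilityMeasure γ]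
    {y : Ξ → EuclideanSpace ℝ κ} (hy : Measurable y) (θ : EuclideanSpace ℝ κ) {k : ℝ}
    (hk : 0 < k) [Nonempty ι] {s Z : ℝ} (hs : 0 < s) (hZ : Z = ∫ ξ, dampedExp θ k (y ξ) ∂γ)
    {m : EuclideanSpace ℝ κ} (hm : m = Z⁻¹ • ∫ ξ, dampedExp θ k (y ξ) • y ξ ∂γ) :
    Z ^ Fintype.card ι * (1 - dampedBound ‖θ‖ k / (Z * (Fintype.card ι * s ^ 2))) *
        Real.exp (-(Fintype.card ι * (⟪θ, m⟫ + ‖θ‖ * s))) ≤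
      (Measure.pi fun _ : ι => γ).real
        {ξ | ‖(Fintype.card ι : ℝ)⁻¹ • ∑ i, y (ξ i) - m‖ < s} := by
  have hZpos : 0 < Z := hZ ▸ integral_dampedExp_pos γ hy θ hk
  set n : ℝ := (Fintype.card ι : ℝ) with hndef
  have hn : 0 < n := by simpa [hndef] using Fintype.card_pos (α := ι)
  set w : Ξ → ℝ≥0∞ := fun ξ => ENNReal.ofReal (dampedExp θ k (y ξ) / Z) with hwdef
  have hdm : Measurable fun ξ => dampedExp θ k (y ξ) :=
    (continuous_dampedExp θ k).measurable.comp hy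
  have hw : Measurable w := (hdm.div_const Z).ennreal_ofReal
  set ν := γ.withDensity w with hν
  have hνprob : IsProbabilityMeasure ν := by
    constructor
    rw [hν, withDensity_apply _ MeasurableSet.univ, setLIntegral_univ,
      ← ofReal_integral_eq_lintegral_ofReal ((integrable_dampedExp γ hy θ hk).div_const Z)
        (ae_of_all _ fun ξ => div_nonneg (dampedExp_pos _ _ _).le hZpos.le),
      integral_div, ← hZ, div_self hZpos.ne', ENNReal.ofReal_one]
  have hsqint : Integrable (fun ξ => dampedExp θ k (y ξ) * ‖y ξ‖ ^ 2) γ := by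
    refine integrable_of_bound γ (hdm.mul (hy.norm.pow_const 2)).aestronglyMeasurable
      (dampedBound ‖θ‖ k) fun ξ => ?_
    rw [Real.norm_of_nonneg (mul_nonneg (dampedExp_pos _ _ _).le (sq_nonneg _))]
    exact dampedExp_mul_norm_sq_le le_rfl hk _
  have hyL2 : MemLp y 2 ν := by
    rw [memLp_two_iff_integrable_sq_norm hy.aestronglyMeasurable, hν,
      integrable_withDensity_iff hw (ae_of_all _ fun _ => ENNReal.ofReal_lt_top)]
    refine (hsqint.div_const Z).congr (ae_of_all _ fun ξ => ?_)
    simp only [hwdef]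
    rw [ENNReal.toReal_ofReal (div_nonneg (dampedExp_pos _ _ _).le hZpos.le)]
    ring
  have hdens : ∀ ξ, 0 ≤ dampedExp θ k (y ξ) / Z := fun ξ =>
    div_nonneg (dampedExp_pos _ _ _).le hZpos.le
  have hmean : ∫ ξ, y ξ ∂ν = m := by
    rw [hν, integral_withDensity_ofReal γ (hdm.div_const Z) hdens, hm, ← integral_smul]
    simp_rw [smul_smul, div_eq_inv_mul]
  have hsq : ∫ ξ, ‖y ξ‖ ^ 2 ∂ν ≤ dampedBound ‖θ‖ k / Z := by
    rw [hν, integral_withDensity_ofReal γ (hdm.div_const Z) hdens]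
    simp_rw [smul_eq_mul, div_mul_eq_mul_div]
    rw [integral_div]
    gcongr
    refine (integral_mono hsqint (integrable_const (dampedBound ‖θ‖ k)) fun ξ =>
      dampedExp_mul_norm_sq_le le_rfl hk _).trans (by simp)
  have hcheb := pi_norm_mean_sub_ge_le (ι := ι) ν hyL2 hs
  rw [hmean] at hcheb
  set A : Set (ι → Ξ) := {ξ | ‖n⁻¹ • ∑ i, y (ξ i) - m‖ < s} with hA
  have hsm : Measurable fun ξ : ι → Ξ => ‖n⁻¹ • ∑ i, y (ξ i) - m‖ := by
    have : ∀ i, Measurable fun ξ : ι → Ξ => y (ξ i) := fun i => hy.comp (measurable_pi_apply i)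
    fun_prop
  have hAm : MeasurableSet A := measurableSet_lt hsm measurable_const
  have hAc : Aᶜ = {ξ : ι → Ξ | s ≤ ‖n⁻¹ • ∑ i, y (ξ i) - m‖} := by
    ext ξ; simp [hA]
  have hνA : 1 - dampedBound ‖θ‖ k / (Z * (n * s ^ 2)) ≤ (Measure.pi fun _ : ι => ν).real A := by
    have h1 := probReal_compl_eq_one_sub (μ := Measure.pi fun _ : ι => ν) hAm
    rw [hAc] at h1
    have h2 : (∫ x, ‖y x‖ ^ 2 ∂ν) / (n * s ^ 2) ≤ dampedBound ‖θ‖ k / (Z * (n * s ^ 2)) := by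
      rw [← div_div (dampedBound ‖θ‖ k)]
      exact div_le_div_of_nonneg_right hsq (by positivity)
    linarith
  set c : ℝ := Real.exp (n * (⟪θ, m⟫ + ‖θ‖ * s)) / Z ^ Fintype.card ι with hc
  have hcpos : 0 < c := by positivity
  have hprod : ∀ ξ ∈ A, ∏ i, w (ξ i) ≤ ENNReal.ofReal c := by
    intro ξ hξ
    simp only [hwdef]
    rw [← ENNReal.ofReal_prod_of_nonneg fun i _ =>
      div_nonneg (dampedExp_pos _ _ _).le hZpos.le]
    refine ENNReal.ofReal_le_ofReal ?_
    rw [Finset.prod_div_distrib, Finset.prod_const, Finset.card_univ, hc]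
    gcongr
    -- The damping factor is at most one, so it can be dropped from an upper bound of the density.
    have h1 : ∀ i, dampedExp θ k (y (ξ i)) ≤ Real.exp ⟪θ, y (ξ i)⟫ := fun i =>
      Real.exp_le_exp.2 (by nlinarith [sq_nonneg ‖y (ξ i)‖])
    refine (Finset.prod_le_prod (fun i _ => (dampedExp_pos _ _ _).le) fun i _ => h1 i).trans ?_
    rw [← Real.exp_sum, Real.exp_le_exp, ← inner_sum]
    have h2 : ∑ i, y (ξ i) = n • m + n • (n⁻¹ • ∑ i, y (ξ i) - m) := by
      rw [smul_sub, smul_smul, mul_inv_cancel₀ hn.ne', one_smul]; abel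
    rw [h2, inner_add_right, real_inner_smul_right, real_inner_smul_right, mul_add]
    gcongr
    exact (real_inner_le_norm _ _).trans (by gcongr; exact le_of_lt hξ)
  have hle : (Measure.pi fun _ : ι => ν) A ≤
      ENNReal.ofReal c * (Measure.pi fun _ : ι => γ) A := by
    rw [hν, pi_withDensity γ w hw, withDensity_apply _ hAm]
    exact (setLIntegral_mono measurable_const hprod).trans (by rw [setLIntegral_const])
  have hle' : (Measure.pi fun _ : ι => ν).real A ≤ c * (Measure.pi fun _ : ι => γ).real A := by
    have := ENNReal.toReal_mono (by finiteness) hle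
    rwa [ENNReal.toReal_mul, ENNReal.toReal_ofReal hcpos.le] at this
  have h3 := hνA.trans hle'
  have h4 : Z ^ Fintype.card ι * Real.exp (-(n * (⟪θ, m⟫ + ‖θ‖ * s))) * c = 1 := by
    rw [hc, Real.exp_neg]
    field_simp
  calc Z ^ Fintype.card ι * (1 - dampedBound ‖θ‖ k / (Z * (n * s ^ 2))) *
        Real.exp (-(n * (⟪θ, m⟫ + ‖θ‖ * s)))
      = Z ^ Fintype.card ι * Real.exp (-(n * (⟪θ, m⟫ + ‖θ‖ * s))) *
        (1 - dampedBound ‖θ‖ k / (Z * (n * s ^ 2))) := by ring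
    _ ≤ Z ^ Fintype.card ι * Real.exp (-(n * (⟪θ, m⟫ + ‖θ‖ * s))) *
        (c * (Measure.pi fun _ : ι => γ).real A) := by gcongr
    _ = _ := by rw [← mul_assoc, h4, one_mul]

end Tilt

/-! ### Cramér's lower bound, locally uniformly in a parameter -/

section Cramer

open scoped RealInnerProductSpace

variable {κ Ξ : Type*} [Fintype κ] [MeasurableSpace Ξ]

/-- Restrict to a bounded set of positive mass. The bound is uniform in the damping, and its
logarithm decays only linearly in ‖θ‖, so every quadratic penalty beats it. -/
theorem exists_mul_exp_le_integral_dampedExp (γ : Measure Ξ) [IsProbabilityMeasure γ]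
    {f : Ξ → EuclideanSpace ℝ κ} (hf : Measurable f) :
    ∃ p ρ : ℝ, 0 < p ∧ 0 ≤ ρ ∧ ∀ (θ : EuclideanSpace ℝ κ) (k : ℝ), 0 < k → k ≤ 1 →
      p * Real.exp (-(ρ * ‖θ‖)) ≤ ∫ ξ, dampedExp θ k (f ξ) ∂γ := by
  have hU : γ (⋃ n : ℕ, {ξ | ‖f ξ‖ ≤ n}) ≠ 0 := by
    have : (⋃ n : ℕ, {ξ | ‖f ξ‖ ≤ n}) = Set.univ :=
      Set.eq_univ_of_forall fun ξ => Set.mem_iUnion.2 (exists_nat_ge ‖f ξ‖)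
    simp [this]
  obtain ⟨n, hn⟩ := exists_measure_pos_of_not_measure_iUnion_null hU
  set S := {ξ | ‖f ξ‖ ≤ n} with hS
  have hSm : MeasurableSet S := measurableSet_le hf.norm measurable_const
  have hreal : 0 < γ.real S := ENNReal.toReal_pos hn.ne' (measure_ne_top _ _)
  refine ⟨γ.real S * Real.exp (-(n : ℝ) ^ 2), n, by positivity, by positivity,
    fun θ k hk hk1 => ?_⟩
  have hint := integrable_dampedExp γ hf θ hk
  calc γ.real S * Real.exp (-(n : ℝ) ^ 2) * Real.exp (-(n * ‖θ‖))
      = ∫ _ in S, Real.exp (-(n : ℝ) ^ 2 - n * ‖θ‖) ∂γ := by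
        rw [setIntegral_const, smul_eq_mul, mul_assoc, ← Real.exp_add, sub_eq_add_neg]
    _ ≤ ∫ ξ in S, dampedExp θ k (f ξ) ∂γ := by
        refine setIntegral_mono_on (integrable_const _) hint.integrableOn hSm fun ξ hξ => ?_
        refine Real.exp_le_exp.2 ?_
        have hξ' : ‖f ξ‖ ≤ n := hξ
        have h1 : -(‖θ‖ * ‖f ξ‖) ≤ ⟪θ, f ξ⟫ := neg_le_of_abs_le (abs_real_inner_le_norm _ _)
        have h2 : ‖θ‖ * ‖f ξ‖ ≤ ‖θ‖ * n := by gcongr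
        have h3 : k * ‖f ξ‖ ^ 2 ≤ 1 * (n : ℝ) ^ 2 := by gcongr
        linarith
    _ ≤ _ := setIntegral_le_integral hint (ae_of_all _ fun ξ => (dampedExp_pos _ _ _).le)

theorem continuous_integral_dampedExp (γ : Measure Ξ) [IsProbabilityMeasure γ]
    {f : Ξ → EuclideanSpace ℝ κ} (hf : Measurable f) {k : ℝ} (hk : 0 < k) :
    Continuous fun θ => ∫ ξ, dampedExp θ k (f ξ) ∂γ := by
  refine continuous_iff_continuousAt.2 fun θ₀ => ?_
  refine continuousAt_of_dominated (bound := fun _ => dampedBound (‖θ₀‖ + 1) k)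
    (Eventually.of_forall fun θ =>
      ((continuous_dampedExp θ k).measurable.comp hf).aestronglyMeasurable) ?_
    (integrable_const _) (ae_of_all _ fun ξ => ?_)
  · filter_upwards [Metric.ball_mem_nhds θ₀ one_pos] with θ hθ
    refine ae_of_all _ fun ξ => ?_
    rw [Real.norm_of_nonneg (dampedExp_pos _ _ _).le]
    refine dampedExp_le ?_ hk _
    have := norm_le_norm_add_norm_sub θ₀ θ
    rw [mem_ball_iff_norm] at hθ
    rw [norm_sub_rev] at this
    linarith
  · unfold dampedExp
    fun_prop

/-- Damping lowers the moments, so the bound `hb` need not survive it; a penalty δ‖θ‖² and a loss ε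
repair this. Otherwise there are bad tilts for dampings tending to 0, and a limit point of them
contradicts `hb`. -/
theorem exists_damping (γ : Measure Ξ) [IsProbabilityMeasure γ]
    {f : Ξ → EuclideanSpace ℝ κ} (hf : Measurable f) {b : ℝ}
    (hb : ∀ θ : EuclideanSpace ℝ κ, ENNReal.ofReal (Real.exp (-b)) ≤
      ∫⁻ ξ, ENNReal.ofReal (Real.exp ⟪θ, f ξ⟫) ∂γ) {δ ε : ℝ} (hδ : 0 < δ) (hε : 0 < ε) :
    ∃ k : ℝ, 0 < k ∧ k ≤ 1 ∧ ∀ θ : EuclideanSpace ℝ κ,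
      -b - ε ≤ Real.log (∫ ξ, dampedExp θ k (f ξ) ∂γ) + δ * ‖θ‖ ^ 2 := by
  by_contra! hcon
  obtain ⟨p, ρ, hp, hρ, hlb⟩ := exists_mul_exp_le_integral_dampedExp γ hf
  set k : ℕ → ℝ := fun n => 1 / ((n : ℝ) + 1) with hkdef
  have hk0 : ∀ n, 0 < k n := fun n => by positivity
  have hk1 : ∀ n, k n ≤ 1 := fun n => by
    rw [hkdef]; exact (div_le_one (by positivity)).2 (by linarith [n.cast_nonneg (α := ℝ)])
  choose θ hθ using fun n => hcon (k n) (hk0 n) (hk1 n)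
  have hZ : ∀ n, 0 < ∫ ξ, dampedExp (θ n) (k n) (f ξ) ∂γ := fun n =>
    integral_dampedExp_pos γ hf _ (hk0 n)
  -- The bad tilts are bounded because δ‖θ‖² outgrows the linear decay from `hlb`.
  have hbd : ∃ B, ∀ n, ‖θ n‖ ≤ B := by
    refine ⟨(ρ + |(-b - ε) - Real.log p| + δ) / δ, fun n => ?_⟩
    have h1 := Real.log_le_log (by positivity) (hlb (θ n) (k n) (hk0 n) (hk1 n))
    rw [Real.log_mul hp.ne' (Real.exp_pos _).ne', Real.log_exp] at h1
    have h2 := hθ n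
    have h3 := le_abs_self ((-b - ε) - Real.log p)
    have h4 := abs_nonneg ((-b - ε) - Real.log p)
    rw [le_div_iff₀ hδ]
    by_contra! h5
    have h6 : 1 ≤ ‖θ n‖ := by
      by_contra! h7
      have : ‖θ n‖ * δ ≤ 1 * δ := by gcongr
      linarith
    nlinarith [mul_le_mul_of_nonneg_left h5.le (norm_nonneg (θ n)),
      mul_nonneg h4 (sub_nonneg.2 h6)]
  obtain ⟨B, hB⟩ := hbd
  obtain ⟨θ₀, -, φ, hφ, hlim⟩ := tendsto_subseq_of_bounded
    (Metric.isBounded_closedBall (x := (0 : EuclideanSpace ℝ κ)) (r := B))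
    (x := θ) fun n => mem_closedBall_zero_iff.2 (hB n)
  have hklim : Tendsto (fun n => k (φ n)) atTop (𝓝 0) :=
    tendsto_one_div_add_atTop_nhds_zero_nat.comp hφ.tendsto_atTop
  have hpt : ∀ ξ, Tendsto (fun n => ENNReal.ofReal (dampedExp (θ (φ n)) (k (φ n)) (f ξ))) atTop
      (𝓝 (ENNReal.ofReal (Real.exp ⟪θ₀, f ξ⟫))) := by
    intro ξ
    refine ENNReal.tendsto_ofReal ((Real.continuous_exp.tendsto _).comp ?_)
    have h1 : Tendsto (fun n => ⟪θ (φ n), f ξ⟫) atTop (𝓝 ⟪θ₀, f ξ⟫) :=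
      hlim.inner tendsto_const_nhds
    simpa using h1.sub (hklim.mul_const (‖f ξ‖ ^ 2))
  -- Fatou suffices here, so undamped exponential moments are allowed to be infinite.
  have hfatou : ∫⁻ ξ, ENNReal.ofReal (Real.exp ⟪θ₀, f ξ⟫) ∂γ ≤
      ENNReal.ofReal (Real.exp (-b - ε)) := by
    calc ∫⁻ ξ, ENNReal.ofReal (Real.exp ⟪θ₀, f ξ⟫) ∂γ
        = ∫⁻ ξ, liminf (fun n => ENNReal.ofReal (dampedExp (θ (φ n)) (k (φ n)) (f ξ))) atTop ∂γ :=
          lintegral_congr fun ξ => (hpt ξ).liminf_eq.symm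
      _ ≤ liminf (fun n => ∫⁻ ξ, ENNReal.ofReal (dampedExp (θ (φ n)) (k (φ n)) (f ξ)) ∂γ) atTop :=
          lintegral_liminf_le fun n =>
            ((continuous_dampedExp _ _).measurable.comp hf).ennreal_ofReal
      _ ≤ ENNReal.ofReal (Real.exp (-b - ε)) := by
          refine liminf_le_of_le (by isBoundedDefault) fun c hc => ?_
          obtain ⟨n, hn⟩ := hc.exists
          refine hn.trans ?_
          rw [← ofReal_integral_eq_lintegral_ofReal (integrable_dampedExp γ hf _ (hk0 _))
            (ae_of_all _ fun ξ => (dampedExp_pos _ _ _).le)]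
          refine ENNReal.ofReal_le_ofReal ((Real.log_le_iff_le_exp (hZ _)).1 ?_)
          have := hθ (φ n)
          have h2 : 0 ≤ δ * ‖θ (φ n)‖ ^ 2 := by positivity
          linarith
  have := (hb θ₀).trans hfatou
  rw [ENNReal.ofReal_le_ofReal_iff (Real.exp_pos _).le, Real.exp_le_exp] at this
  linarith

theorem hasDerivAt_integral_dampedExp (γ : Measure Ξ) [IsProbabilityMeasure γ]
    {f : Ξ → EuclideanSpace ℝ κ} (hf : Measurable f) {k : ℝ} (hk : 0 < k)
    (θ v : EuclideanSpace ℝ κ) :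
    HasDerivAt (fun t : ℝ => ∫ ξ, dampedExp (θ + t • v) k (f ξ) ∂γ)
      (∫ ξ, dampedExp θ k (f ξ) * ⟪v, f ξ⟫ ∂γ) 0 := by
  have hm : ∀ θ, Measurable fun ξ => dampedExp θ k (f ξ) := fun θ =>
    (continuous_dampedExp θ k).measurable.comp hf
  have h := hasDerivAt_integral_of_dominated_loc_of_deriv_le (μ := γ)
    (F := fun (t : ℝ) ξ => dampedExp (θ + t • v) k (f ξ))
    (F' := fun (t : ℝ) ξ => dampedExp (θ + t • v) k (f ξ) * ⟪v, f ξ⟫)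
    (x₀ := 0) (s := Metric.ball 0 1) (bound := fun _ => dampedBound (‖θ‖ + ‖v‖) k * ‖v‖)
    (Metric.ball_mem_nhds 0 one_pos)
    (Eventually.of_forall fun t => (hm _).aestronglyMeasurable)
    (integrable_dampedExp γ hf _ hk)
    (by
      have : Measurable fun ξ => ⟪v, f ξ⟫ := by fun_prop
      exact ((hm _).mul this).aestronglyMeasurable)
    (ae_of_all _ fun ξ t ht => ?_) (integrable_const _) (ae_of_all _ fun ξ t _ => ?_)
  · simpa using h.2
  · have ht' : |t| < 1 := by simpa using ht
    have h1 : ‖θ + t • v‖ ≤ ‖θ‖ + ‖v‖ := by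
      refine (norm_add_le _ _).trans ?_
      rw [norm_smul, Real.norm_eq_abs]
      nlinarith [norm_nonneg v]
    rw [norm_mul, Real.norm_of_nonneg (dampedExp_pos _ _ _).le, Real.norm_eq_abs]
    calc dampedExp (θ + t • v) k (f ξ) * |⟪v, f ξ⟫|
        ≤ dampedExp (θ + t • v) k (f ξ) * (‖v‖ * ‖f ξ‖) := by
          gcongr
          · exact (dampedExp_pos _ _ _).le
          · exact abs_real_inner_le_norm _ _
      _ = (dampedExp (θ + t • v) k (f ξ) * ‖f ξ‖) * ‖v‖ := by ring
      _ ≤ _ := by gcongr; exact dampedExp_mul_norm_le h1 hk _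
  · unfold dampedExp
    have h1 : HasDerivAt (fun t : ℝ => ⟪θ + t • v, f ξ⟫ - k * ‖f ξ‖ ^ 2) ⟪v, f ξ⟫ t := by
      simp_rw [inner_add_left, real_inner_smul_left]
      simpa using (((hasDerivAt_id t).mul_const ⟪v, f ξ⟫).const_add ⟪θ, f ξ⟫).sub_const
        (k * ‖f ξ‖ ^ 2)
    exact h1.exp

/-- Continuity and coercivity: the logarithm is bounded below by an affine function of ‖θ‖, and the
penalty is quadratic. -/
theorem exists_isMinOn_log_integral_dampedExp (γ : Measure Ξ) [IsProbabilityMeasure γ]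
    {f : Ξ → EuclideanSpace ℝ κ} (hf : Measurable f) {k δ : ℝ} (hk : 0 < k) (hk1 : k ≤ 1)
    (hδ : 0 < δ) :
    ∃ θ : EuclideanSpace ℝ κ, ∀ θ' : EuclideanSpace ℝ κ,
      Real.log (∫ ξ, dampedExp θ k (f ξ) ∂γ) + δ * ‖θ‖ ^ 2 ≤
        Real.log (∫ ξ, dampedExp θ' k (f ξ) ∂γ) + δ * ‖θ'‖ ^ 2 := by
  obtain ⟨p, ρ, hp, hρ, hlb⟩ := exists_mul_exp_le_integral_dampedExp γ hf
  refine Continuous.exists_forall_le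
    (f := fun θ => Real.log (∫ ξ, dampedExp θ k (f ξ) ∂γ) + δ * ‖θ‖ ^ 2) ?_ ?_
  · refine Continuous.add ?_ (by fun_prop)
    exact (continuous_integral_dampedExp γ hf hk).log fun θ =>
      (integral_dampedExp_pos γ hf θ hk).ne'
  · have h1 : Tendsto (fun u : ℝ => Real.log p + u * (δ * u - ρ)) atTop atTop := by
      refine tendsto_atTop_add_const_left _ _ (tendsto_id.atTop_mul_atTop₀ ?_)
      exact tendsto_atTop_add_const_right _ _ (tendsto_id.const_mul_atTop hδ)
    refine tendsto_atTop_mono (fun θ => ?_) (h1.comp (tendsto_norm_cocompact_atTop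
      (E := EuclideanSpace ℝ κ)))
    have h2 := Real.log_le_log (by positivity) (hlb θ k hk hk1)
    rw [Real.log_mul hp.ne' (Real.exp_pos _).ne', Real.log_exp] at h2
    simp only [Function.comp]
    nlinarith

/-- At a minimum of the regularised log-moment generating function, the tilted mean is
proportional to the tilt. -/
theorem tilted_mean_eq_of_isMinOn (γ : Measure Ξ) [IsProbabilityMeasure γ]
    {f : Ξ → EuclideanSpace ℝ κ} (hf : Measurable f) {k δ : ℝ} (hk : 0 < k)
    {θ : EuclideanSpace ℝ κ} (hθ : ∀ θ' : EuclideanSpace ℝ κ,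
      Real.log (∫ ξ, dampedExp θ k (f ξ) ∂γ) + δ * ‖θ‖ ^ 2 ≤
        Real.log (∫ ξ, dampedExp θ' k (f ξ) ∂γ) + δ * ‖θ'‖ ^ 2) :
    (∫ ξ, dampedExp θ k (f ξ) ∂γ)⁻¹ • ∫ ξ, dampedExp θ k (f ξ) • f ξ ∂γ = -(2 * δ) • θ := by
  set Z := ∫ ξ, dampedExp θ k (f ξ) ∂γ with hZ
  have hZpos : 0 < Z := integral_dampedExp_pos γ hf θ hk
  have hint : Integrable (fun ξ => dampedExp θ k (f ξ) • f ξ) γ := by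
    refine integrable_of_bound γ (((continuous_dampedExp θ k).measurable.comp hf).smul
      hf).aestronglyMeasurable (dampedBound ‖θ‖ k) fun ξ => ?_
    rw [norm_smul, Real.norm_of_nonneg (dampedExp_pos _ _ _).le]
    exact dampedExp_mul_norm_le le_rfl hk _
  have key : ∀ v, ⟪v, Z⁻¹ • (∫ ξ, dampedExp θ k (f ξ) • f ξ ∂γ) + (2 * δ) • θ⟫ = 0 := by
    intro v
    have h1 := (hasDerivAt_integral_dampedExp γ hf hk θ v).log (by simpa using hZpos.ne')
    have h2 : HasDerivAt (fun t : ℝ => δ * ‖θ + t • v‖ ^ 2) (δ * (2 * ⟪θ, v⟫)) 0 := by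
      have h3 : ∀ t : ℝ, δ * ‖θ + t • v‖ ^ 2 =
          δ * (‖θ‖ ^ 2 + t * (2 * ⟪θ, v⟫) + t ^ 2 * ‖v‖ ^ 2) := by
        intro t
        rw [norm_add_sq_real, real_inner_smul_right, norm_smul, mul_pow, Real.norm_eq_abs, sq_abs]
        ring
      simp_rw [h3]
      have h4 := (((hasDerivAt_id (0 : ℝ)).mul_const (2 * ⟪θ, v⟫)).const_add (‖θ‖ ^ 2)).add
        ((hasDerivAt_pow 2 (0 : ℝ)).mul_const (‖v‖ ^ 2))
      simpa using h4.const_mul δ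
    have hmin : IsLocalMin (fun t : ℝ => Real.log (∫ ξ, dampedExp (θ + t • v) k (f ξ) ∂γ) +
        δ * ‖θ + t • v‖ ^ 2) 0 :=
      Eventually.of_forall fun t => by simpa using hθ (θ + t • v)
    have h5 := hmin.hasDerivAt_eq_zero (h1.add h2)
    rw [inner_add_right, real_inner_smul_right, real_inner_smul_right,
      ← integral_inner hint v]
    simp_rw [real_inner_smul_right]
    simp only [zero_smul, add_zero, ← hZ] at h5
    rw [real_inner_comm v θ] at h5
    rw [← h5]
    ring
  have := key (Z⁻¹ • (∫ ξ, dampedExp θ k (f ξ) • f ξ ∂γ) + (2 * δ) • θ)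
  rw [inner_self_eq_zero] at this
  rw [neg_smul, ← sub_eq_zero, sub_neg_eq_add, this]

/-- The tilt is the minimiser of the penalised log-moment function. Its value is at most the value
at 0, which is nonpositive, and this bounds δ‖θ‖². The mean -2δθ is then of order √δ. -/
theorem exists_tilt (γ : Measure Ξ) [IsProbabilityMeasure γ]
    {f : Ξ → EuclideanSpace ℝ κ} (hf : Measurable f) {b : ℝ}
    (hb : ∀ θ : EuclideanSpace ℝ κ, ENNReal.ofReal (Real.exp (-b)) ≤
      ∫⁻ ξ, ENNReal.ofReal (Real.exp ⟪θ, f ξ⟫) ∂γ) {r ε : ℝ} (hr : 0 < r) (hε : 0 < ε) :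
    ∃ (θ : EuclideanSpace ℝ κ) (k : ℝ), 0 < k ∧
      ‖(∫ ξ, dampedExp θ k (f ξ) ∂γ)⁻¹ • ∫ ξ, dampedExp θ k (f ξ) • f ξ ∂γ‖ < r ∧
      -b - ε ≤ Real.log (∫ ξ, dampedExp θ k (f ξ) ∂γ) -
        ⟪θ, (∫ ξ, dampedExp θ k (f ξ) ∂γ)⁻¹ • ∫ ξ, dampedExp θ k (f ξ) • f ξ ∂γ⟫ := by
  have hb0 : 0 ≤ b := by
    have := hb 0
    simp only [inner_zero_left, Real.exp_zero, ENNReal.ofReal_one, lintegral_const,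
      measure_univ, mul_one, ENNReal.ofReal_le_one, Real.exp_le_one_iff] at this
    linarith
  -- `exists_damping` is used with penalty δ/2, the minimisation with δ; the difference yields δ‖θ‖²
  -- ≤ 2(b + ε). The squared norm of the mean is then at most 8δ(b + ε) = r²/2.
  set δ : ℝ := r ^ 2 / (16 * (b + ε)) with hδdef
  have hδ : 0 < δ := by positivity
  obtain ⟨k, hk, hk1, hlow⟩ := exists_damping γ hf hb (half_pos hδ) hε
  obtain ⟨θ, hθ⟩ := exists_isMinOn_log_integral_dampedExp γ hf hk hk1 hδ
  have hmean := tilted_mean_eq_of_isMinOn γ hf hk hθ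
  have h0 : Real.log (∫ ξ, dampedExp 0 k (f ξ) ∂γ) ≤ 0 := by
    refine Real.log_nonpos (integral_dampedExp_pos γ hf 0 hk).le ?_
    refine (integral_mono (integrable_dampedExp γ hf 0 hk) (integrable_const 1) fun ξ => ?_).trans
      (by simp)
    unfold dampedExp
    rw [Real.exp_le_one_iff, inner_zero_left]
    nlinarith [sq_nonneg ‖f ξ‖]
  have h1 := hθ 0
  have h2 := hlow θ
  simp only [norm_zero, ne_eq, OfNat.ofNat_ne_zero, not_false_eq_true, zero_pow, mul_zero,
    add_zero] at h1
  refine ⟨θ, k, hk, ?_, ?_⟩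
  · rw [hmean, norm_smul, norm_neg, Real.norm_of_nonneg (by positivity)]
    refine lt_of_pow_lt_pow_left₀ 2 hr.le ?_
    have h3 : δ * ‖θ‖ ^ 2 ≤ 2 * (b + ε) := by linarith
    calc (2 * δ * ‖θ‖) ^ 2 = 4 * δ * (δ * ‖θ‖ ^ 2) := by ring
      _ ≤ 4 * δ * (2 * (b + ε)) := by gcongr
      _ = r ^ 2 / 2 := by rw [hδdef]; field_simp; ring
      _ < r ^ 2 := half_lt_self (by positivity)
  · rw [hmean, real_inner_smul_right, real_inner_self_eq_norm_sq]
    have : 0 ≤ δ * ‖θ‖ ^ 2 := by positivity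
    linarith

/-- The damping provides a dominating constant independent of t, so pointwise convergence is enough.
-/
theorem tendsto_integral_dampedExp (γ : Measure Ξ) [IsProbabilityMeasure γ] {T : Type*}
    {l : Filter T} [l.IsCountablyGenerated] {f : T → Ξ → EuclideanSpace ℝ κ}
    {f₀ : Ξ → EuclideanSpace ℝ κ} (hf : ∀ t, Measurable (f t))
    (hlim : ∀ ξ, Tendsto (fun t => f t ξ) l (𝓝 (f₀ ξ))) {k : ℝ} (hk : 0 < k)
    (θ : EuclideanSpace ℝ κ) :
    Tendsto (fun t => ∫ ξ, dampedExp θ k (f t ξ) ∂γ) l (𝓝 (∫ ξ, dampedExp θ k (f₀ ξ) ∂γ)) ∧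
    Tendsto (fun t => ∫ ξ, dampedExp θ k (f t ξ) • f t ξ ∂γ) l
      (𝓝 (∫ ξ, dampedExp θ k (f₀ ξ) • f₀ ξ ∂γ)) := by
  have hm : ∀ t, Measurable fun ξ => dampedExp θ k (f t ξ) := fun t =>
    (continuous_dampedExp θ k).measurable.comp (hf t)
  have hl : ∀ ξ, Tendsto (fun t => dampedExp θ k (f t ξ)) l (𝓝 (dampedExp θ k (f₀ ξ))) :=
    fun ξ => ((continuous_dampedExp θ k).tendsto _).comp (hlim ξ)
  constructor
  · refine tendsto_integral_filter_of_dominated_convergence (fun _ => dampedBound ‖θ‖ k)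
      (Eventually.of_forall fun t => (hm t).aestronglyMeasurable)
      (Eventually.of_forall fun t => ae_of_all _ fun ξ => ?_) (integrable_const _)
      (ae_of_all _ hl)
    rw [Real.norm_of_nonneg (dampedExp_pos _ _ _).le]
    exact dampedExp_le le_rfl hk _
  · refine tendsto_integral_filter_of_dominated_convergence (fun _ => dampedBound ‖θ‖ k)
      (Eventually.of_forall fun t => ((hm t).smul (hf t)).aestronglyMeasurable)
      (Eventually.of_forall fun t => ae_of_all _ fun ξ => ?_) (integrable_const _)
      (ae_of_all _ fun ξ => (hl ξ).smul (hlim ξ))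
    rw [norm_smul, Real.norm_of_nonneg (dampedExp_pos _ _ _).le]
    exact dampedExp_mul_norm_le le_rfl hk _

/-- The lower bound of Cramér's theorem around `x`, locally uniformly in the parameter `t`. -/
theorem cramer_lower_bound (γ : Measure Ξ) [IsProbabilityMeasure γ] {T : Type*}
    {l : Filter T} [l.IsCountablyGenerated] {y : T → Ξ → EuclideanSpace ℝ κ}
    {y₀ : Ξ → EuclideanSpace ℝ κ} (hy : ∀ t, Measurable (y t)) (hy₀ : Measurable y₀)
    (hlim : ∀ ξ, Tendsto (fun t => y t ξ) l (𝓝 (y₀ ξ))) (x : EuclideanSpace ℝ κ) {b : ℝ}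
    (hb : ∀ θ : EuclideanSpace ℝ κ, ENNReal.ofReal (Real.exp (⟪θ, x⟫ - b)) ≤
      ∫⁻ ξ, ENNReal.ofReal (Real.exp ⟪θ, y₀ ξ⟫) ∂γ) {r ε : ℝ} (hr : 0 < r) (hε : 0 < ε) :
    ∃ N₀ : ℕ, ∀ᶠ t in l, ∀ N ≥ N₀, Real.exp (-(N * (b + ε))) ≤
      (Measure.pi fun _ : Fin N => γ).real
        {ξ | ‖(N : ℝ)⁻¹ • ∑ i, y t (ξ i) - x‖ < r} := by
  have hb' : ∀ θ : EuclideanSpace ℝ κ, ENNReal.ofReal (Real.exp (-b)) ≤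
      ∫⁻ ξ, ENNReal.ofReal (Real.exp ⟪θ, y₀ ξ - x⟫) ∂γ := by
    intro θ
    have h1 : ∀ ξ, ENNReal.ofReal (Real.exp ⟪θ, y₀ ξ - x⟫) =
        ENNReal.ofReal (Real.exp (-⟪θ, x⟫)) * ENNReal.ofReal (Real.exp ⟪θ, y₀ ξ⟫) := fun ξ => by
      rw [← ENNReal.ofReal_mul (Real.exp_pos _).le, ← Real.exp_add, inner_sub_right]
      congr 2; ring
    simp_rw [h1]
    rw [lintegral_const_mul' _ _ ENNReal.ofReal_ne_top]
    refine le_trans ?_ (mul_le_mul_right (hb θ) _)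
    rw [← ENNReal.ofReal_mul (Real.exp_pos _).le, ← Real.exp_add]
    refine le_of_eq ?_
    congr 2; ring
  have hε4 : 0 < ε / 4 := by positivity
  obtain ⟨θ, k, hk, hm, hval⟩ := exists_tilt γ (hy₀.sub_const x) hb' (half_pos hr) hε4
  obtain ⟨hZlim, hMlim⟩ := tendsto_integral_dampedExp γ (l := l)
    (f := fun t ξ => y t ξ - x) (fun t => (hy t).sub_const x)
    (fun ξ => (hlim ξ).sub_const x) hk θ
  set Z₀ := ∫ ξ, dampedExp θ k (y₀ ξ - x) ∂γ with hZ₀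
  have hZ₀pos : 0 < Z₀ := integral_dampedExp_pos γ (hy₀.sub_const x) θ hk
  set m₀ := Z₀⁻¹ • ∫ ξ, dampedExp θ k (y₀ ξ - x) • (y₀ ξ - x) ∂γ with hm₀
  set Z : T → ℝ := fun t => ∫ ξ, dampedExp θ k (y t ξ - x) ∂γ with hZ
  set m : T → EuclideanSpace ℝ κ := fun t =>
    (Z t)⁻¹ • ∫ ξ, dampedExp θ k (y t ξ - x) • (y t ξ - x) ∂γ with hmdef
  have hmlim : Tendsto m l (𝓝 m₀) := (hZlim.inv₀ hZ₀pos.ne').smul hMlim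
  -- Budget for ε: one quarter for the tilt at the limit parameter, one for the variation in t, one
  -- for ‖θ‖s, and one for the factor 1/2 left by Chebyshev.
  set s : ℝ := min (r / 2) (ε / (4 * (‖θ‖ + 1))) with hs
  have hspos : 0 < s := by positivity
  have hθs : ‖θ‖ * s ≤ ε / 4 := by
    calc ‖θ‖ * s ≤ (‖θ‖ + 1) * (ε / (4 * (‖θ‖ + 1))) := by
          gcongr
          · linarith
          · exact min_le_right _ _
      _ = ε / 4 := by field_simp
  have hvlim : Tendsto (fun t => Real.log (Z t) - ⟪θ, m t⟫) l
      (𝓝 (Real.log Z₀ - ⟪θ, m₀⟫)) :=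
    (hZlim.log hZ₀pos.ne').sub (tendsto_const_nhds.inner hmlim)
  -- `N₁` makes the Chebyshev error at most 1/2 as soon as `Z t` exceeds `Z₀ / 2`; `N₂` absorbs the
  -- resulting factor 1/2 into exp(-Nε/4).
  obtain ⟨N₁, hN₁⟩ := exists_nat_ge (4 * dampedBound ‖θ‖ k / (Z₀ * s ^ 2))
  obtain ⟨N₂, hN₂⟩ := exists_nat_ge (Real.log 2 / (ε / 4))
  refine ⟨max (max N₁ N₂) 1, ?_⟩
  have e1 : ∀ᶠ t in l, -b - ε / 2 < Real.log (Z t) - ⟪θ, m t⟫ :=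
    hvlim.eventually_const_lt (by linarith)
  have e2 : ∀ᶠ t in l, Z₀ / 2 < Z t := hZlim.eventually_const_lt (half_lt_self hZ₀pos)
  have e3 : ∀ᶠ t in l, ‖m t‖ < r / 2 := hmlim.norm.eventually_lt_const hm
  filter_upwards [e1, e2, e3] with t h1 h2 h3 N hN
  have hN1 : 1 ≤ N := le_trans (le_max_right _ _) hN
  have hNpos : (0 : ℝ) < N := by exact_mod_cast hN1
  have hNN₁ : (N₁ : ℝ) ≤ N := by
    exact_mod_cast (le_max_left _ _).trans ((le_max_left _ _).trans hN)
  have hNN₂ : (N₂ : ℝ) ≤ N := by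
    exact_mod_cast (le_max_right _ _).trans ((le_max_left _ _).trans hN)
  have : Nonempty (Fin N) := ⟨⟨0, hN1⟩⟩
  have hZt : 0 < Z t := by linarith [half_pos hZ₀pos]
  have hmain := pi_norm_mean_sub_lt_ge (ι := Fin N) γ ((hy t).sub_const x) θ hk hspos
    (Z := Z t) rfl (m := m t) rfl
  rw [Fintype.card_fin] at hmain
  have hsub : {ξ : Fin N → Ξ | ‖(N : ℝ)⁻¹ • ∑ i, (y t (ξ i) - x) - m t‖ < s} ⊆
      {ξ | ‖(N : ℝ)⁻¹ • ∑ i, y t (ξ i) - x‖ < r} := by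
    intro ξ hξ
    have h4 : (N : ℝ)⁻¹ • ∑ i, (y t (ξ i) - x) = (N : ℝ)⁻¹ • ∑ i, y t (ξ i) - x := by
      rw [Finset.sum_sub_distrib, smul_sub, Finset.sum_const, Finset.card_univ, Fintype.card_fin,
        ← Nat.cast_smul_eq_nsmul ℝ, smul_smul, inv_mul_cancel₀ hNpos.ne', one_smul]
    simp only [Set.mem_ofPred_eq] at hξ ⊢
    rw [← h4]
    have h5 := norm_le_norm_add_norm_sub (m t) ((N : ℝ)⁻¹ • ∑ i, (y t (ξ i) - x))
    have h6 : s ≤ r / 2 := min_le_left _ _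
    rw [norm_sub_rev (m t)] at h5
    linarith
  refine le_trans ?_ (hmain.trans (measureReal_mono hsub))
  have hhalf : 1 / 2 ≤ 1 - dampedBound ‖θ‖ k / (Z t * (N * s ^ 2)) := by
    have h4 : dampedBound ‖θ‖ k / (Z t * (N * s ^ 2)) ≤ 1 / 2 := by
      have hB : 0 < dampedBound ‖θ‖ k := Real.exp_pos _
      have h5 : 4 * dampedBound ‖θ‖ k ≤ N * (Z₀ * s ^ 2) := by
        rw [div_le_iff₀ (by positivity)] at hN₁
        exact hN₁.trans (by gcongr)
      rw [div_le_iff₀ (by positivity)]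
      have h6 : Z₀ / 2 * (N * s ^ 2) ≤ Z t * (N * s ^ 2) := by gcongr
      linarith
    linarith
  have hexp2 : Real.exp (-(N * (ε / 4))) ≤ 1 / 2 := by
    rw [Real.exp_neg, one_div]
    refine inv_anti₀ two_pos ?_
    rw [div_le_iff₀ hε4] at hN₂
    rw [← Real.log_le_iff_le_exp two_pos]
    exact hN₂.trans (by gcongr)
  have hZN : Z t ^ N = Real.exp (N * Real.log (Z t)) := by
    rw [Real.exp_nat_mul, Real.exp_log hZt]
  calc Real.exp (-(N * (b + ε)))
      ≤ Real.exp (N * Real.log (Z t) - N * (⟪θ, m t⟫ + ‖θ‖ * s)) *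
          Real.exp (-(N * (ε / 4))) := by
        rw [← Real.exp_add, Real.exp_le_exp]
        have : (0 : ℝ) ≤ N * (Real.log (Z t) - ⟪θ, m t⟫ - ‖θ‖ * s + b + 3 * ε / 4) :=
          mul_nonneg hNpos.le (by linarith)
        linarith
    _ ≤ Real.exp (N * Real.log (Z t) - N * (⟪θ, m t⟫ + ‖θ‖ * s)) *
          (1 - dampedBound ‖θ‖ k / (Z t * (N * s ^ 2))) := by
        gcongr
        exact hexp2.trans hhalf
    _ = _ := by
        rw [hZN, sub_eq_add_neg, Real.exp_add]; ring

end Cramer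

/-! ### The cone of positive semidefinite matrices and centred Gaussian laws -/

namespace PSDCone

variable {ι : Type} [Fintype ι]

theorem isClosed_posSemidef : IsClosed {Q : Matrix ι ι ℝ | Q.PosSemidef} := by
  have h : {Q : Matrix ι ι ℝ | Q.PosSemidef} = {Q | Q.conjTranspose = Q} ∩
      ⋂ x : ι → ℝ, {Q | 0 ≤ x ⬝ᵥ (Q.mulVec x)} := by
    ext Q
    simp only [Set.mem_ofPred_eq, Set.mem_inter_iff, Set.mem_iInter]
    rw [Matrix.posSemidef_iff_dotProduct_mulVec]
    simp [Matrix.IsHermitian]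
  rw [h]
  refine (isClosed_eq (by fun_prop) continuous_id).inter (isClosed_iInter fun x => ?_)
  exact isClosed_le continuous_const (by fun_prop)

/-- Evaluate the quadratic form at e_i ± e_j and bound the two diagonal entries by the trace. Hence
the trace alone controls compactness in the cone. -/
theorem abs_apply_le_trace (Q : PSDCone ι) (i j : ι) : |Q.1 i j| ≤ Q.1.trace := by
  classical
  have hdiag : ∀ k, 0 ≤ Q.1 k k := fun k => Q.2.diag_nonneg
  have hle : ∀ k, Q.1 k k ≤ Q.1.trace := fun k =>
    Finset.single_le_sum (f := fun k => Q.1 k k) (fun k _ => hdiag k) (Finset.mem_univ k)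
  have hsymm : Q.1 j i = Q.1 i j := by simpa using Q.2.isHermitian.apply i j
  have hq : ∀ s : ℝ, s ^ 2 = 1 → 0 ≤ Q.1 i i + Q.1 j j + 2 * s * Q.1 i j := by
    intro s hs
    have h := Q.2.dotProduct_mulVec_nonneg (Pi.single i 1 + Pi.single j s)
    simp only [star_trivial, Matrix.mulVec_add, add_dotProduct, dotProduct_add,
      single_dotProduct, Matrix.mulVec_single, Pi.smul_apply, Matrix.col_apply,
      MulOpposite.op_one, one_smul, one_mul, MulOpposite.smul_eq_mul_unop,
      MulOpposite.unop_op] at h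
    rw [hsymm] at h
    have : s * (Q.1 j j * s) = Q.1 j j := by
      rw [mul_comm (Q.1 j j), ← mul_assoc, ← sq, hs, one_mul]
    rw [this] at h
    linarith
  have h1 := hq 1 (by norm_num)
  have h2 := hq (-1) (by norm_num)
  have h3 := hle i
  have h4 := hle j
  rw [abs_le]
  constructor <;> linarith

theorem continuous_trace : Continuous fun Q : PSDCone ι => Q.1.trace := by
  fun_prop

theorem isCompact_trace_le (r : ℝ) : IsCompact {Q : PSDCone ι | Q.1.trace ≤ r} := by
  have hemb : IsClosedEmbedding (Subtype.val : PSDCone ι → Matrix ι ι ℝ) :=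
    isClosed_posSemidef.isClosedEmbedding_subtypeVal
  have hbox : IsCompact {Q : Matrix ι ι ℝ | ∀ i j, Q i j ∈ Set.Icc (-r) r} := by
    have h := isCompact_univ_pi (X := fun _ : ι => ι → ℝ) (s := fun _ =>
      Set.univ.pi fun _ : ι => Set.Icc (-r) r) fun _ => isCompact_univ_pi fun _ => isCompact_Icc
    have heq : {Q : Matrix ι ι ℝ | ∀ i j, Q i j ∈ Set.Icc (-r) r} =
        (Set.univ.pi fun _ : ι => Set.univ.pi fun _ : ι => Set.Icc (-r) r : Set (ι → ι → ℝ)) :=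
      Set.ext fun Q => ⟨fun hQ i _ j _ => hQ i j, fun hQ i j => hQ i trivial j trivial⟩
    rw [heq]
    exact h
  refine (hemb.isCompact_preimage hbox).of_isClosed_subset
    (isClosed_le continuous_trace continuous_const) fun Q hQ i j => ?_
  have := (abs_apply_le_trace Q i j).trans hQ
  rw [abs_le] at this
  exact this

variable [DecidableEq ι]

open scoped MatrixOrder in
/-- The square root of a positive semidefinite matrix, as an operator on Euclidean space. -/
def sqrtCLM (Q : PSDCone ι) : EuclideanSpace ℝ ι →L[ℝ] EuclideanSpace ℝ ι :=
  Matrix.toEuclideanCLM (𝕜 := ℝ) (CFC.sqrt Q.1)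

open scoped MatrixOrder in
theorem multivariateGaussian_eq_map (Q : PSDCone ι) :
    multivariateGaussian 0 Q.1 = (stdGaussian (EuclideanSpace ℝ ι)).map (sqrtCLM Q) := by
  simp [multivariateGaussian, sqrtCLM]

open scoped Matrix.Norms.L2Operator MatrixOrder in
-- All laws N(0, q) become images of one standard Gaussian, with samples depending continuously on
-- q, degenerate q included.
theorem continuous_sqrtCLM : Continuous (sqrtCLM (ι := ι)) := by
  have h1 : ContinuousOn CFC.sqrt {a : Matrix ι ι ℝ | 0 ≤ a} := CFC.continuousOn_sqrt
  have h2 : Continuous fun Q : PSDCone ι => CFC.sqrt Q.1 :=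
    h1.comp_continuous continuous_subtype_val fun Q => Q.2.nonneg
  have h3 : Continuous (Matrix.toEuclideanCLM (n := ι) (𝕜 := ℝ)) :=
    LinearMap.continuous_of_finiteDimensional
      ((Matrix.toEuclideanCLM (n := ι) (𝕜 := ℝ)).toAlgEquiv.toLinearMap)
  exact h3.comp h2

theorem exists_norm_sqrtCLM_le (r : ℝ) :
    ∃ B : ℝ, 0 ≤ B ∧ ∀ Q : PSDCone ι, Q.1.trace ≤ r → ‖sqrtCLM Q‖ ≤ B := by
  obtain ⟨B, hB⟩ := ((isCompact_trace_le (ι := ι) r).image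
    (continuous_sqrtCLM.norm)).bddAbove
  exact ⟨max B 0, le_max_right _ _, fun Q hQ =>
    (hB (Set.mem_image_of_mem _ hQ)).trans (le_max_left _ _)⟩

end PSDCone

theorem exists_integrable_exp_sq_stdGaussian (ι : Type) [Fintype ι] :
    ∃ c : ℝ, 0 < c ∧ Integrable (fun ξ : EuclideanSpace ℝ ι => Real.exp (c * ‖ξ‖ ^ 2))
      (stdGaussian (EuclideanSpace ℝ ι)) :=
  IsGaussian.exists_integrable_exp_sq _

/-! ### Functions that are Lipschitz up to a sublinear error -/

section NearLipschitz

variable {E F H : Type*} [NormedAddCommGroup E] [NormedAddCommGroup F] [NormedAddCommGroup H]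

/-- `f` is Lipschitz up to an error of sublinear growth. -/
def NearLipschitz (f : E → F) : Prop :=
  ∃ L : ℝ, 0 ≤ L ∧ ∀ ε : ℝ, 0 < ε → ∃ C : ℝ, 0 ≤ C ∧
    ∀ z z' : E, ‖f z - f z'‖ ≤ L * ‖z - z'‖ + ε * (‖z‖ + ‖z'‖) + C

/-- Outside a large ball ρ(z) ≤ ε‖z‖. Inside, ρ is not assumed bounded, but f is, by continuity and
compactness, so the inequality with ρ is used only at outer points. -/
theorem NearLipschitz.of_isLittleO [ProperSpace E] {f : E → F} (hf : Continuous f) {L : ℝ}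
    (hL : 0 ≤ L) {ρ : E → ℝ} (hρ : ρ =o[Bornology.cobounded E] fun z => ‖z‖)
    (h : ∀ z z', ‖f z - f z'‖ ≤ L * ‖z - z'‖ + ρ z + ρ z') : NearLipschitz f := by
  refine ⟨L, hL, fun ε hε => ?_⟩
  have h1 := (hρ.bound hε).filter_mono (le_refl _)
  rw [← comap_norm_atTop, eventually_comap] at h1
  obtain ⟨r, hr⟩ := eventually_atTop.1 h1
  have hout : ∀ z : E, r ≤ ‖z‖ → ρ z ≤ ε * ‖z‖ := fun z hz => by
    have := hr _ hz z rfl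
    rw [norm_norm] at this
    exact (le_abs_self _).trans this
  obtain ⟨M, hM⟩ := ((isCompact_closedBall (0 : E) r).image hf.norm).bddAbove
  have hin : ∀ z : E, ‖z‖ ≤ r → ‖f z‖ ≤ M := fun z hz =>
    hM (Set.mem_image_of_mem _ (mem_closedBall_zero_iff.2 hz))
  -- A fixed outer point `z₀` links an inner point to an outer one. If none exists, f is globally
  -- bounded.
  by_cases hz₀ : ∃ z₀ : E, r ≤ ‖z₀‖
  · obtain ⟨z₀, hz₀⟩ := hz₀
    set C := 2 * |M| + ‖f z₀‖ + L * (‖z₀‖ + |r|) + ε * ‖z₀‖ with hC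
    have hmix : ∀ z z' : E, ‖z‖ ≤ r → r ≤ ‖z'‖ →
        ‖f z - f z'‖ ≤ L * ‖z - z'‖ + ε * (‖z‖ + ‖z'‖) + C := by
      intro z z' hz hz'
      have e1 : ‖f z - f z'‖ ≤ ‖f z‖ + ‖f z₀‖ + ‖f z₀ - f z'‖ := by
        have : f z - f z' = f z - f z₀ + (f z₀ - f z') := by abel
        rw [this]
        exact (norm_add_le _ _).trans (by gcongr; exact norm_sub_le _ _)
      have e2 := h z₀ z'
      have e3 : ‖z₀ - z'‖ ≤ ‖z - z'‖ + (‖z₀‖ + |r|) := by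
        have : z₀ - z' = z - z' + (z₀ - z) := by abel
        rw [this]
        refine (norm_add_le _ _).trans ?_
        gcongr
        exact (norm_sub_le _ _).trans (by gcongr; exact hz.trans (le_abs_self r))
      have e4 := hin z hz
      have e5 := le_abs_self M
      have e6 := hout z₀ hz₀
      have e7 := hout z' hz'
      have e8 := mul_le_mul_of_nonneg_left e3 hL
      have e9 : 0 ≤ ε * ‖z‖ := by positivity
      have e10 := abs_nonneg M
      rw [hC]
      linarith
    refine ⟨C, by positivity, fun z z' => ?_⟩
    rcases le_total ‖z‖ r with hz | hz <;> rcases le_total ‖z'‖ r with hz' | hz'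
    · have e1 := norm_sub_le (f z) (f z')
      have e2 := hin z hz
      have e3 := hin z' hz'
      have e4 := le_abs_self M
      have e5 : 0 ≤ L * ‖z - z'‖ + ε * (‖z‖ + ‖z'‖) := by positivity
      have e6 : 0 ≤ ‖f z₀‖ + L * (‖z₀‖ + |r|) + ε * ‖z₀‖ := by positivity
      rw [hC]
      linarith
    · exact hmix z z' hz hz'
    · have := hmix z' z hz' hz
      rw [norm_sub_rev (f z), norm_sub_rev z, add_comm ‖z‖]
      exact this
    · have e1 := h z z'
      have e2 := hout z hz
      have e3 := hout z' hz'
      have e4 : 0 ≤ C := by positivity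
      linarith
  · push Not at hz₀
    refine ⟨2 * |M|, by positivity, fun z z' => ?_⟩
    have e1 := norm_sub_le (f z) (f z')
    have e2 := hin z (hz₀ z).le
    have e3 := hin z' (hz₀ z').le
    have e4 := le_abs_self M
    have e5 : 0 ≤ L * ‖z - z'‖ + ε * (‖z‖ + ‖z'‖) := by positivity
    linarith

theorem NearLipschitz.exists_norm_le {f : E → F} (hf : NearLipschitz f) :
    ∃ K : ℝ, 0 ≤ K ∧ ∀ z, ‖f z‖ ≤ K * (1 + ‖z‖) := by
  obtain ⟨L, hL, h⟩ := hf
  obtain ⟨C, hC, h⟩ := h 1 one_pos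
  refine ⟨L + 1 + C + ‖f 0‖, by positivity, fun z => ?_⟩
  have h1 := h z 0
  rw [sub_zero, norm_zero, add_zero] at h1
  have h2 : ‖f z‖ ≤ ‖f z - f 0‖ + ‖f 0‖ := by
    simpa using norm_add_le (f z - f 0) (f 0)
  have h3 : 0 ≤ (C + ‖f 0‖) * ‖z‖ := by positivity
  linarith

/-- The outer error is measured by ‖f z‖, which grows at most linearly, so sublinear errors remain
sublinear; ε is split in halves between the two maps. -/
theorem NearLipschitz.comp {g : F → H} {f : E → F} (hg : NearLipschitz g) (hf : NearLipschitz f) :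
    NearLipschitz (g ∘ f) := by
  obtain ⟨K, hK, hfK⟩ := hf.exists_norm_le
  obtain ⟨L₁, hL₁, hg⟩ := hg
  obtain ⟨L₂, hL₂, hf⟩ := hf
  refine ⟨L₁ * L₂, by positivity, fun ε hε => ?_⟩
  obtain ⟨C₁, hC₁, h₁⟩ := hg (ε / (2 * (K + 1))) (by positivity)
  obtain ⟨C₂, hC₂, h₂⟩ := hf (ε / (2 * (L₁ + 1))) (by positivity)
  refine ⟨L₁ * C₂ + ε + C₁, by positivity, fun z z' => ?_⟩
  have e1 : L₁ * ‖f z - f z'‖ ≤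
      L₁ * (L₂ * ‖z - z'‖ + ε / (2 * (L₁ + 1)) * (‖z‖ + ‖z'‖) + C₂) := by
    gcongr; exact h₂ z z'
  have e2 : L₁ * (ε / (2 * (L₁ + 1))) ≤ ε / 2 := by
    rw [← mul_div_assoc, div_le_div_iff₀ (by positivity) two_pos]
    nlinarith
  have e3 : ε / (2 * (K + 1)) * (‖f z‖ + ‖f z'‖) ≤
      ε / (2 * (K + 1)) * (K * (1 + ‖z‖) + K * (1 + ‖z'‖)) := by
    gcongr
    · exact hfK z
    · exact hfK z'
  have e4 : ε / (2 * (K + 1)) * K ≤ ε / 2 := by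
    rw [div_mul_eq_mul_div, div_le_div_iff₀ (by positivity) two_pos]
    nlinarith
  have e5 := mul_le_mul_of_nonneg_right e2 (add_nonneg (norm_nonneg z) (norm_nonneg z'))
  have e6 := mul_le_mul_of_nonneg_right e4
    (add_nonneg (add_nonneg one_pos.le (norm_nonneg z)) (add_nonneg one_pos.le (norm_nonneg z')))
  have e7 := h₁ (f z) (f z')
  simp only [Function.comp]
  nlinarith

theorem NearLipschitz.of_clm [NormedSpace ℝ E] [NormedSpace ℝ F] (T : E →L[ℝ] F) :
    NearLipschitz T := by
  refine ⟨‖T‖, norm_nonneg _, fun ε hε => ⟨0, le_rfl, fun z z' => ?_⟩⟩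
  rw [← map_sub]
  have := T.le_opNorm (z - z')
  have : 0 ≤ ε * (‖z‖ + ‖z'‖) := by positivity
  linarith

/-- `f` has at most quadratic growth, and its oscillation between points whose distance is small
compared to their norms is small compared to the square of their norms. -/
structure NearQuadratic (f : E → ℝ) : Prop where
  continuous : Continuous f
  growth : ∃ K : ℝ, 0 ≤ K ∧ ∀ z, |f z| ≤ K * (1 + ‖z‖ ^ 2)
  oscillation : ∀ B δ : ℝ, 0 ≤ B → 0 < δ → ∃ η C : ℝ, 0 < η ∧ 0 ≤ C ∧
    ∀ (z z' : E) (u : ℝ), 0 ≤ u → ‖z‖ ≤ B * u → ‖z'‖ ≤ B * u → ‖z - z'‖ ≤ η * u →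
      |f z - f z'| ≤ δ * u ^ 2 + C

theorem NearQuadratic.zero : NearQuadratic fun _ : E => (0 : ℝ) where
  continuous := continuous_const
  growth := ⟨0, le_rfl, by simp⟩
  oscillation := fun B δ _ hδ => ⟨1, 0, one_pos, le_rfl, fun z z' u _ _ _ _ => by
    simp only [sub_self, abs_zero, add_zero]; positivity⟩

theorem NearQuadratic.add {f g : E → ℝ} (hf : NearQuadratic f) (hg : NearQuadratic g) :
    NearQuadratic fun z => f z + g z where
  continuous := hf.continuous.add hg.continuous
  growth := by
    obtain ⟨K₁, hK₁, h₁⟩ := hf.growth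
    obtain ⟨K₂, hK₂, h₂⟩ := hg.growth
    refine ⟨K₁ + K₂, by positivity, fun z => (abs_add_le _ _).trans ?_⟩
    rw [add_mul]
    exact add_le_add (h₁ z) (h₂ z)
  oscillation := fun B δ hB hδ => by
    obtain ⟨η₁, C₁, hη₁, hC₁, h₁⟩ := hf.oscillation B (δ / 2) hB (half_pos hδ)
    obtain ⟨η₂, C₂, hη₂, hC₂, h₂⟩ := hg.oscillation B (δ / 2) hB (half_pos hδ)
    refine ⟨min η₁ η₂, C₁ + C₂, lt_min hη₁ hη₂, by positivity, fun z z' u hu hz hz' hzz => ?_⟩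
    have e1 := h₁ z z' u hu hz hz' (hzz.trans (by gcongr; exact min_le_left _ _))
    have e2 := h₂ z z' u hu hz hz' (hzz.trans (by gcongr; exact min_le_right _ _))
    have e3 : f z + g z - (f z' + g z') = (f z - f z') + (g z - g z') := by ring
    rw [e3]
    refine (abs_add_le _ _).trans ?_
    linarith

theorem NearQuadratic.const_mul {f : E → ℝ} (hf : NearQuadratic f) (c : ℝ) :
    NearQuadratic fun z => c * f z where
  continuous := hf.continuous.const_mul c
  growth := by
    obtain ⟨K, hK, h⟩ := hf.growth
    refine ⟨|c| * K, by positivity, fun z => ?_⟩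
    rw [abs_mul, mul_assoc]
    exact mul_le_mul_of_nonneg_left (h z) (abs_nonneg c)
  oscillation := fun B δ hB hδ => by
    obtain ⟨η, C, hη, hC, h⟩ := hf.oscillation B (δ / (|c| + 1)) hB (by positivity)
    refine ⟨η, |c| * C, hη, by positivity, fun z z' u hu hz hz' hzz => ?_⟩
    rw [← mul_sub, abs_mul]
    have e1 := mul_le_mul_of_nonneg_left (h z z' u hu hz hz' hzz) (abs_nonneg c)
    have e2 : |c| * (δ / (|c| + 1)) ≤ δ := by
      rw [← mul_div_assoc, div_le_iff₀ (by positivity)]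
      nlinarith [abs_nonneg c]
    have e3 := mul_le_mul_of_nonneg_right e2 (sq_nonneg u)
    linarith

theorem NearQuadratic.sum {ι : Type*} (s : Finset ι) {f : ι → E → ℝ}
    (hf : ∀ i ∈ s, NearQuadratic (f i)) : NearQuadratic fun z => ∑ i ∈ s, f i z := by
  classical
  induction s using Finset.induction_on with
  | empty => simpa using NearQuadratic.zero
  | insert a s ha ih =>
    simp_rw [Finset.sum_insert ha]
    exact (hf a (Finset.mem_insert_self a s)).add
      (ih fun i hi => hf i (Finset.mem_insert_of_mem hi))

/-- Each factor has size O(1 + u) and oscillation at most τu + C, with τ as small as desired; the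
product rule f g - f' g' = (f - f') g + f' (g - g') gives a small multiple of u². -/
theorem NearLipschitz.nearQuadratic_mul {f g : E → ℝ} (hf : NearLipschitz f)
    (hg : NearLipschitz g) (hfc : Continuous f) (hgc : Continuous g) :
    NearQuadratic fun z => f z * g z := by
  obtain ⟨K₁, hK₁, hfK⟩ := hf.exists_norm_le
  obtain ⟨K₂, hK₂, hgK⟩ := hg.exists_norm_le
  obtain ⟨L₁, hL₁, hf⟩ := hf
  obtain ⟨L₂, hL₂, hg⟩ := hg
  refine ⟨hfc.mul hgc, ⟨2 * (K₁ * K₂), by positivity, fun z => ?_⟩, fun B δ hB hδ => ?_⟩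
  · rw [abs_mul]
    calc |f z| * |g z| ≤ (K₁ * (1 + ‖z‖)) * (K₂ * (1 + ‖z‖)) :=
          mul_le_mul (hfK z) (hgK z) (abs_nonneg _) (by positivity)
      _ = K₁ * K₂ * (1 + ‖z‖) ^ 2 := by ring
      _ ≤ K₁ * K₂ * (2 * (1 + ‖z‖ ^ 2)) := by
          gcongr; nlinarith [sq_nonneg (1 - ‖z‖)]
      _ = _ := by ring
  set K := K₁ + K₂ with hK
  set L := L₁ + L₂ with hL
  have hK0 : 0 ≤ K := by positivity
  have hL0 : 0 ≤ L := by positivity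
  -- the oscillation of each factor is at most `τ * u + C`
  set τ := δ / (8 * (K + 1) * (B + 1)) with hτ
  have hτ0 : 0 < τ := by positivity
  obtain ⟨C₁, hC₁, h₁⟩ := hf (τ / (4 * (B + 1))) (by positivity)
  obtain ⟨C₂, hC₂, h₂⟩ := hg (τ / (4 * (B + 1))) (by positivity)
  set C := C₁ + C₂ with hC
  have hC0 : 0 ≤ C := by positivity
  have hosc : ∀ (u a b c : ℝ), 0 ≤ u → a ≤ B * u → b ≤ B * u → c ≤ τ / (2 * (L + 1)) * u →
      L * c + τ / (4 * (B + 1)) * (a + b) ≤ τ * u := by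
    intro u a b c hu ha hb hc
    have e1 : L * c ≤ τ / 2 * u := by
      calc L * c ≤ (L + 1) * (τ / (2 * (L + 1)) * u) := by
            have : 0 ≤ τ / (2 * (L + 1)) * u := by positivity
            nlinarith
        _ = τ / 2 * u := by field_simp
    have e2 : τ / (4 * (B + 1)) * (a + b) ≤ τ / 2 * u := by
      calc τ / (4 * (B + 1)) * (a + b) ≤ τ / (4 * (B + 1)) * (2 * ((B + 1) * u)) := by
            gcongr; linarith
        _ = τ / 2 * u := by field_simp; ring
    linarith
  -- Expanding 2(τu + C)K(1 + Bu) leaves a u² term with coefficient at most δ/4, a linear term Du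
  -- and a constant. Young's inequality trades Du for δ/2 · u² plus D²/(2δ).
  refine ⟨τ / (2 * (L + 1)), 2 * (K * C) + (2 * (K * (τ + C * B))) ^ 2 / (2 * δ), by positivity,
    by positivity, fun z z' u hu hz hz' hzz => ?_⟩
  have hd := hosc u _ _ _ hu hz hz' hzz
  have d1 : |f z - f z'| ≤ τ * u + C := by
    have := h₁ z z'
    rw [Real.norm_eq_abs] at this
    have : L₁ * ‖z - z'‖ ≤ L * ‖z - z'‖ := by gcongr; linarith
    linarith
  have d2 : |g z - g z'| ≤ τ * u + C := by
    have := h₂ z z'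
    rw [Real.norm_eq_abs] at this
    have : L₂ * ‖z - z'‖ ≤ L * ‖z - z'‖ := by gcongr; linarith
    linarith
  have s1 : |g z| ≤ K * (1 + B * u) := by
    refine (hgK z).trans ?_
    gcongr
    linarith
  have s2 : |f z'| ≤ K * (1 + B * u) := by
    refine (hfK z').trans ?_
    gcongr
    linarith
  have e : f z * g z - f z' * g z' = (f z - f z') * g z + f z' * (g z - g z') := by ring
  rw [e]
  have e1 : |(f z - f z') * g z + f z' * (g z - g z')| ≤
      2 * ((τ * u + C) * (K * (1 + B * u))) := by
    refine (abs_add_le _ _).trans ?_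
    rw [abs_mul, abs_mul, two_mul]
    refine add_le_add (mul_le_mul d1 s1 (abs_nonneg _) (by positivity)) ?_
    rw [mul_comm]
    exact mul_le_mul d2 s2 (abs_nonneg _) (by positivity)
  refine e1.trans ?_
  have e2 : 2 * (τ * K * B) ≤ δ / 4 := by
    rw [hτ]
    calc 2 * (δ / (8 * (K + 1) * (B + 1)) * K * B) = δ / 4 * ((K * B) / ((K + 1) * (B + 1))) := by
          field_simp; ring
      _ ≤ δ / 4 * 1 := by
          gcongr
          rw [div_le_one (by positivity)]
          nlinarith
      _ = δ / 4 := mul_one _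
  set D := 2 * (K * (τ + C * B)) with hD
  have e3 : D * u ≤ δ / 2 * u ^ 2 + D ^ 2 / (2 * δ) := by
    rw [← sub_nonneg]
    have : δ / 2 * u ^ 2 + D ^ 2 / (2 * δ) - D * u = (δ * u - D) ^ 2 / (2 * δ) := by
      field_simp; ring
    rw [this]
    positivity
  have e4 := mul_le_mul_of_nonneg_right e2 (sq_nonneg u)
  have e5 : 0 ≤ δ / 4 * u ^ 2 := by positivity
  nlinarith

end NearLipschitz

/-! ### Exponential moments of functions of a Gaussian vector -/

section GaussMGF

variable {ι : Type} [Fintype ι] [DecidableEq ι]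

/-- The exponential moment of `f` under the centred Gaussian law with covariance matrix `q`. -/
def gaussMGF (f : EuclideanSpace ℝ ι → ℝ) (q : PSDCone ι) : ℝ≥0∞ :=
  ∫⁻ z, ENNReal.ofReal (Real.exp (f z)) ∂(multivariateGaussian 0 q.1)

theorem gaussMGF_eq {f : EuclideanSpace ℝ ι → ℝ} (hf : Continuous f) (q : PSDCone ι) :
    gaussMGF f q = ∫⁻ ξ, ENNReal.ofReal (Real.exp (f (q.sqrtCLM ξ)))
      ∂(stdGaussian (EuclideanSpace ℝ ι)) := by
  rw [gaussMGF, PSDCone.multivariateGaussian_eq_map, lintegral_map (by fun_prop) (by fun_prop)]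

theorem gaussMGF_zero (q : PSDCone ι) : gaussMGF (fun _ => 0) q = 1 := by
  simp [gaussMGF]

theorem gaussMGF_pos (f : EuclideanSpace ℝ ι → ℝ) (hf : Continuous f) (q : PSDCone ι) :
    gaussMGF f q ≠ 0 := by
  rw [gaussMGF, Ne, lintegral_eq_zero_iff (by fun_prop)]
  intro h
  obtain ⟨z, hz⟩ := h.exists
  have h1 : Real.exp (f z) ≤ 0 := by simpa using hz
  exact absurd h1 (not_le.2 (Real.exp_pos _))

/-- Take u = ‖ξ‖ in the oscillation bound: √q ξ and √q₁ ξ differ by at most ‖√q - √q₁‖ ‖ξ‖. -/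
theorem NearQuadratic.exists_abs_comp_sqrtCLM_sub_le {f : EuclideanSpace ℝ ι → ℝ}
    (hf : NearQuadratic f) (q₁ : PSDCone ι) {δ : ℝ} (hδ : 0 < δ) :
    ∃ C : ℝ, 0 ≤ C ∧ ∀ᶠ q in 𝓝 q₁, ∀ ξ : EuclideanSpace ℝ ι,
      |f (q.sqrtCLM ξ) - f (q₁.sqrtCLM ξ)| ≤ δ * ‖ξ‖ ^ 2 + C := by
  obtain ⟨η, C, hη, hC, h⟩ := hf.oscillation (‖q₁.sqrtCLM‖ + 1) δ (by positivity) hδ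
  refine ⟨C, hC, ?_⟩
  have hcont := (PSDCone.continuous_sqrtCLM (ι := ι)).tendsto q₁
  filter_upwards [hcont.eventually (Metric.ball_mem_nhds _ hη),
    hcont.norm.eventually_lt_const (lt_add_one ‖q₁.sqrtCLM‖)] with q hq hq' ξ
  refine h _ _ ‖ξ‖ (norm_nonneg _) ?_ ?_ ?_
  · exact (q.sqrtCLM.le_opNorm ξ).trans (by gcongr)
  · exact (q₁.sqrtCLM.le_opNorm ξ).trans (by gcongr; linarith)
  · rw [← sub_apply]
    refine (ContinuousLinearMap.le_opNorm _ ξ).trans ?_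
    gcongr
    exact (mem_ball_iff_norm.1 hq).le

theorem continuous_sqrtCLM_apply (ξ : EuclideanSpace ℝ ι) :
    Continuous fun q : PSDCone ι => q.sqrtCLM ξ :=
  PSDCone.continuous_sqrtCLM.clm_apply continuous_const

/-- Dominated convergence under the standard Gaussian. The spare exponent p > 1 pays, through
Young's inequality with the conjugate exponent p', for the perturbation of f, whose exponential is
integrable by Fernique's theorem. -/
theorem tendsto_gaussMGF {f : EuclideanSpace ℝ ι → ℝ} (hf : NearQuadratic f) (q₁ : PSDCone ι)
    {p : ℝ} (hp : 1 < p) (hfin : gaussMGF (fun z => p * f z) q₁ ≠ ∞) :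
    Tendsto (gaussMGF f) (𝓝 q₁) (𝓝 (gaussMGF f q₁)) := by
  have hfc := hf.continuous
  obtain ⟨c, hc, hcint⟩ := exists_integrable_exp_sq_stdGaussian ι
  set p' : ℝ := p / (p - 1) with hp'
  have hp1 : 0 < p - 1 := by linarith
  have hp'0 : 0 < p' := by positivity
  obtain ⟨C, hC, hev⟩ := hf.exists_abs_comp_sqrtCLM_sub_le q₁ (div_pos hc hp'0)
  rw [gaussMGF_eq hfc]
  have heq : gaussMGF f = fun q => ∫⁻ ξ, ENNReal.ofReal (Real.exp (f (q.sqrtCLM ξ)))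
      ∂(stdGaussian (EuclideanSpace ℝ ι)) := funext fun q => gaussMGF_eq hfc q
  rw [heq]
  refine tendsto_lintegral_filter_of_dominated_convergence
    (fun ξ => ENNReal.ofReal (Real.exp (p * f (q₁.sqrtCLM ξ))) +
      ENNReal.ofReal (Real.exp (p' * C)) * ENNReal.ofReal (Real.exp (c * ‖ξ‖ ^ 2)))
    (Eventually.of_forall fun q => by fun_prop) ?_ ?_ (ae_of_all _ fun ξ => ?_)
  · filter_upwards [hev] with q hq
    refine ae_of_all _ fun ξ => ?_
    rw [← ENNReal.ofReal_mul (Real.exp_pos _).le, ← Real.exp_add,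
      ← ENNReal.ofReal_add (Real.exp_pos _).le (Real.exp_pos _).le]
    refine ENNReal.ofReal_le_ofReal ?_
    have h1 := (abs_le.1 (hq ξ)).2
    set a := f (q₁.sqrtCLM ξ)
    set v := c / p' * ‖ξ‖ ^ 2 + C with hv
    have h2 : p' * C + c * ‖ξ‖ ^ 2 = p' * v := by rw [hv]; field_simp; ring
    rw [h2]
    -- The sum a + v is the convex combination of p a and p' v with weights 1/p and 1/p', hence at
    -- most their maximum; the sum of the two exponentials then dominates.
    have h3 : f (q.sqrtCLM ξ) ≤ max (p * a) (p' * v) := by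
      have h4 : p⁻¹ * (p * a) + p'⁻¹ * (p' * v) ≤
          p⁻¹ * max (p * a) (p' * v) + p'⁻¹ * max (p * a) (p' * v) := by
        gcongr
        · exact le_max_left _ _
        · exact le_max_right _ _
      rw [← add_mul, inv_mul_cancel_left₀ (by positivity), inv_mul_cancel_left₀ hp'0.ne'] at h4
      have h5 : p⁻¹ + p'⁻¹ = 1 := by
        rw [hp']; field_simp; ring
      rw [h5, one_mul] at h4
      linarith
    rcases max_cases (p * a) (p' * v) with ⟨h, -⟩ | ⟨h, -⟩ <;> rw [h] at h3
    · exact (Real.exp_le_exp.2 h3).trans (le_add_of_nonneg_right (Real.exp_pos _).le)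
    · exact (Real.exp_le_exp.2 h3).trans (le_add_of_nonneg_left (Real.exp_pos _).le)
  · rw [lintegral_add_left (by fun_prop)]
    refine ENNReal.add_ne_top.2 ⟨?_, ?_⟩
    · rwa [gaussMGF_eq (by fun_prop)] at hfin
    · rw [lintegral_const_mul _ (by fun_prop)]
      exact ENNReal.mul_ne_top ENNReal.ofReal_ne_top hcint.lintegral_lt_top.ne
  · have h1 : Continuous fun q : PSDCone ι =>
        ENNReal.ofReal (Real.exp (f (q.sqrtCLM ξ))) :=
      ENNReal.continuous_ofReal.comp
        (Real.continuous_exp.comp (hfc.comp (continuous_sqrtCLM_apply ξ)))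
    exact h1.tendsto q₁

/-- Integrate the convexity inequality exp(sx) ≤ 1 - s + s exp(x) at x = f - Λ. -/
theorem gaussMGF_const_mul_le {f : EuclideanSpace ℝ ι → ℝ} (q : PSDCone ι)
    {s Λ : ℝ} (hs : 0 ≤ s) (hs1 : s ≤ 1) (h : gaussMGF f q ≤ ENNReal.ofReal (Real.exp Λ)) :
    gaussMGF (fun z => s * f z) q ≤ ENNReal.ofReal (Real.exp (s * Λ)) := by
  have hpt : ∀ z, ENNReal.ofReal (Real.exp (s * f z)) ≤
      ENNReal.ofReal (Real.exp (s * Λ) * (1 - s)) +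
        ENNReal.ofReal (Real.exp (s * Λ) * s * Real.exp (-Λ)) *
          ENNReal.ofReal (Real.exp (f z)) := by
    intro z
    rw [← ENNReal.ofReal_mul (by positivity), ← ENNReal.ofReal_add
      (mul_nonneg (Real.exp_pos _).le (by linarith)) (by positivity)]
    refine ENNReal.ofReal_le_ofReal ?_
    have h1 := convexOn_exp.2 (Set.mem_univ 0) (Set.mem_univ (f z - Λ))
      (sub_nonneg.2 hs1) hs (by ring)
    simp only [smul_eq_mul, mul_zero, zero_add, Real.exp_zero, mul_one] at h1
    calc Real.exp (s * f z) = Real.exp (s * Λ) * Real.exp (s * (f z - Λ)) := by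
          rw [← Real.exp_add]; congr 1; ring
      _ ≤ Real.exp (s * Λ) * (1 - s + s * Real.exp (f z - Λ)) := by gcongr
      _ = _ := by rw [sub_eq_add_neg (f z), Real.exp_add]; ring
  calc gaussMGF (fun z => s * f z) q
      ≤ ∫⁻ z, ENNReal.ofReal (Real.exp (s * Λ) * (1 - s)) +
        ENNReal.ofReal (Real.exp (s * Λ) * s * Real.exp (-Λ)) *
          ENNReal.ofReal (Real.exp (f z)) ∂(multivariateGaussian 0 q.1) :=
        lintegral_mono hpt
    _ = ENNReal.ofReal (Real.exp (s * Λ) * (1 - s)) +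
        ENNReal.ofReal (Real.exp (s * Λ) * s * Real.exp (-Λ)) * gaussMGF f q := by
        rw [lintegral_add_left measurable_const, lintegral_const, measure_univ, mul_one,
          lintegral_const_mul' _ _ ENNReal.ofReal_ne_top, gaussMGF]
    _ ≤ ENNReal.ofReal (Real.exp (s * Λ) * (1 - s)) +
        ENNReal.ofReal (Real.exp (s * Λ) * s * Real.exp (-Λ)) * ENNReal.ofReal (Real.exp Λ) := by
        gcongr
    _ = ENNReal.ofReal (Real.exp (s * Λ)) := by
        rw [← ENNReal.ofReal_mul (by positivity), ← ENNReal.ofReal_add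
          (mul_nonneg (Real.exp_pos _).le (by linarith)) (by positivity)]
        congr 1
        rw [mul_assoc _ (Real.exp (-Λ)), ← Real.exp_add, neg_add_cancel, Real.exp_zero]
        ring

/-- A strict lower bound on the Legendre functional at a covariance matrix `q₁` persists, after
shrinking the dual variable, in a neighbourhood of `q₁`. -/
theorem exists_scaled_gaussMGF_le {f : EuclideanSpace ℝ ι → ℝ} (hf : NearQuadratic f)
    (q₁ : PSDCone ι) {a y Λ : ℝ} (hΛ : gaussMGF f q₁ ≤ ENNReal.ofReal (Real.exp Λ))
    (ha : a < y - Λ) :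
    ∃ s c : ℝ, (∀ᶠ q in 𝓝 q₁, gaussMGF (fun z => s * f z) q ≤ ENNReal.ofReal (Real.exp c)) ∧
      a < s * y - c := by
  -- Near q₁ the moment of f itself may be infinite. Scaling by s < 1 leaves integrability of the
  -- power s⁻¹ > 1 at q₁, and the loss in the Legendre value vanishes as s → 1.
  have hlim : Tendsto (fun s : ℝ => s * (y - Λ)) (𝓝[<] 1) (𝓝 (y - Λ)) := by
    have : Tendsto (fun s : ℝ => s * (y - Λ)) (𝓝 1) (𝓝 (1 * (y - Λ))) :=
      tendsto_id.mul_const _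
    rw [one_mul] at this
    exact this.mono_left nhdsWithin_le_nhds
  have hIoo : ∀ᶠ s : ℝ in 𝓝[<] 1, s ∈ Set.Ioo 0 1 := Ioo_mem_nhdsLT one_pos
  obtain ⟨s, hs, hs0, hs1⟩ := ((hlim.eventually_const_lt ha).and hIoo).exists
  obtain ⟨c, hc1, hc2⟩ := exists_between (show s * Λ < s * y - a by linarith)
  refine ⟨s, c, ?_, by linarith⟩
  have hfin : gaussMGF (fun z => s⁻¹ * (s * f z)) q₁ ≠ ∞ := by
    simp_rw [inv_mul_cancel_left₀ hs0.ne']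
    exact (hΛ.trans_lt ENNReal.ofReal_lt_top).ne
  have ht := tendsto_gaussMGF (hf.const_mul s) q₁ ((one_lt_inv₀ hs0).2 hs1) hfin
  have hlt : gaussMGF (fun z => s * f z) q₁ < ENNReal.ofReal (Real.exp c) :=
    (gaussMGF_const_mul_le q₁ hs0.le hs1.le hΛ).trans_lt
      ((ENNReal.ofReal_lt_ofReal_iff (Real.exp_pos _)).2 (Real.exp_lt_exp.2 hc1))
  filter_upwards [ht.eventually_lt_const hlt] with q hq using hq.le

/-- A bounded trace bounds ‖√q‖, so t f(√q ξ) is at most c‖ξ‖² plus a constant for small t, within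
the range of Fernique's theorem. -/
theorem exists_gaussMGF_le_of_trace_le {f : EuclideanSpace ℝ ι → ℝ} (hf : NearQuadratic f)
    (r : ℝ) : ∃ t C : ℝ, 0 < t ∧ ∀ q : PSDCone ι, q.1.trace ≤ r →
      gaussMGF (fun z => t * f z) q ≤ ENNReal.ofReal (Real.exp C) := by
  obtain ⟨c, hc, hcint⟩ := exists_integrable_exp_sq_stdGaussian ι
  obtain ⟨B, hB, hBq⟩ := PSDCone.exists_norm_sqrtCLM_le (ι := ι) r
  obtain ⟨K, hK, hfK⟩ := hf.growth
  set t : ℝ := c / ((K + 1) * (B ^ 2 + 1)) with ht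
  have ht0 : 0 < t := by positivity
  set J := ∫ ξ : EuclideanSpace ℝ ι, Real.exp (c * ‖ξ‖ ^ 2) ∂(stdGaussian (EuclideanSpace ℝ ι))
    with hJ
  have hJpos : 0 < J := integral_exp_pos hcint
  refine ⟨t, t * K + Real.log J, ht0, fun q hq => ?_⟩
  have hfc := hf.continuous
  rw [gaussMGF_eq (by fun_prop), Real.exp_add, Real.exp_log hJpos,
    ENNReal.ofReal_mul (Real.exp_pos _).le, hJ, ofReal_integral_eq_lintegral_ofReal hcint
      (ae_of_all _ fun ξ => (Real.exp_pos _).le), ← lintegral_const_mul _ (by fun_prop)]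
  refine lintegral_mono fun ξ => ?_
  rw [← ENNReal.ofReal_mul (Real.exp_pos _).le, ← Real.exp_add]
  refine ENNReal.ofReal_le_ofReal (Real.exp_le_exp.2 ?_)
  have h1 : ‖q.sqrtCLM ξ‖ ≤ B * ‖ξ‖ :=
    (q.sqrtCLM.le_opNorm ξ).trans (by gcongr; exact hBq q hq)
  have h2 : f (q.sqrtCLM ξ) ≤ K * (1 + (B * ‖ξ‖) ^ 2) :=
    ((le_abs_self _).trans (hfK _)).trans (by gcongr)
  have h3 : t * (K * B ^ 2) ≤ c := by
    rw [ht, div_mul_eq_mul_div, div_le_iff₀ (by positivity)]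
    have : K * B ^ 2 ≤ (K + 1) * (B ^ 2 + 1) := by nlinarith [sq_nonneg B]
    nlinarith
  have h4 := mul_le_mul_of_nonneg_left h2 ht0.le
  have h5 := mul_le_mul_of_nonneg_right h3 (sq_nonneg ‖ξ‖)
  linarith

end GaussMGF

/-! ### The conditional rate function of a layer -/

namespace ConvNet

variable (A : ConvNet)

/-- The pairing of `G^{(ℓ)}` with a matrix. -/
def dualG (ℓ : ℕ) (θ : Matrix (A.Idx (ℓ + 1)) (A.Idx (ℓ + 1)) ℝ)
    (z : EuclideanSpace ℝ (A.Idx ℓ)) : ℝ :=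
  (θ.transpose * A.G ℓ z.ofLp).trace

theorem trace_transpose_mul {J : Type} [Fintype J] (θ Q : Matrix J J ℝ) :
    (θ.transpose * Q).trace = ∑ p, ∑ q, θ p q * Q p q := by
  simp only [Matrix.trace, Matrix.diag_apply, Matrix.mul_apply, Matrix.transpose_apply]
  exact Finset.sum_comm

theorem continuous_trace_transpose_mul {J : Type} [Fintype J] (θ : Matrix J J ℝ) :
    Continuous fun Q : PSDCone J => (θ.transpose * Q.1).trace := by
  fun_prop

theorem dualG_smul (ℓ : ℕ) (s : ℝ) (θ : Matrix (A.Idx (ℓ + 1)) (A.Idx (ℓ + 1)) ℝ) :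
    A.dualG ℓ (s • θ) = fun z => s * A.dualG ℓ θ z := by
  ext z
  simp [dualG]

/-! ### Regularity of the features and of the dual forms -/

section Regularity

variable {A}

theorem nearLipschitz_activation (hσ : AsympLipschitzActivation A.σ) : NearLipschitz A.σ := by
  obtain ⟨hc, L, ρ, hL, -, hρ, h⟩ := hσ
  exact NearLipschitz.of_isLittleO hc hL hρ h

/-- The growth condition on ρ refers to the sup-norm bornology; since `ofLp` is antilipschitz, it
transfers to Euclidean space. -/
theorem _root_.AsympLipschitzMap.nearLipschitz {ι κ : Type} [Fintype ι] [Fintype κ]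
    {f : (ι → ℝ) → (κ → ℝ)} (hf : AsympLipschitzMap f) :
    NearLipschitz fun z : EuclideanSpace ℝ ι =>
      (WithLp.toLp 2 (f z.ofLp) : EuclideanSpace ℝ κ) := by
  obtain ⟨hc, L, ρ, hL, hρ, h⟩ := hf
  have hcob : Tendsto (fun z : EuclideanSpace ℝ ι => z.ofLp) (Bornology.cobounded _)
      (Bornology.cobounded (ι → ℝ)) :=
    (PiLp.antilipschitzWith_ofLp 2 fun _ : ι => ℝ).tendsto_cobounded
  refine NearLipschitz.of_isLittleO (by fun_prop) hL (ρ := fun z => ρ z.ofLp)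
    (hρ.comp_tendsto hcob) fun z z' => ?_
  exact h z.ofLp z'.ofLp

theorem nearLipschitz_feature {ℓ : ℕ} (hσ : AsympLipschitzActivation A.σ)
    (hR : ∀ i : Fin (A.N (ℓ + 1)), AsympLipschitzMap (A.R ℓ i))
    (p : A.Idx (ℓ + 1)) (m : A.Mask ℓ) :
    NearLipschitz fun z : EuclideanSpace ℝ (A.Idx ℓ) =>
      A.σ (A.R ℓ p.1 (fun i => z.ofLp (i, p.2)) m) := by
  let T : EuclideanSpace ℝ (A.Idx ℓ) →ₗ[ℝ] EuclideanSpace ℝ (Fin (A.N ℓ)) :=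
    { toFun := fun z => WithLp.toLp 2 fun i => z.ofLp (i, p.2)
      map_add' := fun _ _ => rfl
      map_smul' := fun _ _ => rfl }
  exact (nearLipschitz_activation hσ).comp
    (((NearLipschitz.of_clm (EuclideanSpace.proj m : EuclideanSpace ℝ (A.Mask ℓ) →L[ℝ] ℝ)).comp
      (hR p.1).nearLipschitz).comp
      (NearLipschitz.of_clm (LinearMap.toContinuousLinearMap T)))

theorem continuous_feature {ℓ : ℕ} (hσ : AsympLipschitzActivation A.σ)
    (hR : ∀ i : Fin (A.N (ℓ + 1)), AsympLipschitzMap (A.R ℓ i))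
    (p : A.Idx (ℓ + 1)) (m : A.Mask ℓ) :
    Continuous fun z : A.Idx ℓ → ℝ => A.σ (A.R ℓ p.1 (fun i => z (i, p.2)) m) := by
  have h1 := hσ.1
  have h2 := (hR p.1).1
  exact h1.comp ((continuous_apply m).comp (h2.comp (by fun_prop)))

theorem nearQuadratic_dualG {ℓ : ℕ} (hσ : AsympLipschitzActivation A.σ)
    (hR : ∀ i : Fin (A.N (ℓ + 1)), AsympLipschitzMap (A.R ℓ i))
    (θ : Matrix (A.Idx (ℓ + 1)) (A.Idx (ℓ + 1)) ℝ) : NearQuadratic (A.dualG ℓ θ) := by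
  have h : A.dualG ℓ θ = fun z => ∑ p, ∑ q, θ p q *
      (1 / ((A.prec ℓ : ℝ) * (Fintype.card (A.Mask ℓ) : ℝ)) *
        ∑ m, A.σ (A.R ℓ p.1 (fun i => z.ofLp (i, p.2)) m) *
          A.σ (A.R ℓ q.1 (fun i => z.ofLp (i, q.2)) m)) := by
    ext z
    rw [dualG, trace_transpose_mul]
    rfl
  rw [h]
  refine NearQuadratic.sum _ fun p _ => NearQuadratic.sum _ fun q _ =>
    NearQuadratic.const_mul (NearQuadratic.const_mul (NearQuadratic.sum _ fun m _ => ?_) _) _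
  exact (nearLipschitz_feature hσ hR p m).nearQuadratic_mul (nearLipschitz_feature hσ hR q m)
    ((continuous_feature hσ hR p m).comp (PiLp.continuous_ofLp 2 _))
    ((continuous_feature hσ hR q m).comp (PiLp.continuous_ofLp 2 _))

end Regularity

/-! ### Legendre duality for one layer -/

section CondRate

variable {A} {ℓ : ℕ}

theorem condRate_eq (Q₂ : PSDCone (A.Idx (ℓ + 1))) (Q₁ : PSDCone (A.Idx ℓ)) :
    A.condRate ℓ Q₂ Q₁ = ⨆ (θ : Matrix (A.Idx (ℓ + 1)) (A.Idx (ℓ + 1)) ℝ) (_ : θ.IsSymm),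
      (((θ.transpose * Q₂.1).trace : ℝ) : EReal) - ENNReal.log (gaussMGF (A.dualG ℓ θ) Q₁) :=
  rfl

theorem log_ofReal_exp (c : ℝ) : ENNReal.log (ENNReal.ofReal (Real.exp c)) = (c : EReal) := by
  rw [ENNReal.log_ofReal_of_pos (Real.exp_pos _), Real.log_exp]

theorem le_condRate {θ : Matrix (A.Idx (ℓ + 1)) (A.Idx (ℓ + 1)) ℝ} (hθ : θ.IsSymm)
    {Q₁ : PSDCone (A.Idx ℓ)} {c : ℝ}
    (hc : gaussMGF (A.dualG ℓ θ) Q₁ ≤ ENNReal.ofReal (Real.exp c))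
    (Q₂ : PSDCone (A.Idx (ℓ + 1))) :
    (((θ.transpose * Q₂.1).trace - c : ℝ) : EReal) ≤ A.condRate ℓ Q₂ Q₁ := by
  rw [condRate_eq]
  refine le_trans ?_ (le_iSup₂ θ hθ)
  rw [EReal.coe_sub]
  refine EReal.sub_le_sub le_rfl ?_
  rw [← log_ofReal_exp]
  exact ENNReal.log_monotone hc

theorem condRate_nonneg (Q₂ : PSDCone (A.Idx (ℓ + 1))) (Q₁ : PSDCone (A.Idx ℓ)) :
    0 ≤ A.condRate ℓ Q₂ Q₁ := by
  have h : A.dualG ℓ 0 = fun _ => 0 := by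
    ext z
    simp [dualG]
  have := le_condRate (A := A) (ℓ := ℓ) (θ := 0) (by simp) (Q₁ := Q₁) (c := 0)
    (by rw [h, gaussMGF_zero]; simp) Q₂
  simpa using this

theorem exists_eq_ofReal_exp {M : ℝ≥0∞} (h0 : M ≠ 0) (h1 : M ≠ ∞) :
    ∃ Λ : ℝ, M = ENNReal.ofReal (Real.exp Λ) := by
  refine ⟨Real.log M.toReal, ?_⟩
  rw [Real.exp_log (ENNReal.toReal_pos h0 h1), ENNReal.ofReal_toReal h1]

/-- A dual matrix with infinite moment contributes ⊥ to the supremum, so a witness of a strict lower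
bound has finite moment and can be shrunk to work for all q near Q₁. -/
theorem exists_dual_of_lt_condRate (hG : ∀ θ, NearQuadratic (A.dualG ℓ θ))
    {Q₂ : PSDCone (A.Idx (ℓ + 1))} {Q₁ : PSDCone (A.Idx ℓ)} {a : ℝ}
    (ha : (a : EReal) < A.condRate ℓ Q₂ Q₁) :
    ∃ (θ : Matrix (A.Idx (ℓ + 1)) (A.Idx (ℓ + 1)) ℝ) (c : ℝ), θ.IsSymm ∧
      (∀ᶠ q in 𝓝 Q₁, gaussMGF (A.dualG ℓ θ) q ≤ ENNReal.ofReal (Real.exp c)) ∧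
      a < (θ.transpose * Q₂.1).trace - c := by
  rw [condRate_eq, lt_iSup_iff] at ha
  obtain ⟨θ, ha⟩ := ha
  rw [lt_iSup_iff] at ha
  obtain ⟨hθ, ha⟩ := ha
  have hfin : gaussMGF (A.dualG ℓ θ) Q₁ ≠ ∞ := by
    intro h
    rw [h, ENNReal.log_top, EReal.sub_top] at ha
    exact not_lt_bot ha
  obtain ⟨Λ, hΛ⟩ := exists_eq_ofReal_exp (gaussMGF_pos _ (hG θ).continuous Q₁) hfin
  rw [hΛ, log_ofReal_exp, ← EReal.coe_sub, EReal.coe_lt_coe_iff] at ha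
  obtain ⟨s, c, hs, hsc⟩ := exists_scaled_gaussMGF_le (hG θ) Q₁ hΛ.le ha
  refine ⟨s • θ, c, hθ.smul s, ?_, ?_⟩
  · rw [dualG_smul]; exact hs
  · simpa using hsc

theorem eventually_lt_condRate (hG : ∀ θ, NearQuadratic (A.dualG ℓ θ))
    {Q₂ : PSDCone (A.Idx (ℓ + 1))} {Q₁ : PSDCone (A.Idx ℓ)} {a : ℝ}
    (ha : (a : EReal) < A.condRate ℓ Q₂ Q₁) :
    ∀ᶠ p in 𝓝 (Q₂, Q₁), (a : EReal) < A.condRate ℓ p.1 p.2 := by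
  obtain ⟨θ, c, hθ, hev, hlt⟩ := exists_dual_of_lt_condRate hG ha
  have h1 : ∀ᶠ Q in 𝓝 Q₂, a < (θ.transpose * Q.1).trace - c :=
    ((continuous_trace_transpose_mul θ).sub continuous_const).continuousAt.eventually_const_lt hlt
  rw [nhds_prod_eq]
  filter_upwards [h1.prod_mk hev] with p hp
  exact (EReal.coe_lt_coe_iff.2 hp.1).trans_le (le_condRate hθ hp.2 p.1)

theorem dualG_smul_one (t : ℝ) :
    A.dualG ℓ (t • 1) = fun z => t * A.dualG ℓ 1 z := A.dualG_smul ℓ t 1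

theorem exists_gaussMGF_trace_le (hG : ∀ θ, NearQuadratic (A.dualG ℓ θ)) (r : ℝ) :
    ∃ t C : ℝ, 0 < t ∧ ∀ q : PSDCone (A.Idx ℓ), q.1.trace ≤ r →
      gaussMGF (A.dualG ℓ (t • 1)) q ≤ ENNReal.ofReal (Real.exp C) := by
  simp_rw [dualG_smul_one]
  exact exists_gaussMGF_le_of_trace_le (hG 1) r

/-- Use t · 1 as dual matrix: its pairing with Q₂ is t times the trace. -/
theorem exists_trace_le_of_condRate_le (hG : ∀ θ, NearQuadratic (A.dualG ℓ θ)) (r b : ℝ) :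
    ∃ r' : ℝ, ∀ (Q₂ : PSDCone (A.Idx (ℓ + 1))) (Q₁ : PSDCone (A.Idx ℓ)), Q₁.1.trace ≤ r →
      A.condRate ℓ Q₂ Q₁ ≤ b → Q₂.1.trace ≤ r' := by
  obtain ⟨t, C, ht, h⟩ := exists_gaussMGF_trace_le hG r
  refine ⟨(b + C) / t, fun Q₂ Q₁ h1 h2 => ?_⟩
  have h3 := (le_condRate (Matrix.isSymm_one.smul t) (h Q₁ h1) Q₂).trans h2
  rw [EReal.coe_le_coe_iff] at h3
  rw [le_div_iff₀ ht]
  simp only [Matrix.transpose_smul, Matrix.transpose_one, Matrix.smul_mul, Matrix.one_mul,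
    Matrix.trace_smul, smul_eq_mul] at h3
  linarith

/-- The rate involves symmetric dual matrices only, whereas Cramér's bound is applied in the space
of all matrices. Symmetrising θ changes neither pairing, since Q₂ and G are symmetric. -/
theorem ofReal_exp_le_gaussMGF (hG : ∀ θ, NearQuadratic (A.dualG ℓ θ))
    {Q₂ : PSDCone (A.Idx (ℓ + 1))} {Q₁ : PSDCone (A.Idx ℓ)} {b : ℝ}
    (hb : A.condRate ℓ Q₂ Q₁ ≤ b) (θ : Matrix (A.Idx (ℓ + 1)) (A.Idx (ℓ + 1)) ℝ) :
    ENNReal.ofReal (Real.exp ((θ.transpose * Q₂.1).trace - b)) ≤ gaussMGF (A.dualG ℓ θ) Q₁ := by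
  set θ' : Matrix (A.Idx (ℓ + 1)) (A.Idx (ℓ + 1)) ℝ := (1 / 2 : ℝ) • (θ + θ.transpose) with hθ'
  have hsymm : θ'.IsSymm := by
    rw [hθ']
    refine Matrix.IsSymm.smul ?_ _
    rw [Matrix.IsSymm, Matrix.transpose_add, Matrix.transpose_transpose]
    exact add_comm _ _
  have hpair : ∀ Q : Matrix (A.Idx (ℓ + 1)) (A.Idx (ℓ + 1)) ℝ, Q.PosSemidef →
      (θ'.transpose * Q).trace = (θ.transpose * Q).trace := by
    intro Q hQ
    have hQs : Q.transpose = Q := by simpa using hQ.isHermitian.eq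
    have h1 : (θ * Q).trace = (θ.transpose * Q).trace := by
      rw [← Matrix.trace_transpose, Matrix.transpose_mul, hQs, Matrix.trace_mul_comm]
    rw [hsymm.eq, hθ', Matrix.smul_mul, Matrix.add_mul, Matrix.trace_smul, Matrix.trace_add, h1,
      smul_eq_mul]
    ring
  have hdual : A.dualG ℓ θ' = A.dualG ℓ θ := funext fun z => hpair _ (A.G_posSemidef ℓ _)
  rw [← hpair _ Q₂.2, ← hdual]
  by_cases hfin : gaussMGF (A.dualG ℓ θ') Q₁ = ∞
  · rw [hfin]; exact le_top
  obtain ⟨Λ, hΛ⟩ := exists_eq_ofReal_exp (gaussMGF_pos _ (hG θ').continuous Q₁) hfin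
  have h1 := (le_condRate hsymm hΛ.le Q₂).trans hb
  rw [EReal.coe_le_coe_iff] at h1
  rw [hΛ]
  exact ENNReal.ofReal_le_ofReal (Real.exp_le_exp.2 (by linarith))

end CondRate

end ConvNet

/-! ### Large deviation bounds for the transition from one layer to the next -/

/-- A square matrix as a Euclidean vector. -/
def Matrix.toEuclideanVec {J : Type} (Q : Matrix J J ℝ) : EuclideanSpace ℝ (J × J) :=
  WithLp.toLp 2 fun p => Q p.1 p.2

theorem Matrix.inner_toEuclideanVec {J : Type} [Fintype J] (θ : EuclideanSpace ℝ (J × J))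
    (Q : Matrix J J ℝ) :
    inner ℝ θ Q.toEuclideanVec =
      ((Matrix.of fun p q => θ.ofLp (p, q) : Matrix J J ℝ).transpose * Q).trace := by
  rw [ConvNet.trace_transpose_mul, PiLp.inner_apply, Fintype.sum_prod_type]
  refine Finset.sum_congr rfl fun p _ => Finset.sum_congr rfl fun q _ => ?_
  simp [Matrix.toEuclideanVec, mul_comm]

theorem PSDCone.exists_norm_toEuclideanVec_lt_imp_mem {J : Type} [Fintype J] {Q₀ : PSDCone J}
    {U : Set (PSDCone J)} (hU : U ∈ 𝓝 Q₀) :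
    ∃ r : ℝ, 0 < r ∧ ∀ Q : PSDCone J, ‖Q.1.toEuclideanVec - Q₀.1.toEuclideanVec‖ < r → Q ∈ U := by
  obtain ⟨V, hV, hVU⟩ := mem_nhds_subtype _ _ _ |>.1 hU
  have hcont : Continuous fun x : EuclideanSpace ℝ (J × J) =>
      (Matrix.of fun p q => x.ofLp (p, q) : Matrix J J ℝ) :=
    continuous_matrix fun p q => by simp only [Matrix.of_apply]; fun_prop
  have h1 := hcont.continuousAt (x := Q₀.1.toEuclideanVec) |>.preimage_mem_nhds (t := V) hV
  obtain ⟨r, hr, h2⟩ := Metric.mem_nhds_iff.1 h1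
  exact ⟨r, hr, fun Q hQ => hVU (h2 (mem_ball_iff_norm.2 hQ))⟩

namespace ConvNet

variable (A : ConvNet) {ℓ : ℕ}

/-- The average of `G^{(ℓ)}` over the channels, as a point of the cone. -/
def avgG (ℓ : ℕ) {N : ℕ} (z : Fin N → EuclideanSpace ℝ (A.Idx ℓ)) : PSDCone (A.Idx (ℓ + 1)) :=
  ⟨(1 / (N : ℝ)) • ∑ c, A.G ℓ (z c).ofLp,
    (Matrix.posSemidef_sum _ fun _ _ => A.G_posSemidef _ _).smul (by positivity)⟩

/-- The law of `N` independent centred Gaussian vectors with covariance matrix `q`. -/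
def layerLaw {J : Type} [Fintype J] [DecidableEq J] (q : PSDCone J) (N : ℕ) :
    Measure (Fin N → EuclideanSpace ℝ J) :=
  Measure.pi fun _ => multivariateGaussian 0 q.1

instance {J : Type} [Fintype J] [DecidableEq J] (q : PSDCone J) (N : ℕ) :
    IsProbabilityMeasure (layerLaw q N) := by
  unfold layerLaw; infer_instance

variable {A}

theorem continuous_avgG (hG : Continuous (A.G ℓ)) (N : ℕ) :
    Continuous fun z : Fin N → EuclideanSpace ℝ (A.Idx ℓ) => A.avgG ℓ z := by
  refine Continuous.subtype_mk ?_ _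
  have h : Continuous fun z : Fin N → EuclideanSpace ℝ (A.Idx ℓ) => ∑ c, A.G ℓ (z c).ofLp :=
    continuous_finsetSum _ fun c _ => hG.comp
      ((PiLp.continuous_ofLp 2 _).comp (continuous_apply c))
  exact h.const_smul (1 / (N : ℝ))

theorem natCast_mul_trace_avgG {N : ℕ} (hN : N ≠ 0)
    (θ : Matrix (A.Idx (ℓ + 1)) (A.Idx (ℓ + 1)) ℝ) (z : Fin N → EuclideanSpace ℝ (A.Idx ℓ)) :
    (N : ℝ) * (θ.transpose * (A.avgG ℓ z).1).trace = ∑ c, A.dualG ℓ θ (z c) := by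
  have hN' : (N : ℝ) ≠ 0 := by exact_mod_cast hN
  simp only [avgG, dualG, Matrix.mul_smul, Matrix.trace_smul, Matrix.mul_sum, Matrix.trace_sum,
    smul_eq_mul]
  field_simp

theorem layerLaw_trace_ge_le {θ : Matrix (A.Idx (ℓ + 1)) (A.Idx (ℓ + 1)) ℝ}
    (hθ : Measurable (A.dualG ℓ θ)) {q : PSDCone (A.Idx ℓ)} {c : ℝ}
    (hc : gaussMGF (A.dualG ℓ θ) q ≤ ENNReal.ofReal (Real.exp c)) (a : ℝ) (N : ℕ) :
    layerLaw q N {z | a ≤ (θ.transpose * (A.avgG ℓ z).1).trace} ≤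
      ENNReal.ofReal (Real.exp (-(N * (a - c)))) := by
  -- Without channels the bound equals 1.
  rcases Nat.eq_zero_or_pos N with rfl | hN
  · simpa using prob_le_one
  have h := pi_sum_ge_le_exp (ι := Fin N) (multivariateGaussian 0 q.1) hθ (a := a) hc
  rw [Fintype.card_fin] at h
  refine le_trans (measure_mono fun z hz => ?_) h
  have hz' : a ≤ (θ.transpose * (A.avgG ℓ z).1).trace := hz
  change (N : ℝ) * a ≤ _
  rw [← natCast_mul_trace_avgG hN.ne']
  gcongr

/-- The neighbourhood of Q₂ is a half-space given by the dual matrix, so Chernoff's bound applies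
directly and holds for every N. -/
theorem exists_layerLaw_le_of_lt_condRate (hG : ∀ θ, NearQuadratic (A.dualG ℓ θ))
    {Q₂ : PSDCone (A.Idx (ℓ + 1))} {Q₁ : PSDCone (A.Idx ℓ)} {a : ℝ}
    (ha : (a : EReal) < A.condRate ℓ Q₂ Q₁) :
    ∃ U₂ ∈ 𝓝 Q₂, ∃ U₁ ∈ 𝓝 Q₁, ∀ q ∈ U₁, ∀ N : ℕ,
      layerLaw q N {z | A.avgG ℓ z ∈ U₂} ≤ ENNReal.ofReal (Real.exp (-(N * a))) := by
  obtain ⟨θ, c, -, hev, hlt⟩ := exists_dual_of_lt_condRate hG ha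
  refine ⟨{Q | a + c ≤ (θ.transpose * Q.1).trace}, ?_, _, hev, fun q hq N => ?_⟩
  · have h := (continuous_trace_transpose_mul θ).continuousAt.eventually_const_lt
      (show a + c < (θ.transpose * Q₂.1).trace by linarith)
    filter_upwards [h] with Q hQ using hQ.le
  · have := layerLaw_trace_ge_le (hG θ).continuous.measurable hq (a + c) N
    rwa [add_sub_cancel_right] at this

theorem exists_layerLaw_trace_gt_le (hG : ∀ θ, NearQuadratic (A.dualG ℓ θ)) (r a : ℝ) :
    ∃ r' : ℝ, ∀ q : PSDCone (A.Idx ℓ), q.1.trace ≤ r → ∀ N : ℕ,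
      layerLaw q N {z | r' < (A.avgG ℓ z).1.trace} ≤ ENNReal.ofReal (Real.exp (-(N * a))) := by
  obtain ⟨t, C, ht, h⟩ := exists_gaussMGF_trace_le hG r
  refine ⟨(a + C) / t, fun q hq N => ?_⟩
  have h1 := layerLaw_trace_ge_le (hG _).continuous.measurable (h q hq) (a + C) N
  rw [add_sub_cancel_right] at h1
  refine le_trans (measure_mono fun z hz => ?_) h1
  have hz' : (a + C) / t < (A.avgG ℓ z).1.trace := hz
  rw [div_lt_iff₀ ht] at hz'
  change a + C ≤ _
  simp only [Matrix.transpose_smul, Matrix.transpose_one, Matrix.smul_mul, Matrix.one_mul,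
    Matrix.trace_smul, smul_eq_mul]
  linarith

/-- Cramér's lower bound with q itself as the parameter, the samples of N(0, q) being coupled
through √q. -/
theorem exists_le_layerLaw_of_condRate_le (hGc : Continuous (A.G ℓ))
    (hG : ∀ θ, NearQuadratic (A.dualG ℓ θ))
    {Q₂ : PSDCone (A.Idx (ℓ + 1))} {Q₁ : PSDCone (A.Idx ℓ)} {b : ℝ}
    (hb : A.condRate ℓ Q₂ Q₁ ≤ b) {U : Set (PSDCone (A.Idx (ℓ + 1)))} (hU : U ∈ 𝓝 Q₂)
    {ε : ℝ} (hε : 0 < ε) :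
    ∃ N₀ : ℕ, ∃ U₁ ∈ 𝓝 Q₁, ∀ q ∈ U₁, ∀ N ≥ N₀,
      ENNReal.ofReal (Real.exp (-(N * (b + ε)))) ≤ layerLaw q N {z | A.avgG ℓ z ∈ U} := by
  obtain ⟨r, hr, hrU⟩ := PSDCone.exists_norm_toEuclideanVec_lt_imp_mem hU
  have hvec : Continuous fun z : EuclideanSpace ℝ (A.Idx ℓ) =>
      (A.G ℓ z.ofLp).toEuclideanVec := by
    unfold Matrix.toEuclideanVec
    have : ∀ p : A.Idx (ℓ + 1) × A.Idx (ℓ + 1), Continuous fun z : EuclideanSpace ℝ (A.Idx ℓ) =>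
        A.G ℓ z.ofLp p.1 p.2 := fun p =>
      (hGc.matrix_elem p.1 p.2).comp (PiLp.continuous_ofLp 2 _)
    fun_prop
  obtain ⟨N₀, hN₀⟩ := cramer_lower_bound (stdGaussian (EuclideanSpace ℝ (A.Idx ℓ)))
    (l := 𝓝 Q₁) (y := fun q ξ => (A.G ℓ (q.sqrtCLM ξ).ofLp).toEuclideanVec)
    (y₀ := fun ξ => (A.G ℓ (Q₁.sqrtCLM ξ).ofLp).toEuclideanVec)
    (fun q => (hvec.comp q.sqrtCLM.continuous).measurable)
    (hvec.comp Q₁.sqrtCLM.continuous).measurable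
    (fun ξ => (hvec.comp (continuous_sqrtCLM_apply ξ)).tendsto Q₁)
    Q₂.1.toEuclideanVec (b := b)
    (fun θ => by
      have h := ofReal_exp_le_gaussMGF hG hb (Matrix.of fun p q => θ.ofLp (p, q))
      rw [gaussMGF_eq (hG _).continuous] at h
      rw [Matrix.inner_toEuclideanVec]
      simp_rw [Matrix.inner_toEuclideanVec]
      exact h) hr hε
  refine ⟨max N₀ 1, _, hN₀, fun q hq N hN => ?_⟩
  have hNpos : 0 < N := lt_of_lt_of_le one_pos ((le_max_right _ _).trans hN)
  have h1 := hq N ((le_max_left _ _).trans hN)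
  have hmap : layerLaw q N = (Measure.pi fun _ : Fin N =>
      stdGaussian (EuclideanSpace ℝ (A.Idx ℓ))).map fun ξ i => q.sqrtCLM (ξ i) := by
    rw [Measure.pi_map_pi (f := fun _ => q.sqrtCLM)
      fun _ => q.sqrtCLM.continuous.measurable.aemeasurable]
    simp_rw [← PSDCone.multivariateGaussian_eq_map]
    rfl
  have hvecavg : ∀ ξ : Fin N → EuclideanSpace ℝ (A.Idx ℓ),
      (A.avgG ℓ fun i => q.sqrtCLM (ξ i)).1.toEuclideanVec =
        (N : ℝ)⁻¹ • ∑ i, (A.G ℓ (q.sqrtCLM (ξ i)).ofLp).toEuclideanVec := by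
    intro ξ
    ext p
    simp [Matrix.toEuclideanVec, avgG, Matrix.sum_apply]
  have hmeas : Measurable fun (ξ : Fin N → EuclideanSpace ℝ (A.Idx ℓ)) i => q.sqrtCLM (ξ i) := by
    fun_prop
  calc ENNReal.ofReal (Real.exp (-(N * (b + ε))))
      ≤ (Measure.pi fun _ : Fin N => stdGaussian (EuclideanSpace ℝ (A.Idx ℓ)))
        {ξ | ‖(N : ℝ)⁻¹ • ∑ i, (A.G ℓ (q.sqrtCLM (ξ i)).ofLp).toEuclideanVec -
          Q₂.1.toEuclideanVec‖ < r} := by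
        rw [← ofReal_measureReal]
        exact ENNReal.ofReal_le_ofReal h1
    _ ≤ (Measure.pi fun _ : Fin N => stdGaussian (EuclideanSpace ℝ (A.Idx ℓ)))
        ((fun ξ i => q.sqrtCLM (ξ i)) ⁻¹' {z | A.avgG ℓ z ∈ U}) := by
        refine measure_mono fun ξ hξ => hrU _ ?_
        rw [hvecavg]
        exact hξ
    _ ≤ layerLaw q N {z | A.avgG ℓ z ∈ U} := by
        rw [hmap]
        exact Measure.le_map_apply hmeas.aemeasurable _

end ConvNet

/-! ### Linear images of independent Gaussian weights -/

/-- Both sides have the same characteristic function, which also covers singular covariance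
matrices. Channels are independent because they use disjoint blocks of weights. -/
theorem map_pi_gaussianReal_eq_layerLaw {κ J : Type} [Fintype κ] [Fintype J] [DecidableEq J]
    (N : ℕ) (v : ℝ≥0) (s : ℝ) (a : κ → J → ℝ) (q : PSDCone J)
    (hq : ∀ i j, q.1 i j = v * s ^ 2 * ∑ k, a k i * a k j) :
    (Measure.pi fun _ : Fin N × κ => gaussianReal 0 v).map
      (fun w c => (WithLp.toLp 2 fun p => s * ∑ k, w (c, k) * a k p : EuclideanSpace ℝ J)) =
      ConvNet.layerLaw q N := by
  have hm1 : Measurable fun (w : Fin N × κ → ℝ) (c : Fin N) =>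
      (WithLp.toLp 2 fun p => s * ∑ k, w (c, k) * a k p : EuclideanSpace ℝ J) := by fun_prop
  have hm2 : Measurable (WithLp.toLp 2 : (Fin N → EuclideanSpace ℝ J) →
      PiLp 2 fun _ : Fin N => EuclideanSpace ℝ J) := by fun_prop
  -- Characteristic functions need an inner product on the space of all channels, hence the passage
  -- to `PiLp 2`, which is undone at the end.
  have key : (Measure.map (WithLp.toLp 2) ((Measure.pi fun _ : Fin N × κ => gaussianReal 0 v).map
      (fun w c => (WithLp.toLp 2 fun p => s * ∑ k, w (c, k) * a k p : EuclideanSpace ℝ J))) :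
        Measure (PiLp 2 fun _ : Fin N => EuclideanSpace ℝ J)) =
      Measure.map (WithLp.toLp 2) (ConvNet.layerLaw q N) := by
    rw [Measure.map_map hm2 hm1]
    have : IsProbabilityMeasure (Measure.map (WithLp.toLp 2) (ConvNet.layerLaw q N) :
        Measure (PiLp 2 fun _ : Fin N => EuclideanSpace ℝ J)) :=
      Measure.isProbabilityMeasure_map hm2.aemeasurable
    have : IsProbabilityMeasure ((Measure.pi fun _ : Fin N × κ => gaussianReal 0 v).map
        ((WithLp.toLp 2 : (Fin N → EuclideanSpace ℝ J) →
          PiLp 2 fun _ : Fin N => EuclideanSpace ℝ J) ∘ fun w c =>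
        (WithLp.toLp 2 fun p => s * ∑ k, w (c, k) * a k p : EuclideanSpace ℝ J))) :=
      Measure.isProbabilityMeasure_map (hm2.comp hm1).aemeasurable
    apply Measure.ext_of_charFun
    ext t
    rw [ConvNet.layerLaw, charFun_pi, charFun_apply, integral_map (hm2.comp hm1).aemeasurable
      (Measurable.aestronglyMeasurable (by fun_prop))]
    set b : Fin N × κ → ℝ := fun x => s * ∑ p, a x.2 p * (t x.1) p with hb
    have h1 : ∀ w : Fin N × κ → ℝ,
        Complex.exp ((inner ℝ (((WithLp.toLp 2 : (Fin N → EuclideanSpace ℝ J) →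
          PiLp 2 fun _ : Fin N => EuclideanSpace ℝ J) ∘ fun w c =>
        (WithLp.toLp 2 fun p => s * ∑ k, w (c, k) * a k p : EuclideanSpace ℝ J)) w) t : ℝ) *
          Complex.I) = ∏ x, Complex.exp (b x * w x * Complex.I) := by
      intro w
      rw [← Complex.exp_sum, ← Finset.sum_mul]
      congr 2
      have h2 : inner ℝ (((WithLp.toLp 2 : (Fin N → EuclideanSpace ℝ J) →
          PiLp 2 fun _ : Fin N => EuclideanSpace ℝ J) ∘ fun w c =>
          (WithLp.toLp 2 fun p => s * ∑ k, w (c, k) * a k p : EuclideanSpace ℝ J)) w) t =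
          ∑ x, b x * w x := by
        rw [PiLp.inner_apply, Fintype.sum_prod_type]
        refine Finset.sum_congr rfl fun c _ => ?_
        rw [PiLp.inner_apply]
        simp only [Function.comp, hb, RCLike.inner_apply, conj_trivial, Finset.mul_sum,
          Finset.sum_mul]
        rw [Finset.sum_comm]
        refine Finset.sum_congr rfl fun k _ => Finset.sum_congr rfl fun p _ => ?_
        ring
      rw [h2]
      push_cast
      rfl
    simp_rw [h1]
    rw [integral_fintype_prod_eq_prod (f := fun x (w : ℝ) => Complex.exp (b x * w * Complex.I))]
    simp_rw [← charFun_apply_real, charFun_gaussianReal, charFun_multivariateGaussian q.2]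
    rw [Fintype.prod_prod_type]
    refine Finset.prod_congr rfl fun c _ => ?_
    rw [← Complex.exp_sum]
    congr 1
    simp only [inner_zero_right, Complex.ofReal_zero, mul_zero, zero_mul, zero_sub]
    rw [Finset.sum_neg_distrib]
    congr 1
    rw [← Finset.sum_div]
    congr 1
    have h3 : ∑ k, (v : ℝ) * (b (c, k)) ^ 2 = (t c).ofLp ⬝ᵥ q.1.mulVec (t c).ofLp := by
      simp only [dotProduct, Matrix.mulVec, hq, hb, Finset.mul_sum, Finset.sum_mul, sq]
      rw [Finset.sum_comm]
      refine Finset.sum_congr rfl fun i _ => ?_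
      rw [Finset.sum_comm]
      refine Finset.sum_congr rfl fun j _ => Finset.sum_congr rfl fun k _ => ?_
      ring
    rw [← h3]
    push_cast
    rfl
  have h := congrArg (Measure.map (WithLp.ofLp : (PiLp 2 fun _ : Fin N => EuclideanSpace ℝ J) →
    (Fin N → EuclideanSpace ℝ J))) key
  rw [Measure.map_map (by fun_prop) hm2, Measure.map_map (by fun_prop) hm2] at h
  have hid : (WithLp.ofLp : (PiLp 2 fun _ : Fin N => EuclideanSpace ℝ J) → _) ∘
      (WithLp.toLp 2 : (Fin N → EuclideanSpace ℝ J) → _) = id := rfl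
  rwa [hid, Measure.map_id, Measure.map_id] at h

/-! ### Layer recursion in a form common to all layers, and measurability -/

namespace ConvNet

variable (A : ConvNet)

/-- The input of layer `j`, after extraction of patches and activation. -/
def inputAct (C : ℕ → ℕ) (w : A.Weights C) :
    (j : ℕ) → Fin (A.chan C j) → A.Mask j → A.Idx (j + 1) → ℝ
  | 0, c', m, p => A.R 0 p.1 (A.x p.2 c') m
  | j + 1, c', m, p => A.σ (A.R (j + 1) p.1 (fun i => A.preact C w j c' (i, p.2)) m)

theorem preact_eq (C : ℕ → ℕ) (w : A.Weights C) (j : ℕ) (c : Fin (A.chan C (j + 1)))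
    (p : A.Idx (j + 1)) :
    A.preact C w j c p = 1 / √((Fintype.card (A.Mask j) : ℝ) * (A.chan C j : ℝ)) *
      ∑ c' : Fin (A.chan C j), ∑ m : A.Mask j, w j m c' c * A.inputAct C w j c' m p := by
  cases j with
  | zero => rw [preact]; rfl
  | succ j => rw [preact]; rfl

/-- The sequence `K^{(1)}, K^{(2)}, …` of conditional covariance matrices. -/
def cov (C : ℕ → ℕ) (w : A.Weights C) : (j : ℕ) → PSDCone (A.Idx (j + 1))
  | 0 => A.K1
  | j + 1 => ⟨A.KMat C w j, A.KMat_posSemidef C w j⟩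

/-- This is the covariance of the linear image of the weights in `preact_eq`: the inverse precision
is the variance of a weight, the square that of the normalisation. -/
theorem cov_apply (C : ℕ → ℕ) (w : A.Weights C) (j : ℕ) (p q : A.Idx (j + 1)) :
    (A.cov C w j).1 p q = ((A.prec j)⁻¹ : ℝ≥0) *
      (1 / √((Fintype.card (A.Mask j) : ℝ) * (A.chan C j : ℝ))) ^ 2 *
      ∑ k : Fin (A.chan C j) × A.Mask j,
        A.inputAct C w j k.1 k.2 p * A.inputAct C w j k.1 k.2 q := by
  have hs : (1 / √((Fintype.card (A.Mask j) : ℝ) * (A.chan C j : ℝ))) ^ 2 =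
      1 / ((Fintype.card (A.Mask j) : ℝ) * (A.chan C j : ℝ)) := by
    rw [div_pow, one_pow, Real.sq_sqrt (by positivity)]
  rw [hs, Fintype.sum_prod_type]
  cases j with
  | zero =>
    simp only [cov, K1, K1Mat, Matrix.of_apply, inputAct]
    congr 1
    simp only [chan, NNReal.coe_inv, one_div, mul_inv]
    ring
  | succ j =>
    simp only [cov, KMat, G, Matrix.smul_apply, Matrix.sum_apply, Matrix.of_apply, inputAct,
      smul_eq_mul, Finset.mul_sum]
    refine Finset.sum_congr rfl fun c _ => Finset.sum_congr rfl fun m _ => ?_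
    simp only [NNReal.coe_inv, one_div, mul_inv]
    ring

/-- The pre-activations of a layer as Euclidean vectors, one for each channel. -/
def preactVec (C : ℕ → ℕ) (w : A.Weights C) (j : ℕ) :
    Fin (A.chan C (j + 1)) → EuclideanSpace ℝ (A.Idx (j + 1)) :=
  fun c => WithLp.toLp 2 (A.preact C w j c)

/-- The features of the layers `1, …, L` are continuous. -/
def ContinuousFeatures : Prop :=
  ∀ ℓ, 1 ≤ ℓ → ℓ ≤ A.L → ∀ (p : A.Idx (ℓ + 1)) (m : A.Mask ℓ),
    Continuous fun z : A.Idx ℓ → ℝ => A.σ (A.R ℓ p.1 (fun i => z (i, p.2)) m)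

variable {A} {Ω : Type*}

/-- The σ-algebra is a free variable in these lemmas, so that they also apply to the one generated
by the earlier layers. -/
theorem measurable_inputAct_succ {mΩ : MeasurableSpace Ω} (hA : A.ContinuousFeatures)
    {C : ℕ → ℕ} {w : Ω → A.Weights C} {j : ℕ} (hj : j + 1 ≤ A.L)
    (hp : ∀ c p, Measurable fun ω => A.preact C (w ω) j c p)
    (c' : Fin (A.chan C (j + 1))) (m : A.Mask (j + 1)) (p : A.Idx (j + 1 + 1)) :
    Measurable fun ω => A.inputAct C (w ω) (j + 1) c' m p :=
  (hA (j + 1) (Nat.le_add_left 1 j) hj p m).measurable.comp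
    (measurable_pi_lambda _ fun p => hp c' p)

theorem measurable_preact {mΩ : MeasurableSpace Ω} (hA : A.ContinuousFeatures)
    {C : ℕ → ℕ} {w : Ω → A.Weights C} {j : ℕ} (hj : j ≤ A.L)
    (hw : ∀ ℓ ≤ j, ∀ m c' c, Measurable fun ω => w ω ℓ m c' c) (c : Fin (A.chan C (j + 1)))
    (p : A.Idx (j + 1)) : Measurable fun ω => A.preact C (w ω) j c p := by
  induction j with
  | zero =>
    simp_rw [preact_eq]
    refine Measurable.const_mul (Finset.measurable_fun_sum _ fun c' _ =>
      Finset.measurable_fun_sum _ fun m _ => (hw 0 le_rfl m c' c).mul ?_) _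
    exact measurable_const
  | succ j ih =>
    simp_rw [preact_eq]
    refine Measurable.const_mul (Finset.measurable_fun_sum _ fun c' _ =>
      Finset.measurable_fun_sum _ fun m _ => (hw (j + 1) le_rfl m c' c).mul ?_) _
    exact measurable_inputAct_succ hA hj (fun c p => ih (Nat.le_of_succ_le hj)
      (fun ℓ hℓ => hw ℓ (Nat.le_succ_of_le hℓ)) c p) c' m p

theorem measurable_inputAct {mΩ : MeasurableSpace Ω} (hA : A.ContinuousFeatures)
    {C : ℕ → ℕ} {w : Ω → A.Weights C} {j : ℕ} (hj : j ≤ A.L)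
    (hw : ∀ ℓ < j, ∀ m c' c, Measurable fun ω => w ω ℓ m c' c) (c' : Fin (A.chan C j))
    (m : A.Mask j) (p : A.Idx (j + 1)) : Measurable fun ω => A.inputAct C (w ω) j c' m p := by
  cases j with
  | zero => exact measurable_const
  | succ j =>
    exact measurable_inputAct_succ hA hj (fun c p => measurable_preact hA (Nat.le_of_succ_le hj)
      (fun ℓ hℓ => hw ℓ (Nat.lt_succ_of_le hℓ)) c p) c' m p

theorem ContinuousFeatures.continuous_G (hA : A.ContinuousFeatures) {ℓ : ℕ} (h1 : 1 ≤ ℓ)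
    (hℓ : ℓ ≤ A.L) : Continuous (A.G ℓ) := by
  refine continuous_matrix fun p q => ?_
  simp only [G, Matrix.of_apply]
  exact continuous_const.mul (continuous_finsetSum _ fun m _ =>
    (hA ℓ h1 hℓ p m).mul (hA ℓ h1 hℓ q m))

theorem measurable_preactVec {mΩ : MeasurableSpace Ω} (hA : A.ContinuousFeatures)
    {C : ℕ → ℕ} {w : Ω → A.Weights C} {j : ℕ} (hj : j ≤ A.L)
    (hw : ∀ ℓ ≤ j, ∀ m c' c, Measurable fun ω => w ω ℓ m c' c) :
    Measurable fun ω => A.preactVec C (w ω) j := by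
  refine measurable_pi_lambda _ fun c => ?_
  exact (WithLp.measurable_toLp 2 _).comp
    (measurable_pi_lambda _ fun p => measurable_preact hA hj hw c p)

/-- Only the weights of layers strictly below j enter; this makes `cov` at j part of the past when
layer j is sampled. -/
theorem measurable_cov {mΩ : MeasurableSpace Ω} (hA : A.ContinuousFeatures)
    {C : ℕ → ℕ} {w : Ω → A.Weights C} {j : ℕ} (hj : j ≤ A.L)
    (hw : ∀ ℓ < j, ∀ m c' c, Measurable fun ω => w ω ℓ m c' c) :
    Measurable fun ω => A.cov C (w ω) j := by
  cases j with
  | zero => exact measurable_const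
  | succ j =>
    exact (continuous_avgG (hA.continuous_G (Nat.le_add_left 1 j) hj) _).measurable.comp
      (measurable_preactVec hA (Nat.le_of_succ_le hj)
        fun ℓ hℓ => hw ℓ (Nat.lt_succ_of_le hℓ))

end ConvNet

/-! ### Conditionally on the previous layers, the channels of a layer are Gaussian -/

namespace ConvNet

variable {A : ConvNet} {C : ℕ → ℕ} {Ω : Type*}

/-- The `σ`-algebra generated by the weights of the layers in `S`. -/
@[reducible]
def weightSigma (w : Ω → A.Weights C) (S : Set ℕ) : MeasurableSpace Ω :=
  ⨆ p ∈ {p : A.WeightIdx C | (p.1 : ℕ) ∈ S},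
    MeasurableSpace.comap (fun ω => w ω p.1 p.2.1 p.2.2.1 p.2.2.2) inferInstance

theorem measurable_weightSigma (w : Ω → A.Weights C) {S : Set ℕ} {ℓ : ℕ} (hℓ : ℓ ≤ A.L)
    (hS : ℓ ∈ S) (m : A.Mask ℓ) (c' : Fin (A.chan C ℓ)) (c : Fin (A.chan C (ℓ + 1))) :
    Measurable[weightSigma w S] fun ω => w ω ℓ m c' c := by
  have h : MeasurableSpace.comap (fun ω => w ω ℓ m c' c) inferInstance ≤ weightSigma w S :=
    le_iSup₂_of_le (⟨⟨ℓ, Nat.lt_succ_of_le hℓ⟩, m, c', c⟩ : A.WeightIdx C) hS le_rfl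
  exact Measurable.mono (comap_measurable _) h le_rfl

/-- The weights of layer `j`, the channel of layer `j + 1` being the first index. -/
def layerWeights (w : Ω → A.Weights C) (j : ℕ) (ω : Ω) :
    Fin (A.chan C (j + 1)) × (Fin (A.chan C j) × A.Mask j) → ℝ :=
  fun x => w ω j x.2.2 x.2.1 x.1

theorem measurable_layerWeights {mΩ : MeasurableSpace Ω} {w : Ω → A.Weights C} {j : ℕ}
    (hw : ∀ m c' c, Measurable fun ω => w ω j m c' c) : Measurable (layerWeights w j) :=
  measurable_pi_lambda _ fun x => hw x.2.2 x.2.1 x.1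

theorem measurable_indicator_prodMk_inputAct {mΩ : MeasurableSpace Ω}
    (hA : A.ContinuousFeatures) {w : Ω → A.Weights C} {j : ℕ} (hj : j ≤ A.L)
    (hw : ∀ ℓ < j, ∀ m c' c, Measurable fun ω => w ω ℓ m c' c) {E : Set Ω}
    (hE : MeasurableSet E) :
    Measurable fun ω => (E.indicator (fun _ => (1 : ℝ)) ω,
      fun (c' : Fin (A.chan C j)) (m : A.Mask j) (p : A.Idx (j + 1)) =>
        A.inputAct C (w ω) j c' m p) :=
  (measurable_const.indicator hE).prodMk <| measurable_pi_lambda _ fun c' =>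
    measurable_pi_lambda _ fun m => measurable_pi_lambda _ fun p =>
      measurable_inputAct hA hj hw c' m p

theorem measurableSet_cov_mem_weightSigma (w : Ω → A.Weights C)
    (hA : A.ContinuousFeatures) {j k : ℕ} (hj : j ≤ A.L)
    (hjk : j ≤ k) {U : Set (PSDCone (A.Idx (j + 1)))} (hU : MeasurableSet U) :
    MeasurableSet[weightSigma w (Set.Iio k)] {ω | A.cov C (w ω) j ∈ U} := by
  have h : Measurable[weightSigma w (Set.Iio k)] fun ω => A.cov C (w ω) j :=
    @measurable_cov A Ω (weightSigma w (Set.Iio k)) hA C w j hj fun ℓ hℓ m c' c =>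
      measurable_weightSigma w ((Nat.le_of_lt hℓ).trans hj)
        (Set.mem_Iio.2 (lt_of_lt_of_le hℓ hjk)) m c' c
  exact h hU

variable [mΩ : MeasurableSpace Ω]

/-- The weights of the layers `0, …, L` are measurable, Gaussian and independent. -/
structure IsGaussianWeights (P : Measure Ω) (w : Ω → A.Weights C) : Prop where
  measurable : ∀ ℓ ≤ A.L, ∀ m c' c, Measurable fun ω => w ω ℓ m c' c
  map_eq : ∀ ℓ ≤ A.L, ∀ m c' c, P.map (fun ω => w ω ℓ m c' c) = gaussianReal 0 (A.prec ℓ)⁻¹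
  indep : iIndepFun (fun (p : A.WeightIdx C) ω => w ω p.1 p.2.1 p.2.2.1 p.2.2.2) P

variable {P : Measure Ω} {w : Ω → A.Weights C}

theorem IsGaussianWeights.weightSigma_le (hw : IsGaussianWeights P w) (S : Set ℕ) :
    weightSigma w S ≤ mΩ :=
  iSup₂_le fun p _ => (hw.measurable p.1 (Nat.le_of_lt_succ p.1.2) _ _ _).comap_le

theorem IsGaussianWeights.indep_weightSigma (hw : IsGaussianWeights P w) {S T : Set ℕ}
    (h : Disjoint S T) : Indep (weightSigma w S) (weightSigma w T) P := by
  refine indep_iSup_of_disjoint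
    (m := fun p : A.WeightIdx C => MeasurableSpace.comap
      (fun ω => w ω p.1 p.2.1 p.2.2.1 p.2.2.2) inferInstance)
    (fun p => (hw.measurable p.1 (Nat.le_of_lt_succ p.1.2) _ _ _).comap_le) hw.indep.iIndep ?_
  rw [Set.disjoint_left] at h ⊢
  exact fun p hp hp' => h hp hp'

theorem IsGaussianWeights.map_layerWeights (hw : IsGaussianWeights P w) {j : ℕ} (hj : j ≤ A.L) :
    P.map (layerWeights w j) = Measure.pi fun _ => gaussianReal 0 (A.prec j)⁻¹ := by
  have hinj : Function.Injective
      fun x : Fin (A.chan C (j + 1)) × (Fin (A.chan C j) × A.Mask j) =>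
        (⟨⟨j, Nat.lt_succ_of_le hj⟩, x.2.2, x.2.1, x.1⟩ : A.WeightIdx C) := by
    rintro ⟨c, c', m⟩ ⟨d, d', m'⟩ h
    simp only [Sigma.mk.injEq, heq_eq_eq, Prod.mk.injEq, true_and] at h
    obtain ⟨rfl, rfl, rfl⟩ := h
    rfl
  have h := (hw.indep.precomp hinj).map_fun_eq_pi_map
    (fun x : Fin (A.chan C (j + 1)) × (Fin (A.chan C j) × A.Mask j) =>
      (hw.measurable j hj x.2.2 x.2.1 x.1).aemeasurable)
  refine Eq.trans h ?_
  congr 1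
  ext1 x
  exact hw.map_eq j hj _ _ _

variable [IsProbabilityMeasure P]

/-- The weights of layer j are independent of all earlier ones, so Fubini freezes the inputs of the
layer; its channels are then a linear image of Gaussian weights. -/
theorem IsGaussianWeights.measure_inter_preactVec_mem (hw : IsGaussianWeights P w)
    (hA : A.ContinuousFeatures) {j : ℕ} (hj : j ≤ A.L) {E : Set Ω}
    (hE : MeasurableSet[weightSigma w (Set.Iio j)] E)
    {S : Set (Fin (A.chan C (j + 1)) → EuclideanSpace ℝ (A.Idx (j + 1)))} (hS : MeasurableSet S) :
    P (E ∩ {ω | A.preactVec C (w ω) j ∈ S}) =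
      ∫⁻ ω in E, layerLaw (A.cov C (w ω) j) (A.chan C (j + 1)) S ∂P := by
  have hEΩ : MeasurableSet E := hw.weightSigma_le _ _ hE
  set s : ℝ := 1 / √((Fintype.card (A.Mask j) : ℝ) * (A.chan C j : ℝ)) with hs
  -- The indicator of E is carried along with the inputs, so that the event E becomes a condition on
  -- X.
  set X : Ω → ℝ × (Fin (A.chan C j) → A.Mask j → A.Idx (j + 1) → ℝ) :=
    fun ω => (E.indicator (fun _ => (1 : ℝ)) ω, fun c' m p => A.inputAct C (w ω) j c' m p) with hX
  set Y := layerWeights w j with hY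
  have hXm' : Measurable[weightSigma w (Set.Iio j)] X :=
    @measurable_indicator_prodMk_inputAct A C Ω (weightSigma w (Set.Iio j)) hA w j hj
      (fun ℓ hℓ m c' c => measurable_weightSigma w ((Nat.le_of_lt hℓ).trans hj) hℓ m c' c) E hE
  have hXm : Measurable X := hXm'.mono (hw.weightSigma_le _) le_rfl
  have hYm' : Measurable[weightSigma w {j}] Y :=
    @measurable_layerWeights A C Ω (weightSigma w {j}) w j
      fun m c' c => measurable_weightSigma w hj (Set.mem_singleton j) m c' c
  have hYm : Measurable Y := hYm'.mono (hw.weightSigma_le _) le_rfl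
  have hXY : IndepFun X Y P := by
    rw [IndepFun_iff_Indep]
    refine indep_of_indep_of_le (hw.indep_weightSigma (S := Set.Iio j) (T := {j}) ?_)
      hXm'.comap_le hYm'.comap_le
    simp
  set Φ : (Fin (A.chan C j) → A.Mask j → A.Idx (j + 1) → ℝ) →
      (Fin (A.chan C (j + 1)) × (Fin (A.chan C j) × A.Mask j) → ℝ) →
      (Fin (A.chan C (j + 1)) → EuclideanSpace ℝ (A.Idx (j + 1))) :=
    fun a y c => WithLp.toLp 2 fun p => s * ∑ k : Fin (A.chan C j) × A.Mask j,
      y (c, k) * a k.1 k.2 p with hΦ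
  have hΦm : Measurable fun z : (Fin (A.chan C j) → A.Mask j → A.Idx (j + 1) → ℝ) ×
      (Fin (A.chan C (j + 1)) × (Fin (A.chan C j) × A.Mask j) → ℝ) => Φ z.1 z.2 := by
    refine measurable_pi_lambda _ fun c => (WithLp.measurable_toLp 2 _).comp
      (measurable_pi_lambda _ fun p => ?_)
    fun_prop
  have hH : ∀ ω, A.preactVec C (w ω) j = Φ (X ω).2 (Y ω) := by
    intro ω
    funext c
    simp only [preactVec, hΦ, hX, hY, layerWeights]
    congr 1
    funext p
    rw [preact_eq, Fintype.sum_prod_type]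
  have hlaw : ∀ ω, P.map Y {y | Φ (X ω).2 y ∈ S} =
      layerLaw (A.cov C (w ω) j) (A.chan C (j + 1)) S := by
    intro ω
    rw [← map_pi_gaussianReal_eq_layerLaw (κ := Fin (A.chan C j) × A.Mask j)
      (A.chan C (j + 1)) (A.prec j)⁻¹ s (fun k p => (X ω).2 k.1 k.2 p) (A.cov C (w ω) j)
      (fun p q => A.cov_apply C (w ω) j p q), hY, hw.map_layerWeights hj,
      Measure.map_apply (by fun_prop) hS]
    rfl
  set T : Set ((ℝ × (Fin (A.chan C j) → A.Mask j → A.Idx (j + 1) → ℝ)) ×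
      (Fin (A.chan C (j + 1)) × (Fin (A.chan C j) × A.Mask j) → ℝ)) :=
    {z | z.1.1 = 1 ∧ Φ z.1.2 z.2 ∈ S} with hT
  have hTm : MeasurableSet T := by
    refine MeasurableSet.inter ?_ ?_
    · exact (measurable_fst.comp measurable_fst) (measurableSet_singleton 1)
    · exact (hΦm.comp ((measurable_snd.comp measurable_fst).prodMk measurable_snd)) hS
  have hset : E ∩ {ω | A.preactVec C (w ω) j ∈ S} = (fun ω => (X ω, Y ω)) ⁻¹' T := by
    ext ω
    by_cases hω : ω ∈ E <;> simp [hT, hH, hω, hX]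
  have hprod := (indepFun_iff_map_prod_eq_prod_map_map hXm.aemeasurable hYm.aemeasurable).1 hXY
  have : IsProbabilityMeasure (P.map Y) := Measure.isProbabilityMeasure_map hYm.aemeasurable
  rw [hset, ← Measure.map_apply (hXm.prodMk hYm) hTm, hprod, Measure.prod_apply hTm,
    lintegral_map (measurable_measure_prodMk_left hTm) hXm, ← lintegral_indicator hEΩ]
  refine lintegral_congr fun ω => ?_
  by_cases hω : ω ∈ E
  · rw [Set.indicator_of_mem hω, ← hlaw ω]
    congr 1
    ext y
    simp [hT, hX, hω]
  · rw [Set.indicator_of_notMem hω]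
    have : Prod.mk (X ω) ⁻¹' T = ∅ := by
      ext y
      simp [hT, hX, hω]
    rw [this, measure_empty]

/-- The Markov property of the chain: the next covariance is by definition `avgG` of the
pre-activations. -/
theorem IsGaussianWeights.measure_inter_cov_mem (hw : IsGaussianWeights P w)
    (hA : A.ContinuousFeatures) {j : ℕ} (hj : j + 1 ≤ A.L) {E : Set Ω}
    (hE : MeasurableSet[weightSigma w (Set.Iio j)] E)
    {U : Set (PSDCone (A.Idx (j + 2)))} (hU : MeasurableSet U) :
    P (E ∩ {ω | A.cov C (w ω) (j + 1) ∈ U}) =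
      ∫⁻ ω in E, layerLaw (A.cov C (w ω) j) (A.chan C (j + 1))
        {z | A.avgG (j + 1) z ∈ U} ∂P :=
  hw.measure_inter_preactVec_mem hA (Nat.le_of_succ_le hj) hE
    ((continuous_avgG (hA.continuous_G (Nat.le_add_left 1 j) hj) _).measurable hU)

theorem IsGaussianWeights.measure_inter_cov_mem_le (hw : IsGaussianWeights P w)
    (hA : A.ContinuousFeatures) {j : ℕ} (hj : j + 1 ≤ A.L) {E : Set Ω}
    (hE : MeasurableSet[weightSigma w (Set.Iio j)] E)
    {U : Set (PSDCone (A.Idx (j + 2)))} (hU : MeasurableSet U) {b : ℝ≥0∞}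
    (hb : ∀ ω ∈ E, layerLaw (A.cov C (w ω) j) (A.chan C (j + 1))
      {z | A.avgG (j + 1) z ∈ U} ≤ b) :
    P (E ∩ {ω | A.cov C (w ω) (j + 1) ∈ U}) ≤ b * P E := by
  rw [hw.measure_inter_cov_mem hA hj hE hU]
  refine (setLIntegral_mono' (hw.weightSigma_le _ _ hE) hb).trans ?_
  rw [setLIntegral_const]

theorem IsGaussianWeights.le_measure_inter_cov_mem (hw : IsGaussianWeights P w)
    (hA : A.ContinuousFeatures) {j : ℕ} (hj : j + 1 ≤ A.L) {E : Set Ω}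
    (hE : MeasurableSet[weightSigma w (Set.Iio j)] E)
    {U : Set (PSDCone (A.Idx (j + 2)))} (hU : MeasurableSet U) {b : ℝ≥0∞}
    (hb : ∀ ω ∈ E, b ≤ layerLaw (A.cov C (w ω) j) (A.chan C (j + 1))
      {z | A.avgG (j + 1) z ∈ U}) :
    b * P E ≤ P (E ∩ {ω | A.cov C (w ω) (j + 1) ∈ U}) := by
  rw [hw.measure_inter_cov_mem hA hj hE hU]
  refine le_trans ?_ (setLIntegral_mono' (hw.weightSigma_le _ _ hE) hb)
  rw [setLIntegral_const]

end ConvNet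

/-! ### Exponential scales -/

theorem coe_sum_ereal {κ : Type*} (s : Finset κ) (f : κ → ℝ) :
    ((∑ k ∈ s, f k : ℝ) : EReal) = ∑ k ∈ s, (f k : EReal) := by
  classical
  induction s using Finset.induction_on with
  | empty => simp
  | insert a s ha ih => rw [Finset.sum_insert ha, Finset.sum_insert ha, EReal.coe_add, ih]

/-- Distributes a lower bound on the joint rate over the layers, in real numbers, so that each layer
gets its own dual matrix. -/
theorem exists_real_lt_of_lt_sum_mul {κ : Type*} [Fintype κ] {α : κ → ℝ}
    (hα : ∀ k, 0 < α k) {x : κ → EReal} (hx : ∀ k, 0 ≤ x k) {a : ℝ}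
    (ha : (a : EReal) < ∑ k, (α k : EReal) * x k) :
    ∃ y : κ → ℝ, (∀ k, (y k : EReal) < x k) ∧ a < ∑ k, α k * y k := by
  classical
  by_cases htop : ∃ k, x k = ⊤
  · obtain ⟨k, hk⟩ := htop
    -- An infinite term can compensate for anything; the other terms get -1, strictly below every
    -- nonnegative value.
    refine ⟨fun i => if i = k then (a + 1 + ∑ i, α i) / α k else -1, fun i => ?_, ?_⟩
    · by_cases hi : i = k
      · subst hi
        rw [hk]
        exact EReal.coe_lt_top _
      · simp only [hi, if_false]
        exact lt_of_lt_of_le (by exact_mod_cast neg_one_lt_zero) (hx i)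
    · rw [← Finset.add_sum_erase _ _ (Finset.mem_univ k)]
      have h1 : ∑ i ∈ Finset.univ.erase k, α i * (if i = k then (a + 1 + ∑ i, α i) / α k else -1) =
          -∑ i ∈ Finset.univ.erase k, α i := by
        rw [← Finset.sum_neg_distrib]
        refine Finset.sum_congr rfl fun i hi => ?_
        rw [if_neg (Finset.ne_of_mem_erase hi), mul_neg_one]
      rw [h1]
      beta_reduce
      rw [if_pos rfl, mul_div_cancel₀ _ (hα k).ne', ← Finset.add_sum_erase _ α (Finset.mem_univ k)]
      linarith [hα k]
  · push Not at htop
    have hcoe : ∀ k, ((x k).toReal : EReal) = x k := fun k =>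
      EReal.coe_toReal (htop k) (ne_bot_of_le_ne_bot EReal.zero_ne_bot (hx k))
    have hsum : ∑ k, (α k : EReal) * x k = ((∑ k, α k * (x k).toReal : ℝ) : EReal) := by
      rw [coe_sum_ereal]
      refine Finset.sum_congr rfl fun k _ => ?_
      rw [EReal.coe_mul, hcoe]
    rw [hsum, EReal.coe_lt_coe_iff] at ha
    have hS : 0 ≤ ∑ k, α k := Finset.sum_nonneg fun k _ => (hα k).le
    set δ : ℝ := (∑ k, α k * (x k).toReal - a) / (∑ k, α k + 1) with hδ
    have hδ0 : 0 < δ := div_pos (sub_pos.2 ha) (by linarith)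
    refine ⟨fun k => (x k).toReal - δ, fun k => ?_, ?_⟩
    · rw [← hcoe k]
      exact EReal.coe_lt_coe_iff.2 (sub_lt_self _ hδ0)
    · simp_rw [mul_sub]
      rw [Finset.sum_sub_distrib, ← Finset.sum_mul]
      have : δ * (∑ k, α k + 1) = ∑ k, α k * (x k).toReal - a := by
        rw [hδ]; field_simp
      linarith

/-- `f n` is eventually at most `exp (-n b)` for some `b > a`. -/
def ExpSmall (a : ℝ) (f : ℕ → ℝ≥0∞) : Prop :=
  ∃ b > a, ∀ᶠ n : ℕ in atTop, f n ≤ ENNReal.ofReal (Real.exp (-(n * b)))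

theorem ExpSmall.mono {a : ℝ} {f g : ℕ → ℝ≥0∞} (hg : ExpSmall a g) (h : ∀ n, f n ≤ g n) :
    ExpSmall a f := by
  obtain ⟨b, hb, hg⟩ := hg
  exact ⟨b, hb, hg.mono fun n hn => (h n).trans hn⟩

theorem ExpSmall.zero (a : ℝ) : ExpSmall a fun _ => 0 :=
  ⟨a + 1, lt_add_one a, Eventually.of_forall fun _ => bot_le⟩

theorem ExpSmall.add {a : ℝ} {f g : ℕ → ℝ≥0∞} (hf : ExpSmall a f) (hg : ExpSmall a g) :
    ExpSmall a fun n => f n + g n := by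
  obtain ⟨b₁, hb₁, hf⟩ := hf
  obtain ⟨b₂, hb₂, hg⟩ := hg
  -- The gap between b and the minimum absorbs the factor 2.
  obtain ⟨b, hb, hb'⟩ := exists_between (lt_min hb₁ hb₂)
  refine ⟨b, hb, ?_⟩
  have hd : 0 < min b₁ b₂ - b := sub_pos.2 hb'
  have hlim : Tendsto (fun n : ℕ => (n : ℝ) * (min b₁ b₂ - b)) atTop atTop :=
    tendsto_natCast_atTop_atTop.atTop_mul_const hd
  filter_upwards [hf, hg, hlim.eventually_ge_atTop (Real.log 2)] with n h1 h2 h3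
  have hbd : ∀ b', min b₁ b₂ ≤ b' →
      ENNReal.ofReal (Real.exp (-(n * b'))) ≤ ENNReal.ofReal (Real.exp (-(n * min b₁ b₂))) :=
    fun b' hb' => ENNReal.ofReal_le_ofReal (Real.exp_le_exp.2 (by
      have : (n : ℝ) * min b₁ b₂ ≤ n * b' := by gcongr
      linarith))
  refine (add_le_add (h1.trans (hbd _ (min_le_left _ _)))
    (h2.trans (hbd _ (min_le_right _ _)))).trans ?_
  rw [← ENNReal.ofReal_add (Real.exp_pos _).le (Real.exp_pos _).le]
  refine ENNReal.ofReal_le_ofReal ?_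
  rw [← two_mul]
  calc 2 * Real.exp (-(n * min b₁ b₂))
      ≤ Real.exp (n * (min b₁ b₂ - b)) * Real.exp (-(n * min b₁ b₂)) := by
        gcongr
        exact (Real.log_le_iff_le_exp two_pos).1 h3
    _ = Real.exp (-(n * b)) := by rw [← Real.exp_add]; congr 1; ring

theorem ExpSmall.sum {κ : Type*} (s : Finset κ) {a : ℝ} {f : κ → ℕ → ℝ≥0∞}
    (hf : ∀ k ∈ s, ExpSmall a (f k)) : ExpSmall a fun n => ∑ k ∈ s, f k n := by
  classical
  induction s using Finset.induction_on with
  | empty => simpa using ExpSmall.zero a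
  | insert i s hi ih =>
    simp_rw [Finset.sum_insert hi]
    exact (hf i (Finset.mem_insert_self i s)).add
      (ih fun k hk => hf k (Finset.mem_insert_of_mem hk))

theorem expSmall_of_tendsto {a c : ℝ} {u : ℕ → ℝ} (hac : a < c)
    (hu : Tendsto (fun n : ℕ => u n / n) atTop (𝓝 c)) :
    ExpSmall a fun n => ENNReal.ofReal (Real.exp (-u n)) := by
  obtain ⟨b, hb, hbc⟩ := exists_between hac
  refine ⟨b, hb, ?_⟩
  filter_upwards [hu.eventually_const_lt hbc, eventually_gt_atTop 0] with n hn hn0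
  have hn0' : (0 : ℝ) < n := by exact_mod_cast hn0
  rw [lt_div_iff₀ hn0'] at hn
  exact ENNReal.ofReal_le_ofReal (Real.exp_le_exp.2 (by linarith))

theorem log_ofReal_exp_div (x : ℝ) (n : ℕ) :
    ENNReal.log (ENNReal.ofReal (Real.exp x)) / (n : EReal) = ((x / n : ℝ) : EReal) := by
  rw [ConvNet.log_ofReal_exp, ← EReal.coe_coe_eq_natCast, ← EReal.coe_div]

theorem ExpSmall.limsup_log_div_le {a : ℝ} {f : ℕ → ℝ≥0∞} (hf : ExpSmall a f) :
    limsup (fun n : ℕ => ENNReal.log (f n) / (n : EReal)) atTop ≤ ((-a : ℝ) : EReal) := by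
  obtain ⟨b, hb, hf⟩ := hf
  refine limsup_le_of_le (by isBoundedDefault) ?_
  filter_upwards [hf, eventually_gt_atTop 0] with n hn hn0
  have hn0' : (n : ℝ) ≠ 0 := by exact_mod_cast hn0.ne'
  refine (EReal.div_le_div_right_of_nonneg (by exact_mod_cast n.cast_nonneg)
    (ENNReal.log_monotone hn)).trans ?_
  rw [log_ofReal_exp_div, EReal.coe_le_coe_iff, ← mul_neg, mul_div_cancel_left₀ _ hn0']
  linarith

theorem le_liminf_log_div {c d : ℝ} {f : ℕ → ℝ≥0∞} {u : ℕ → ℝ} (hcd : c < -d)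
    (hu : Tendsto (fun n : ℕ => u n / n) atTop (𝓝 d))
    (hf : ∀ᶠ n in atTop, ENNReal.ofReal (Real.exp (-u n)) ≤ f n) :
    (c : EReal) ≤ liminf (fun n : ℕ => ENNReal.log (f n) / (n : EReal)) atTop := by
  refine le_liminf_of_le (by isBoundedDefault) ?_
  filter_upwards [hf, hu.eventually_lt_const (show d < -c by linarith)] with n hn hun
  refine le_trans ?_ (EReal.div_le_div_right_of_nonneg (by exact_mod_cast n.cast_nonneg)
    (ENNReal.log_monotone hn))
  rw [log_ofReal_exp_div, EReal.coe_le_coe_iff, neg_div]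
  linarith

/-! ### Large deviation bounds for the sequence of covariance matrices -/

namespace ConvNet

variable {A : ConvNet} {Ω : Type*}

/-- The quadratic forms associated with `G^{(ℓ)}` are regular for `1 ≤ ℓ ≤ L`. -/
def NearQuadraticLayers (A : ConvNet) : Prop :=
  ∀ ℓ, 1 ≤ ℓ → ℓ ≤ A.L → ∀ θ, NearQuadratic (A.dualG ℓ θ)

theorem measurableSet_forall_cov_mem (hA : A.ContinuousFeatures) {C : ℕ → ℕ}
    (w : Ω → A.Weights C) {V : ∀ j, Set (PSDCone (A.Idx (j + 1)))} {k : ℕ} (hk : k ≤ A.L)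
    (hV : ∀ j ≤ k, MeasurableSet (V j)) :
    MeasurableSet[weightSigma w (Set.Iio k)] {ω | ∀ j ≤ k, A.cov C (w ω) j ∈ V j} := by
  have h : {ω | ∀ j ≤ k, A.cov C (w ω) j ∈ V j} =
      ⋂ j, ⋂ (_ : j ≤ k), {ω | A.cov C (w ω) j ∈ V j} := by
    ext ω; simp
  rw [h]
  refine @MeasurableSet.iInter Ω ℕ (weightSigma w (Set.Iio k)) _ _ fun j =>
    @MeasurableSet.iInter Ω (j ≤ k) (weightSigma w (Set.Iio k)) _ _ fun hj => ?_
  exact measurableSet_cov_mem_weightSigma w hA (hj.trans hk) hj (hV j hj)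

theorem setOf_forall_cov_mem_succ {C : ℕ → ℕ} (w : Ω → A.Weights C)
    (V : ∀ j, Set (PSDCone (A.Idx (j + 1)))) (k : ℕ) :
    {ω | ∀ j ≤ k + 1, A.cov C (w ω) j ∈ V j} =
      {ω | ∀ j ≤ k, A.cov C (w ω) j ∈ V j} ∩ {ω | A.cov C (w ω) (k + 1) ∈ V (k + 1)} := by
  ext ω
  constructor
  · exact fun h => ⟨fun j hj => h j (Nat.le_succ_of_le hj), h (k + 1) le_rfl⟩
  · rintro ⟨h1, h2⟩ j hj
    rcases Nat.le_succ_iff.1 hj with h | rfl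
    · exact h1 j h
    · exact h2

variable [MeasurableSpace Ω] {P : Measure Ω} [IsProbabilityMeasure P]

/-- Each entry lies in two neighbourhoods, as target of one transition and as source of the next; on
their intersections the one-step bounds multiply. -/
theorem exists_isOpen_measure_cov_mem_le (hA : A.ContinuousFeatures)
    (hG : A.NearQuadraticLayers) (q : ∀ j, PSDCone (A.Idx (j + 1))) {a : ℕ → ℝ}
    (ha : ∀ j < A.L, (a j : EReal) < A.condRate (j + 1) (q (j + 1)) (q j)) :
    ∃ V : ∀ j, Set (PSDCone (A.Idx (j + 1))), (∀ j, IsOpen (V j) ∧ q j ∈ V j) ∧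
      ∀ (C : ℕ → ℕ) (w : Ω → A.Weights C), IsGaussianWeights P w → ∀ k ≤ A.L,
        P {ω | ∀ j ≤ k, A.cov C (w ω) j ∈ V j} ≤
          ENNReal.ofReal (Real.exp (-∑ j ∈ Finset.range k, (C (j + 1) : ℝ) * a j)) := by
  have hloc : ∀ j, ∃ U₂ ∈ 𝓝 (q (j + 1)), ∃ U₁ ∈ 𝓝 (q j), j < A.L → ∀ x ∈ U₁, ∀ N : ℕ,
      layerLaw x N {z | A.avgG (j + 1) z ∈ U₂} ≤ ENNReal.ofReal (Real.exp (-(N * a j))) := by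
    intro j
    by_cases hj : j < A.L
    · obtain ⟨U₂, h2, U₁, h1, h⟩ :=
        exists_layerLaw_le_of_lt_condRate (hG (j + 1) (Nat.le_add_left 1 j) hj) (ha j hj)
      exact ⟨U₂, h2, U₁, h1, fun _ => h⟩
    · exact ⟨_, univ_mem, _, univ_mem, fun h => absurd h hj⟩
  choose U₂ hU₂ U₁ hU₁ hU using hloc
  let V' : ∀ j, Set (PSDCone (A.Idx (j + 1))) := fun j =>
    match j with
    | 0 => Set.univ
    | j + 1 => U₂ j
  have hV' : ∀ j, V' j ∈ 𝓝 (q j) := by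
    intro j
    cases j with
    | zero => exact univ_mem
    | succ j => exact hU₂ j
  refine ⟨fun j => interior (U₁ j ∩ V' j), fun j => ⟨isOpen_interior,
    mem_interior_iff_mem_nhds.2 (inter_mem (hU₁ j) (hV' j))⟩, fun C w hw k hk => ?_⟩
  induction k with
  | zero => simpa using prob_le_one
  | succ k ih =>
    rw [setOf_forall_cov_mem_succ, Finset.sum_range_succ, neg_add, Real.exp_add,
      ENNReal.ofReal_mul (Real.exp_pos _).le, mul_comm]
    refine (hw.measure_inter_cov_mem_le hA hk (measurableSet_forall_cov_mem hA w
      (Nat.le_of_succ_le hk) fun j _ => isOpen_interior.measurableSet)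
      isOpen_interior.measurableSet
      (b := ENNReal.ofReal (Real.exp (-(C (k + 1) * a k)))) fun ω hω => ?_).trans ?_
    · refine le_trans (measure_mono fun z hz => ?_)
        (hU k hk (A.cov C (w ω) k) (interior_subset (hω k le_rfl)).1 (C (k + 1)))
      exact (interior_subset hz).2
    · gcongr
      exact ih (Nat.le_of_succ_le hk)

/-- Works backwards: the set for entry k is shrunk until the transition into the next set has the
required probability from each of its points. The induction must therefore allow arbitrary V. -/
theorem exists_le_measure_cov_mem (hA : A.ContinuousFeatures) (hG : A.NearQuadraticLayers)
    {q : ∀ j, PSDCone (A.Idx (j + 1))} (hq0 : q 0 = A.K1) {b : ℕ → ℝ}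
    (hb : ∀ j < A.L, A.condRate (j + 1) (q (j + 1)) (q j) ≤ b j) {ε : ℝ} (hε : 0 < ε)
    {k : ℕ} (hk : k ≤ A.L) {V : ∀ j, Set (PSDCone (A.Idx (j + 1)))}
    (hV : ∀ j, IsOpen (V j) ∧ q j ∈ V j) :
    ∃ N₀ : ℕ, ∀ (C : ℕ → ℕ) (w : Ω → A.Weights C), IsGaussianWeights P w →
      (∀ j < k, N₀ ≤ C (j + 1)) →
        ENNReal.ofReal (Real.exp (-∑ j ∈ Finset.range k, (C (j + 1) : ℝ) * (b j + ε))) ≤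
          P {ω | ∀ j ≤ k, A.cov C (w ω) j ∈ V j} := by
  induction k generalizing V with
  | zero =>
    refine ⟨0, fun C w hw _ => ?_⟩
    have : {ω | ∀ j ≤ 0, A.cov C (w ω) j ∈ V j} = Set.univ := by
      refine Set.eq_univ_of_forall fun ω j hj => ?_
      obtain rfl : j = 0 := Nat.le_zero.1 hj
      have h := (hV 0).2
      rw [hq0] at h
      exact h
    rw [this]
    simp
  | succ k ih =>
    obtain ⟨N₁, U₁, hU₁, hU⟩ := exists_le_layerLaw_of_condRate_le
      (hA.continuous_G (Nat.le_add_left 1 k) hk) (hG (k + 1) (Nat.le_add_left 1 k) hk)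
      (hb k hk) ((hV (k + 1)).1.mem_nhds (hV (k + 1)).2) hε
    set V' : ∀ j, Set (PSDCone (A.Idx (j + 1))) :=
      Function.update V k (V k ∩ interior U₁) with hV'def
    have hV' : ∀ j, IsOpen (V' j) ∧ q j ∈ V' j := by
      intro j
      by_cases hj : j = k
      · subst hj
        rw [hV'def, Function.update_self]
        exact ⟨(hV j).1.inter isOpen_interior, (hV j).2, mem_interior_iff_mem_nhds.2 hU₁⟩
      · rw [hV'def, Function.update_of_ne hj]
        exact hV j
    have hV'V : ∀ j, V' j ⊆ V j := by
      intro j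
      by_cases hj : j = k
      · subst hj
        rw [hV'def, Function.update_self]
        exact Set.inter_subset_left
      · rw [hV'def, Function.update_of_ne hj]
    obtain ⟨N₀, hN₀⟩ := ih (Nat.le_of_succ_le hk) hV'
    refine ⟨max N₀ N₁, fun C w hw hC => ?_⟩
    have h1 := hN₀ C w hw fun j hj => (le_max_left _ _).trans (hC j (Nat.lt_succ_of_lt hj))
    set E := {ω | ∀ j ≤ k, A.cov C (w ω) j ∈ V' j} with hE
    rw [setOf_forall_cov_mem_succ, Finset.sum_range_succ, neg_add, Real.exp_add,
      ENNReal.ofReal_mul (Real.exp_pos _).le, mul_comm]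
    calc ENNReal.ofReal (Real.exp (-(C (k + 1) * (b k + ε)))) *
          ENNReal.ofReal (Real.exp (-∑ j ∈ Finset.range k, (C (j + 1) : ℝ) * (b j + ε)))
        ≤ ENNReal.ofReal (Real.exp (-(C (k + 1) * (b k + ε)))) * P E := by gcongr
      _ ≤ P (E ∩ {ω | A.cov C (w ω) (k + 1) ∈ V (k + 1)}) := by
          refine hw.le_measure_inter_cov_mem hA hk (measurableSet_forall_cov_mem hA w
            (Nat.le_of_succ_le hk) fun j _ => (hV' j).1.measurableSet)
            (hV (k + 1)).1.measurableSet fun ω hω => ?_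
          have h2 : A.cov C (w ω) k ∈ U₁ := by
            have := hω k le_rfl
            rw [hV'def, Function.update_self] at this
            exact interior_subset this.2
          exact hU _ h2 _ ((le_max_right _ _).trans (hC k (Nat.lt_succ_self k)))
      _ ≤ _ := measure_mono (Set.inter_subset_inter_left _ fun ω hω j hj => hV'V j (hω j hj))

theorem exists_trace_bounds {R : ℕ → ℝ → ℝ → Prop} {L : ℕ} (r₀ : ℝ)
    (h : ∀ j < L, ∀ r, ∃ r', R j r r') :
    ∃ r : ℕ → ℝ, r 0 = r₀ ∧ ∀ j < L, R j (r j) (r (j + 1)) := by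
  have h' : ∀ j r, ∃ r', j < L → R j r r' := fun j r => by
    by_cases hj : j < L
    · obtain ⟨r', hr'⟩ := h j hj r
      exact ⟨r', fun _ => hr'⟩
    · exact ⟨0, fun hj' => absurd hj' hj⟩
  choose f hf using h'
  exact ⟨fun j => Nat.rec r₀ f j, rfl, fun j hj => hf j _ hj⟩

/-- Union bound over the first layer whose trace is too large: while the previous trace is bounded,
the one-step tail estimate applies. The radii are chosen recursively from K^(1). -/
theorem exists_measure_trace_gt_le (hA : A.ContinuousFeatures) (hG : A.NearQuadraticLayers)
    (M : ℕ → ℝ) :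
    ∃ r : ℕ → ℝ, ∀ (C : ℕ → ℕ) (w : Ω → A.Weights C), IsGaussianWeights P w → ∀ k ≤ A.L,
      P {ω | ∀ j ≤ k, (A.cov C (w ω) j).1.trace ≤ r j}ᶜ ≤
        ∑ j ∈ Finset.range k, ENNReal.ofReal (Real.exp (-(C (j + 1) * M j))) := by
  obtain ⟨r, hr0, hr⟩ := exists_trace_bounds (L := A.L) (R := fun j r r' =>
    ∀ x : PSDCone (A.Idx (j + 1)), x.1.trace ≤ r → ∀ N : ℕ,
      layerLaw x N {z | r' < (A.avgG (j + 1) z).1.trace} ≤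
        ENNReal.ofReal (Real.exp (-(N * M j)))) A.K1.1.trace
    fun j hj r => exists_layerLaw_trace_gt_le (hG (j + 1) (Nat.le_add_left 1 j) hj) r (M j)
  refine ⟨r, fun C w hw k hk => ?_⟩
  induction k with
  | zero =>
    have : {ω | ∀ j ≤ 0, (A.cov C (w ω) j).1.trace ≤ r j} = Set.univ := by
      refine Set.eq_univ_of_forall fun ω j hj => ?_
      obtain rfl : j = 0 := Nat.le_zero.1 hj
      exact hr0.ge
    rw [this]
    simp
  | succ k ih =>
    rw [Finset.sum_range_succ]
    set V : ∀ j, Set (PSDCone (A.Idx (j + 1))) := fun j => {Q | Q.1.trace ≤ r j} with hV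
    have hVm : ∀ j, MeasurableSet (V j) := fun j =>
      (isClosed_le PSDCone.continuous_trace continuous_const).measurableSet
    set E := {ω | ∀ j ≤ k, A.cov C (w ω) j ∈ V j} with hE
    have hsub : {ω | ∀ j ≤ k + 1, (A.cov C (w ω) j).1.trace ≤ r j}ᶜ ⊆
        Eᶜ ∪ (E ∩ {ω | A.cov C (w ω) (k + 1) ∈ (V (k + 1))ᶜ}) := by
      intro ω hω
      by_cases hωE : ω ∈ E
      · refine Or.inr ⟨hωE, fun hV' => hω ?_⟩
        have := (setOf_forall_cov_mem_succ w V k).ge ⟨hωE, hV'⟩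
        exact this
      · exact Or.inl hωE
    refine (measure_mono hsub).trans ((measure_union_le _ _).trans
      (add_le_add (ih (Nat.le_of_succ_le hk)) ?_))
    refine (hw.measure_inter_cov_mem_le hA hk (measurableSet_forall_cov_mem hA w
      (Nat.le_of_succ_le hk) fun j _ => hVm j) (hVm (k + 1)).compl
      (b := ENNReal.ofReal (Real.exp (-(C (k + 1) * M k)))) fun ω hω => ?_).trans
      (mul_le_of_le_one_right' prob_le_one)
    refine le_trans (measure_mono fun z hz => ?_)
      (hr k hk (A.cov C (w ω) k) (hω k le_rfl) (C (k + 1)))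
    exact not_le.1 (show ¬ (A.avgG (k + 1) z).1.trace ≤ r (k + 1) from hz)

end ConvNet

/-! ### The joint rate function is good -/

namespace ConvNet

variable (A : ConvNet)

/-- A tuple `(Q_2, …, Q_{L+1})` as a sequence starting with `K^{(1)}`; the entries that follow the
tuple are set to `0`. -/
def extend (Q : A.CovTuple) : (j : ℕ) → PSDCone (A.Idx (j + 1))
  | 0 => A.K1
  | j + 1 => if h : j < A.L then Q ⟨j, h⟩ else ⟨0, Matrix.PosSemidef.zero⟩

variable {A}

theorem extend_succ (Q : A.CovTuple) (k : Fin A.L) : A.extend Q (k + 1) = Q k :=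
  dif_pos k.2

theorem entry_eq_extend (Q : A.CovTuple) {k : ℕ} (hk : k ≤ A.L) :
    A.entry Q k hk = A.extend Q k := by
  cases k with
  | zero => rfl
  | succ k => exact (extend_succ Q ⟨k, hk⟩).symm

theorem continuous_extend (j : ℕ) : Continuous fun Q : A.CovTuple => A.extend Q j := by
  cases j with
  | zero => exact continuous_const
  | succ j =>
    by_cases h : j < A.L
    · have : (fun Q : A.CovTuple => A.extend Q (j + 1)) = fun Q => Q ⟨j, h⟩ :=
        funext fun Q => extend_succ Q ⟨j, h⟩
      rw [this]
      exact continuous_apply _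
    · have : (fun Q : A.CovTuple => A.extend Q (j + 1)) =
          fun _ => ⟨0, Matrix.PosSemidef.zero⟩ := funext fun Q => dif_neg h
      rw [this]
      exact continuous_const

theorem rate_eq (α : ℕ → ℝ) (Q : A.CovTuple) :
    A.rate α Q = ∑ k : Fin A.L, (α (k + 1) : EReal) *
      A.condRate (k + 1) (A.extend Q (k + 1)) (A.extend Q k) := by
  unfold rate
  refine Finset.sum_congr rfl fun k _ => ?_
  rw [entry_eq_extend, extend_succ]

theorem mul_condRate_nonneg {α : ℕ → ℝ} (hα : ∀ ℓ, 1 ≤ ℓ → ℓ ≤ A.L → 0 < α ℓ)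
    (Q : A.CovTuple) (k : Fin A.L) :
    0 ≤ (α (k + 1) : EReal) * A.condRate (k + 1) (A.extend Q (k + 1)) (A.extend Q k) :=
  mul_nonneg (by exact_mod_cast (hα (k + 1) (Nat.le_add_left 1 k) k.2).le) (condRate_nonneg _ _)

theorem rate_nonneg {α : ℕ → ℝ} (hα : ∀ ℓ, 1 ≤ ℓ → ℓ ≤ A.L → 0 < α ℓ) (Q : A.CovTuple) :
    0 ≤ A.rate α Q := by
  rw [rate_eq]
  exact Finset.sum_nonneg fun k _ => mul_condRate_nonneg hα Q k

theorem condRate_le_of_rate_le {α : ℕ → ℝ} (hα : ∀ ℓ, 1 ≤ ℓ → ℓ ≤ A.L → 0 < α ℓ)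
    {Q : A.CovTuple} {a : ℝ} (h : A.rate α Q ≤ a) {j : ℕ} (hj : j < A.L) :
    A.condRate (j + 1) (A.extend Q (j + 1)) (A.extend Q j) ≤ ((a / α (j + 1) : ℝ) : EReal) := by
  rw [rate_eq] at h
  have h1 := (Finset.single_le_sum (fun k _ => mul_condRate_nonneg hα Q k)
    (Finset.mem_univ (⟨j, hj⟩ : Fin A.L))).trans h
  rw [EReal.coe_div, EReal.le_div_iff_mul_le
    (by exact_mod_cast hα (j + 1) (Nat.le_add_left 1 j) hj) (EReal.coe_ne_top _), mul_comm]
  exact h1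

/-- Each conditional rate is jointly lower semicontinuous in target and source, and positive
coefficients preserve this for the sum. -/
theorem lowerSemicontinuous_rate {α : ℕ → ℝ} (hG : A.NearQuadraticLayers)
    (hα : ∀ ℓ, 1 ≤ ℓ → ℓ ≤ A.L → 0 < α ℓ) : LowerSemicontinuous (A.rate α) := by
  intro Q y hy
  obtain ⟨a, hya, haQ⟩ := EReal.lt_iff_exists_real_btwn.1 hy
  rw [rate_eq] at haQ
  obtain ⟨b, hb, hab⟩ := exists_real_lt_of_lt_sum_mul
    (fun k : Fin A.L => hα (k + 1) (Nat.le_add_left 1 k) k.2) (fun k => condRate_nonneg _ _) haQ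
  have h : ∀ k : Fin A.L, ∀ᶠ Q' in 𝓝 Q,
      (b k : EReal) < A.condRate (k + 1) (A.extend Q' (k + 1)) (A.extend Q' k) := fun k =>
    ((continuous_extend (A := A) (k + 1)).prodMk (continuous_extend k)).tendsto Q
      |>.eventually (eventually_lt_condRate (hG (k + 1) (Nat.le_add_left 1 k) k.2) (hb k))
  filter_upwards [eventually_all.2 h] with Q' hQ'
  refine hya.trans (lt_of_lt_of_le (EReal.coe_lt_coe_iff.2 hab) ?_)
  rw [rate_eq, coe_sum_ereal]
  refine Finset.sum_le_sum fun k _ => ?_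
  rw [EReal.coe_mul]
  exact mul_le_mul_of_nonneg_left (hQ' k).le
    (by exact_mod_cast (hα (k + 1) (Nat.le_add_left 1 k) k.2).le)

theorem isCompact_setOf_trace_le (r : ℕ → ℝ) :
    IsCompact {Q : A.CovTuple | ∀ k : Fin A.L, (Q k).1.trace ≤ r (k + 1)} := by
  have h : {Q : A.CovTuple | ∀ k : Fin A.L, (Q k).1.trace ≤ r (k + 1)} =
      Set.univ.pi fun k : Fin A.L => {q | q.1.trace ≤ r (k + 1)} := by
    ext Q
    simp
  rw [h]
  exact isCompact_univ_pi fun k => PSDCone.isCompact_trace_le (r (k + 1))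

/-- As all terms are nonnegative, a bound on the joint rate bounds every conditional rate; starting
from K^(1), traces are then bounded layer by layer. -/
theorem isGoodRateFunction_rate {α : ℕ → ℝ} (hG : A.NearQuadraticLayers)
    (hα : ∀ ℓ, 1 ≤ ℓ → ℓ ≤ A.L → 0 < α ℓ) : IsGoodRateFunction (A.rate α) := by
  refine ⟨fun Q => ne_bot_of_le_ne_bot EReal.zero_ne_bot (rate_nonneg hα Q),
    lowerSemicontinuous_rate hG hα, fun a => ?_⟩
  obtain ⟨r, hr0, hr⟩ := exists_trace_bounds (L := A.L) (R := fun j r r' =>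
    ∀ (Q₂ : PSDCone (A.Idx (j + 1 + 1))) (Q₁ : PSDCone (A.Idx (j + 1))), Q₁.1.trace ≤ r →
      A.condRate (j + 1) Q₂ Q₁ ≤ ((a / α (j + 1) : ℝ) : EReal) → Q₂.1.trace ≤ r') A.K1.1.trace
    fun j hj r => exists_trace_le_of_condRate_le (hG (j + 1) (Nat.le_add_left 1 j) hj) r _
  refine (isCompact_setOf_trace_le (A := A) r).of_isClosed_subset
    ((lowerSemicontinuous_rate hG hα).isClosed_preimage _) fun Q hQ => ?_
  have h : ∀ j ≤ A.L, (A.extend Q j).1.trace ≤ r j := by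
    intro j
    induction j with
    | zero => exact fun _ => hr0.ge
    | succ j ih =>
      exact fun hj => hr j hj _ _ (ih (Nat.le_of_succ_le hj)) (condRate_le_of_rate_le hα hQ hj)
  intro k
  rw [← extend_succ Q k]
  exact h _ k.2

end ConvNet

/-! ### The large deviation principle for measurable weights -/

namespace ConvNet

variable {A : ConvNet} {α : ℕ → ℝ} {C : ℕ → ℕ → ℕ}

theorem tendsto_sum_channels_mul_div
    (hC : ∀ ℓ, 1 ≤ ℓ → ℓ ≤ A.L → Tendsto (fun n : ℕ => (C n ℓ : ℝ) / n) atTop (𝓝 (α ℓ)))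
    (a : ℕ → ℝ) :
    Tendsto (fun n : ℕ => (∑ j ∈ Finset.range A.L, (C n (j + 1) : ℝ) * a j) / n) atTop
      (𝓝 (∑ j ∈ Finset.range A.L, α (j + 1) * a j)) := by
  simp_rw [Finset.sum_div]
  refine tendsto_finsetSum _ fun j hj => ?_
  simp_rw [mul_div_right_comm]
  exact (hC (j + 1) (Nat.le_add_left 1 j) (Finset.mem_range.1 hj)).mul_const _

theorem tendsto_channels_atTop (hα : ∀ ℓ, 1 ≤ ℓ → ℓ ≤ A.L → 0 < α ℓ)
    (hC : ∀ ℓ, 1 ≤ ℓ → ℓ ≤ A.L → Tendsto (fun n : ℕ => (C n ℓ : ℝ) / n) atTop (𝓝 (α ℓ)))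
    {j : ℕ} (hj : j < A.L) : Tendsto (fun n => C n (j + 1)) atTop atTop := by
  have h := Tendsto.pos_mul_atTop (hα (j + 1) (Nat.le_add_left 1 j) hj)
    (hC (j + 1) (Nat.le_add_left 1 j) hj) (tendsto_natCast_atTop_atTop (R := ℝ))
  refine tendsto_natCast_atTop_iff.1 (h.congr' ?_)
  filter_upwards [eventually_gt_atTop 0] with n hn
  exact div_mul_cancel₀ _ (by exact_mod_cast hn.ne')

theorem exists_rate_eq_sum {Q : A.CovTuple} (hα : ∀ ℓ, 1 ≤ ℓ → ℓ ≤ A.L → 0 < α ℓ)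
    (h : A.rate α Q ≠ ⊤) :
    ∃ b : ℕ → ℝ, (∀ j < A.L, A.condRate (j + 1) (A.extend Q (j + 1)) (A.extend Q j) = b j) ∧
      A.rate α Q = ((∑ j ∈ Finset.range A.L, α (j + 1) * b j : ℝ) : EReal) := by
  have hb : ∀ j < A.L, A.condRate (j + 1) (A.extend Q (j + 1)) (A.extend Q j) =
      ((A.condRate (j + 1) (A.extend Q (j + 1)) (A.extend Q j)).toReal : EReal) := by
    intro j hj
    refine (EReal.coe_toReal (fun htop => ?_)
      (ne_bot_of_le_ne_bot EReal.zero_ne_bot (condRate_nonneg _ _))).symm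
    have hr := EReal.coe_toReal h (ne_bot_of_le_ne_bot EReal.zero_ne_bot (rate_nonneg hα Q))
    have h1 := condRate_le_of_rate_le hα hr.ge hj
    rw [htop] at h1
    exact (EReal.coe_lt_top _).not_ge h1
  refine ⟨_, hb, ?_⟩
  rw [rate_eq, coe_sum_ereal, Finset.sum_range]
  refine Finset.sum_congr rfl fun k _ => ?_
  rw [EReal.coe_mul, ← hb k k.2]

variable {Ω : Type*} [MeasurableSpace Ω] {P : Measure Ω} {w : (n : ℕ) → Ω → A.Weights (C n)}

theorem measurable_covTuple (hA : A.ContinuousFeatures) (hw : ∀ n, IsGaussianWeights P (w n))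
    (n : ℕ) : Measurable fun ω => A.covTuple (C n) (w n ω) :=
  measurable_pi_lambda _ fun k => measurable_cov hA (j := k + 1) k.2
    fun ℓ hℓ => (hw n).measurable ℓ ((Nat.le_of_lt hℓ).trans k.2)

section LDP

variable [IsProbabilityMeasure P]

theorem neg_rate_le_liminf (hA : A.ContinuousFeatures) (hG : A.NearQuadraticLayers)
    (hα : ∀ ℓ, 1 ≤ ℓ → ℓ ≤ A.L → 0 < α ℓ)
    (hC : ∀ ℓ, 1 ≤ ℓ → ℓ ≤ A.L → Tendsto (fun n : ℕ => (C n ℓ : ℝ) / n) atTop (𝓝 (α ℓ)))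
    (hw : ∀ n, IsGaussianWeights P (w n)) {O : Set A.CovTuple} (hO : IsOpen O)
    {Q : A.CovTuple} (hQ : Q ∈ O) :
    -A.rate α Q ≤ liminf (fun n : ℕ =>
      ENNReal.log (P {ω | A.covTuple (C n) (w n ω) ∈ O}) / (n : EReal)) atTop := by
  refine EReal.ge_of_forall_gt_iff_ge.1 fun c hc => ?_
  have htop : A.rate α Q ≠ ⊤ := by
    intro h
    rw [h, EReal.neg_top] at hc
    exact not_lt_bot hc
  obtain ⟨b, hb, hbQ⟩ := exists_rate_eq_sum hα htop
  rw [hbQ, ← EReal.coe_neg, EReal.coe_lt_coe_iff] at hc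
  obtain ⟨u, hu, huO⟩ := isOpen_pi_iff'.1 hO Q hQ
  set B := ∑ j ∈ Finset.range A.L, α (j + 1) * b j with hB
  set S := ∑ j ∈ Finset.range A.L, α (j + 1) with hS
  have hS0 : 0 ≤ S := Finset.sum_nonneg fun j hj =>
    (hα (j + 1) (Nat.le_add_left 1 j) (Finset.mem_range.1 hj)).le
  -- The total loss εS stays strictly below -B - c; the added 1 also covers the empty sum.
  set ε := (-B - c) / (S + 1) with hε
  have hε0 : 0 < ε := div_pos (by linarith) (by linarith)
  have hεS : ε * (S + 1) = -B - c := div_mul_cancel₀ _ (by linarith)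
  set V : ∀ j, Set (PSDCone (A.Idx (j + 1))) := fun j =>
    match j with
    | 0 => Set.univ
    | j + 1 => {q | ∀ h : j < A.L, q ∈ u ⟨j, h⟩} with hV
  have hVQ : ∀ j, IsOpen (V j) ∧ A.extend Q j ∈ V j := by
    intro j
    cases j with
    | zero => exact ⟨isOpen_univ, trivial⟩
    | succ j =>
      by_cases h : j < A.L
      · have : V (j + 1) = u ⟨j, h⟩ := by
          ext q
          exact ⟨fun hq => hq h, fun hq _ => hq⟩
        rw [this, extend_succ Q ⟨j, h⟩]
        exact hu ⟨j, h⟩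
      · have : V (j + 1) = Set.univ := Set.eq_univ_of_forall fun q h' => absurd h' h
        rw [this]
        exact ⟨isOpen_univ, trivial⟩
  obtain ⟨N₀, hN₀⟩ := exists_le_measure_cov_mem (P := P) hA hG (q := A.extend Q) rfl
    (fun j hj => (hb j hj).le) hε0 le_rfl hVQ
  refine le_liminf_log_div (u := fun n =>
    ∑ j ∈ Finset.range A.L, (C n (j + 1) : ℝ) * (b j + ε)) ?_
    (tendsto_sum_channels_mul_div hC _) ?_
  · simp_rw [mul_add, Finset.sum_add_distrib, ← Finset.sum_mul]
    nlinarith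
  · have hev : ∀ᶠ n in atTop, ∀ k : Fin A.L, N₀ ≤ C n (k + 1) :=
      eventually_all.2 fun k => (tendsto_channels_atTop hα hC k.2).eventually_ge_atTop N₀
    filter_upwards [hev] with n hn
    refine (hN₀ (C n) (w n) (hw n) fun j hj => hn ⟨j, hj⟩).trans (measure_mono fun ω hω => ?_)
    exact huO fun k _ => hω (k + 1) k.2 k.2

theorem expSmall_measure_covTuple_mem (hA : A.ContinuousFeatures) (hG : A.NearQuadraticLayers)
    (hα : ∀ ℓ, 1 ≤ ℓ → ℓ ≤ A.L → 0 < α ℓ)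
    (hC : ∀ ℓ, 1 ≤ ℓ → ℓ ≤ A.L → Tendsto (fun n : ℕ => (C n ℓ : ℝ) / n) atTop (𝓝 (α ℓ)))
    (hw : ∀ n, IsGaussianWeights P (w n)) {Q : A.CovTuple} {a : ℝ} (ha : a < A.rate α Q) :
    ∃ U ∈ 𝓝 Q, ExpSmall a fun n => P {ω | A.covTuple (C n) (w n ω) ∈ U} := by
  rw [rate_eq] at ha
  obtain ⟨y, hy, hay⟩ := exists_real_lt_of_lt_sum_mul
    (fun k : Fin A.L => hα (k + 1) (Nat.le_add_left 1 k) k.2) (fun k => condRate_nonneg _ _) ha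
  set b : ℕ → ℝ := fun j => if h : j < A.L then y ⟨j, h⟩ else 0 with hb
  have hby : ∀ k : Fin A.L, b k = y k := fun k => dif_pos k.2
  obtain ⟨V, hV, hVP⟩ := exists_isOpen_measure_cov_mem_le (P := P) hA hG (A.extend Q) (a := b)
    fun j hj => by rw [hby ⟨j, hj⟩]; exact hy ⟨j, hj⟩
  refine ⟨⋂ j ∈ Finset.range (A.L + 1), {Q' | A.extend Q' j ∈ V j},
    (biInter_finset_mem _).2 fun j _ =>
      ((hV j).1.preimage (continuous_extend j)).mem_nhds (hV j).2, ?_⟩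
  have hsum : a < ∑ j ∈ Finset.range A.L, α (j + 1) * b j := by
    rw [Finset.sum_range]
    simpa only [hby] using hay
  refine (expSmall_of_tendsto hsum (tendsto_sum_channels_mul_div hC b)).mono fun n => ?_
  refine (measure_mono fun ω hω j hj => ?_).trans (hVP (C n) (w n) (hw n) A.L le_rfl)
  have h := Set.mem_iInter₂.1 hω j (Finset.mem_range.2 (Nat.lt_succ_of_le hj))
  cases j with
  | zero => exact h
  | succ j =>
    have h' : A.extend (A.covTuple (C n) (w n ω)) (j + 1) ∈ V (j + 1) := h
    rwa [extend_succ _ ⟨j, hj⟩] at h'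

/-- Compactness and exponential tightness: inside the trace-bounded set K finitely many local bounds
suffice, outside K the tail is negligible. -/
theorem limsup_le_neg_iInf_rate (hA : A.ContinuousFeatures) (hG : A.NearQuadraticLayers)
    (hα : ∀ ℓ, 1 ≤ ℓ → ℓ ≤ A.L → 0 < α ℓ)
    (hC : ∀ ℓ, 1 ≤ ℓ → ℓ ≤ A.L → Tendsto (fun n : ℕ => (C n ℓ : ℝ) / n) atTop (𝓝 (α ℓ)))
    (hw : ∀ n, IsGaussianWeights P (w n)) {F : Set A.CovTuple} (hF : IsClosed F) :
    limsup (fun n : ℕ =>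
      ENNReal.log (P {ω | A.covTuple (C n) (w n ω) ∈ F}) / (n : EReal)) atTop ≤
        -⨅ Q ∈ F, A.rate α Q := by
  refine EReal.le_of_forall_lt_iff_le.1 fun c hc => ?_
  rw [EReal.neg_lt_comm, ← EReal.coe_neg] at hc
  rw [← neg_neg c]
  refine ExpSmall.limsup_log_div_le ?_
  set a := -c with hadef
  -- Layer j + 1 has about n α (j + 1) channels, so each tail has exponent close to a + 1, above a.
  obtain ⟨r, hr⟩ := exists_measure_trace_gt_le (P := P) hA hG fun j => (a + 1) / α (j + 1)
  set K : Set A.CovTuple := {Q | ∀ k : Fin A.L, (Q k).1.trace ≤ r (k + 1)} with hK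
  have hFK : ExpSmall a fun n => P {ω | A.covTuple (C n) (w n ω) ∈ F ∩ K} := by
    refine ((isCompact_setOf_trace_le r).inter_left hF).induction_on
      (p := fun s => ExpSmall a fun n => P {ω | A.covTuple (C n) (w n ω) ∈ s}) ?_ ?_ ?_ ?_
    · simpa using ExpSmall.zero a
    · exact fun s t hst ht => ht.mono fun n => measure_mono fun ω hω => hst hω
    · exact fun s t hs ht => (hs.add ht).mono fun n => measure_union_le _ _
    · intro Q hQ
      obtain ⟨U, hU, h⟩ := expSmall_measure_covTuple_mem hA hG hα hC hw
        (hc.trans_le (iInf₂_le Q hQ.1))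
      exact ⟨U, mem_nhdsWithin_of_mem_nhds hU, h⟩
  have htail : ExpSmall a fun n =>
      P {ω | ∀ j ≤ A.L, (A.cov (C n) (w n ω) j).1.trace ≤ r j}ᶜ := by
    refine (ExpSmall.sum (Finset.range A.L) (f := fun j n =>
      ENNReal.ofReal (Real.exp (-(C n (j + 1) * ((a + 1) / α (j + 1)))))) fun j hj => ?_).mono
      fun n => hr (C n) (w n) (hw n) A.L le_rfl
    have hj' := Finset.mem_range.1 hj
    have hpos := hα (j + 1) (Nat.le_add_left 1 j) hj'
    refine expSmall_of_tendsto (c := α (j + 1) * ((a + 1) / α (j + 1))) ?_ ?_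
    · rw [mul_div_cancel₀ _ hpos.ne']
      exact lt_add_one a
    · simp_rw [mul_div_right_comm]
      exact (hC (j + 1) (Nat.le_add_left 1 j) hj').mul_const _
  refine (hFK.add htail).mono fun n => (measure_mono fun ω hω => ?_).trans (measure_union_le _ _)
  by_cases h : ∀ j ≤ A.L, (A.cov (C n) (w n ω) j).1.trace ≤ r j
  · exact Or.inl ⟨hω, fun k => h (k + 1) k.2⟩
  · exact Or.inr h

theorem satisfiesLDP_covTuple (hA : A.ContinuousFeatures) (hG : A.NearQuadraticLayers)
    (hα : ∀ ℓ, 1 ≤ ℓ → ℓ ≤ A.L → 0 < α ℓ)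
    (hC : ∀ ℓ, 1 ≤ ℓ → ℓ ≤ A.L → Tendsto (fun n : ℕ => (C n ℓ : ℝ) / n) atTop (𝓝 (α ℓ)))
    (hw : ∀ n, IsGaussianWeights P (w n)) :
    SatisfiesLDP (fun n => P.map fun ω => A.covTuple (C n) (w n ω)) (A.rate α) := by
  have hm := measurable_covTuple hA hw
  constructor
  · intro O hO
    simp_rw [Measure.map_apply (hm _) hO.measurableSet]
    exact EReal.neg_le.1 (le_iInf₂ fun Q hQ =>
      EReal.neg_le.1 (neg_rate_le_liminf hA hG hα hC hw hO hQ))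
  · intro F hF
    simp_rw [Measure.map_apply (hm _) hF.measurableSet]
    exact limsup_le_neg_iInf_rate hA hG hα hC hw hF

end LDP

/-! ### Dependence of the covariances on the weights -/

theorem preact_congr {C : ℕ → ℕ} {w w' : A.Weights C} {j : ℕ} (h : ∀ ℓ ≤ j, w ℓ = w' ℓ) :
    A.preact C w j = A.preact C w' j := by
  induction j with
  | zero =>
    funext c p
    rw [preact, preact, h 0 le_rfl]
  | succ j ih =>
    funext c p
    rw [preact, preact, h (j + 1) le_rfl, ih fun ℓ hℓ => h ℓ (Nat.le_succ_of_le hℓ)]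

theorem covTuple_congr {C : ℕ → ℕ} {w w' : A.Weights C} (h : ∀ ℓ ≤ A.L, w ℓ = w' ℓ) :
    A.covTuple C w = A.covTuple C w' := by
  funext k
  refine Subtype.ext ?_
  change A.KMat C w k = A.KMat C w' k
  rw [KMat, KMat, preact_congr fun ℓ hℓ => h ℓ (hℓ.trans k.2.le)]

/-- The weights are only almost everywhere measurable; measurable modifications keep laws and
independence, and the tuple changes on a null set because only finitely many weights enter it. -/
theorem exists_isGaussianWeights {C : ℕ → ℕ}
    {W : (ℓ : ℕ) → A.Mask ℓ → Fin (A.chan C ℓ) → Fin (A.chan C (ℓ + 1)) → Ω → ℝ}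
    (hlaw : ∀ ℓ ≤ A.L, ∀ m c' c, HasLaw (W ℓ m c' c) (gaussianReal 0 (A.prec ℓ)⁻¹) P)
    (hindep : iIndepFun (fun p : A.WeightIdx C => W p.1 p.2.1 p.2.2.1 p.2.2.2) P) :
    ∃ w : Ω → A.Weights C, IsGaussianWeights P w ∧
      (fun ω => A.covTuple C fun ℓ m c' c => W ℓ m c' c ω) =ᵐ[P] fun ω => A.covTuple C (w ω) := by
  have h : ∀ ℓ m c' c, ∃ f : Ω → ℝ, ℓ ≤ A.L → Measurable f ∧ W ℓ m c' c =ᵐ[P] f := by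
    intro ℓ m c' c
    by_cases hℓ : ℓ ≤ A.L
    · exact ⟨_, fun _ => ⟨(hlaw ℓ hℓ m c' c).aemeasurable.measurable_mk,
        (hlaw ℓ hℓ m c' c).aemeasurable.ae_eq_mk⟩⟩
    · exact ⟨0, fun h => absurd h hℓ⟩
  choose f hf using h
  refine ⟨fun ω ℓ m c' c => f ℓ m c' c ω, ⟨fun ℓ hℓ m c' c => (hf ℓ m c' c hℓ).1,
    fun ℓ hℓ m c' c => ?_, ?_⟩, ?_⟩
  · rw [← (hlaw ℓ hℓ m c' c).map_eq]
    exact (Measure.map_congr (hf ℓ m c' c hℓ).2).symm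
  · exact hindep.congr fun p => (hf _ _ _ _ (Nat.le_of_lt_succ p.1.2)).2
  · have hae : ∀ᵐ ω ∂P, ∀ p : A.WeightIdx C,
        W p.1 p.2.1 p.2.2.1 p.2.2.2 ω = f p.1 p.2.1 p.2.2.1 p.2.2.2 ω :=
      ae_all_iff.2 fun p => (hf _ _ _ _ (Nat.le_of_lt_succ p.1.2)).2
    filter_upwards [hae] with ω hω
    refine covTuple_congr fun ℓ hℓ => ?_
    funext m c' c
    exact hω ⟨⟨ℓ, Nat.lt_succ_of_le hℓ⟩, m, c', c⟩

end ConvNet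

end

theorem theorem3 {Ω : Type*} [MeasurableSpace Ω] (Pr : Measure Ω) [IsProbabilityMeasure Pr]
    (A : ConvNet)
    (C : ℕ → ℕ → ℕ) (α : ℕ → ℝ)
    (W : (n : ℕ) → (ℓ : ℕ) → (m : A.Mask ℓ) → (c' : Fin (A.chan (C n) ℓ)) →
      (c : Fin (A.chan (C n) (ℓ + 1))) → Ω → ℝ)
    -- Gaussian prior: independent weights with law `N(0, 1 / λ_ℓ)` in the layer `ℓ`
    (hprec : ∀ ℓ ≤ A.L, 0 < A.prec ℓ)
    (hlaw : ∀ (n ℓ : ℕ), ℓ ≤ A.L → ∀ (m : A.Mask ℓ) (c' : Fin (A.chan (C n) ℓ))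
      (c : Fin (A.chan (C n) (ℓ + 1))),
      HasLaw (W n ℓ m c' c) (gaussianReal 0 (A.prec ℓ)⁻¹) Pr)
    (hindep : ∀ n : ℕ, iIndepFun
      (fun p : A.WeightIdx (C n) => W n p.1 p.2.1 p.2.2.1 p.2.2.2) Pr)
    -- infinite channels limit
    (hα : ∀ ℓ, 1 ≤ ℓ → ℓ ≤ A.L → 0 < α ℓ)
    (hC : ∀ ℓ, 1 ≤ ℓ → ℓ ≤ A.L →
      Tendsto (fun n : ℕ => (C n ℓ : ℝ) / (n : ℝ)) atTop (𝓝 (α ℓ)))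
    -- asymptotic Lipschitz condition
    (hσ : AsympLipschitzActivation A.σ)
    (hR : ∀ ℓ, 1 ≤ ℓ → ℓ ≤ A.L → ∀ i : Fin (A.N (ℓ + 1)), AsympLipschitzMap (A.R ℓ i)) :
    (∀ n, AEMeasurable (fun ω => A.covTuple (C n) (fun ℓ m c' c => W n ℓ m c' c ω)) Pr) ∧
    IsGoodRateFunction (A.rate α) ∧
    SatisfiesLDP
      (fun n => Pr.map (fun ω => A.covTuple (C n) (fun ℓ m c' c => W n ℓ m c' c ω)))
      (A.rate α) := by
  have hA : A.ContinuousFeatures := fun ℓ h1 hℓ => ConvNet.continuous_feature hσ (hR ℓ h1 hℓ)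
  have hG : A.NearQuadraticLayers := fun ℓ h1 hℓ => ConvNet.nearQuadratic_dualG hσ (hR ℓ h1 hℓ)
  choose w hw hWw using fun n => ConvNet.exists_isGaussianWeights (hlaw n) (hindep n)
  refine ⟨fun n => (ConvNet.measurable_covTuple hA hw n).aemeasurable.congr (hWw n).symm,
    ConvNet.isGoodRateFunction_rate hG hα, ?_⟩
  simp_rw [fun n => Measure.map_congr (hWw n)]
  exact ConvNet.satisfiesLDP_covTuple hA hG hα hC hw
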